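/- Fix a number $d\ge 1$ of objectives. A multi-objective mixed-integer linear program (MOMILP) $I$ is given by $n_{\mathbb R}+n_{\mathbb Z}=n\ge 1$, $m\ge 1$, $Q\in\mathbb Q^{d\times n}$, $A\in\mathbb Q^{m\times n}$, $b\in\mathbb Q^m$. Its feasible set is $X=\{x\in\mathbb R^{n_{\mathbb R}}\times\mathbb Z^{n_{\mathbb Z}}: Ax\ge b\}$, its objective (to be minimised) is $f(x)=Qx$, and we assume $f(x)\in\mathbb R^d_{\ge 0}$ for all $x\in X$. Let $\langle\cdot\rangle$ denote binary encoding length, and let $s$ be a fixed polynomial. A *plane separating oracle* $\mathsf{hpO}$ for $I$ takes a halfspace $H=\{z\in\mathbb R^d: w^{\mathsf T}z\ge c\}$ with $w\in\mathbb R^d_{\ge0}\setminus\{0\}$, given by $w$ and $c$, and returns either "inside", in which case $f(x)\in H$ for all $x\in X$, or a rational point $x\in X$ with $\langle x\rangle\le s(\langle I\rangle)$ and $f(x)\notin H$. For a polyhedron $\mathcal P$ let $\mathcal H(\mathcal P)$ be the set of halfspaces that contain $\mathcal P$ and whose boundary contains a facet of $\mathcal P$. For finite $R\subseteq X$ put $\mathcal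 A(R)=\mathsf{conv}\{f(x):x\in R\}+\mathbb R^d_{\ge0}$. The *inner approximation algorithm*, parameterised by a real $\varepsilon>0$ and by $\mathsf{hpO}$, gets $I$ and a rational $x^{\mathrm{init}}\in X$ with $\langle x^{\mathrm{init}}\rangle\le s(\langle I\rangle)$. It starts with $R=\{x^{\mathrm{init}}\}$ and $F=\emptyset$. While $\mathcal H(\mathcal A(R))\setminus F\ne\emptyset$, it picks an arbitrary $H=\{z: w^{\mathsf T}z\ge c\}$ in this set and calls $\mathsf{hpO}$ on $H_{1+\varepsilon}=\{z:(1+\varepsilon)w^{\mathsf T}z\ge c\}$; if a solution $x^*$ is returned, $x^*$ is added to $R$, and otherwise $H$ is added to $F$. At the end it returns $R$. **Theorem.** The running time of the inner approximation algorithm is polynomial in $\langle I\rangle$, $\varepsilon^{-1}$ and $T_{\mathsf{hpO}}$, where $T_{\mathsf{hpO}}$ is an upper bound on the running time of the oracle on the halfspaces on which it is called. More precisely, for every $d\ge1$ there is a random access machine program over $\mathbb Q$ (with arithmetic, comparisons and indirect addressing, and with an instruction that calls $\mathsf{hpO}$ on $H_{1+\varepsilon}$ for a stored halfspace $H$) such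 that for every polynomial $s$ there are polynomials $p$ and $q$, depending only on $d$ and $s$, with the following properties for all $I$, $x^{\mathrm{init}}$, $\varepsilon$ and $\mathsf{hpO}$ as above: 1. However the halfspaces $H$ are picked, the algorithm performs at most $q(\langle I\rangle,\varepsilon^{-1})$ iterations. 2. On input $(I,x^{\mathrm{init}})$ the program carries out a complete run of the algorithm and outputs the resulting set $R$ in time at most $p(\langle I\rangle,\varepsilon^{-1},T_{\mathsf{hpO}})$. Here each operation is charged the encoding lengths of the numbers involved, and each oracle call is in addition charged the running time of the oracle and the encoding lengths of $H$ and of the answer. -/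

import Mathlib

open scoped Matrix Pointwise

namespace InnerApx

/-! ### Binary encoding lengths -/

/-- Binary encoding length of a rational number: numerator, denominator and a sign bit. -/
def ratSize (q : ℚ) : ℕ := q.num.natAbs.size + q.den.size + 1

/-- Binary encoding length of a rational vector. -/
def vecSize {n : ℕ} (x : Fin n → ℚ) : ℕ := ∑ j, ratSize (x j)

/-- The real vector given by a rational vector. -/
def toReal {n : ℕ} (x : Fin n → ℚ) : Fin n → ℝ := fun j => (x j : ℝ)

/-! ### Multi-objective mixed-integer linear programs -/

/-- A multi-objective mixed-integer linear program with `d` objectives: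
minimise `Q x` subject to `A x ≥ b`, where the first `nR` variables are real
and the last `nZ` variables are integral. -/
structure MOMILP (d : ℕ) where
  nR : ℕ
  nZ : ℕ
  m : ℕ
  n_pos : 0 < nR + nZ
  m_pos : 0 < m
  Q : Matrix (Fin d) (Fin (nR + nZ)) ℚ
  A : Matrix (Fin m) (Fin (nR + nZ)) ℚ
  b : Fin m → ℚ

namespace MOMILP

variable {d : ℕ} (I : MOMILP d)

/-- The number of variables. -/
abbrev n : ℕ := I.nR + I.nZ

/-- The set `X ⊆ ℝⁿ` of feasible solutions. -/
def feasible : Set (Fin I.n → ℝ) :=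
  {x | (∀ i, (I.b i : ℝ) ≤ ∑ j, (I.A i j : ℝ) * x j) ∧
       ∀ j : Fin I.n, I.nR ≤ (j : ℕ) → ∃ z : ℤ, x j = z}

/-- The objective function `f x = Q x`. -/
def f (x : Fin I.n → ℝ) : Fin d → ℝ := fun i => ∑ j, (I.Q i j : ℝ) * x j

/-- The binary encoding length `⟨I⟩` of an instance. -/
def size : ℕ :=
  I.nR.size + I.nZ.size + I.m.size
    + (∑ i, ∑ j, ratSize (I.Q i j)) + (∑ i, ∑ j, ratSize (I.A i j)) + ∑ i, ratSize (I.b i)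

end MOMILP

/-! ### Halfspaces, faces and facets -/

/-- A halfspace `{z | wᵀ z ≥ c}` of `ℝᵈ`, given by `w ≠ 0` and `c`. -/
@[ext] structure Halfspace (d : ℕ) where
  normal : Fin d → ℝ
  offset : ℝ
  normal_ne : normal ≠ 0

namespace Halfspace

variable {d : ℕ}

/-- The points of the halfspace. -/
def toSet (H : Halfspace d) : Set (Fin d → ℝ) := {z | H.offset ≤ H.normal ⬝ᵥ z}

/-- The bounding hyperplane. -/
def boundary (H : Halfspace d) : Set (Fin d → ℝ) := {z | H.normal ⬝ᵥ z = H.offset}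

/-- `H_{1+ε} = {z | (1+ε) wᵀ z ≥ c}` for `H = {z | wᵀ z ≥ c}` and `ε > 0`. -/
def relax (H : Halfspace d) (ε : ℝ) (hε : 0 < ε) : Halfspace d where
  normal := (1 + ε) • H.normal
  offset := H.offset
  normal_ne := smul_ne_zero (by positivity) H.normal_ne

end Halfspace

/-- The dimension of (the affine hull of) a nonempty set. -/
noncomputable def affDim {d : ℕ} (S : Set (Fin d → ℝ)) : ℕ :=
  Module.finrank ℝ (vectorSpan ℝ S)

/-- A face of `P` is `P` itself or the intersection of `P` with the boundary of a halfspace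
that contains `P`. -/
def IsFace {d : ℕ} (P G : Set (Fin d → ℝ)) : Prop :=
  G = P ∨ ∃ H : Halfspace d, P ⊆ H.toSet ∧ G = P ∩ H.boundary

/-- A facet of `P` is a nonempty face of one dimension less than `P`. -/
def IsFacet {d : ℕ} (P G : Set (Fin d → ℝ)) : Prop :=
  IsFace P G ∧ G.Nonempty ∧ affDim G + 1 = affDim P

/-- `𝓗(P)`: the halfspaces (as point sets) that contain `P` and whose boundary contains a
facet of `P`. -/
def facetHalfspaces {d : ℕ} (P : Set (Fin d → ℝ)) : Set (Set (Fin d → ℝ)) :=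
  {S | ∃ H : Halfspace d, H.toSet = S ∧ P ⊆ S ∧ ∃ G, IsFacet P G ∧ G ⊆ H.boundary}

/-! ### The plane separating oracle -/

/-- A plane separating oracle for `I` with a running time: a black box that, on a halfspace
`H` with nonnegative normal vector, either answers `none` (inside), and then all
images lie in `H`, or answers with a feasible solution of encoding length at most `s(⟨I⟩)`
whose image is not in `H` (not inside). Nothing is required of it on other halfspaces. -/
structure PlaneSepOracle {d : ℕ} (I : MOMILP d) (s : Polynomial ℕ) where
  answer : Halfspace d → Option (Fin I.n → ℚ)
  /-- the running time on each halfspace -/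
  time : Halfspace d → ℕ
  inside : ∀ H : Halfspace d, 0 ≤ H.normal → answer H = none →
    ∀ x ∈ I.feasible, I.f x ∈ H.toSet
  notInside : ∀ (H : Halfspace d) (x : Fin I.n → ℚ), 0 ≤ H.normal → answer H = some x →
    toReal x ∈ I.feasible ∧ I.f (toReal x) ∉ H.toSet ∧ vecSize x ≤ s.eval I.size

/-! ### The inner approximation algorithm, as an abstract procedure -/

section Algorithm

variable {d : ℕ} (I : MOMILP d)

/-- The inner approximation polyhedron `conv {f x | x ∈ R} + ℝᵈ_{≥0}`. -/
def innerPoly (R : Finset (Fin I.n → ℚ)) : Set (Fin d → ℝ) :=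
  convexHull ℝ ((fun x => I.f (toReal x)) '' (R : Set (Fin I.n → ℚ))) + {z | 0 ≤ z}

/-- `Reaches I ε hε hpO x₀ ℓ R F`: started with the solution `x₀`, the algorithm can be in the
state `(R, F)` after `ℓ.length` iterations of its main loop, where `ℓ` lists, in order, the
halfspaces `H` picked in these iterations. In each iteration an arbitrary
`H ∈ 𝓗(A_k) \ F` is picked and the oracle is called for `H_{1+ε}`; a returned solution is added
to `R`, and otherwise `H` is added to `F`. -/
inductive Reaches (ε : ℝ) (hε : 0 < ε) (hpO : Halfspace d → Option (Fin I.n → ℚ))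
    (x₀ : Fin I.n → ℚ) :
    List (Halfspace d) → Finset (Fin I.n → ℚ) → Set (Set (Fin d → ℝ)) → Prop
  | start : Reaches ε hε hpO x₀ [] {x₀} ∅
  | notInside {ℓ R F} (H : Halfspace d) (x : Fin I.n → ℚ) :
      Reaches ε hε hpO x₀ ℓ R F →
      H.toSet ∈ facetHalfspaces (innerPoly I R) \ F →
      hpO (H.relax ε hε) = some x →
      Reaches ε hε hpO x₀ (ℓ ++ [H]) (insert x R) F
  | inside {ℓ R F} (H : Halfspace d) :
      Reaches ε hε hpO x₀ ℓ R F →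
      H.toSet ∈ facetHalfspaces (innerPoly I R) \ F →
      hpO (H.relax ε hε) = none →
      Reaches ε hε hpO x₀ (ℓ ++ [H]) R (F ∪ {H.toSet})

/-- A complete run: the main loop is left because `𝓗(A_k) \ F = ∅`; `R` is returned. -/
def IsRun (ε : ℝ) (hε : 0 < ε) (hpO : Halfspace d → Option (Fin I.n → ℚ))
    (x₀ : Fin I.n → ℚ) (ℓ : List (Halfspace d)) (R : Finset (Fin I.n → ℚ)) : Prop :=
  ∃ F, Reaches I ε hε hpO x₀ ℓ R F ∧ facetHalfspaces (innerPoly I R) \ F = ∅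

end Algorithm

/-! ### The machine model

A random access machine over the rational numbers. Its memory consists of arrays
`0, 1, 2, …` of rational numbers (a program mentions only finitely many of them), with
computed indices. Programs are finite and structured. Every operation is charged
the binary encoding lengths of the numbers involved (logarithmic cost criterion), and an oracle
call is in addition charged the running time of the oracle. -/

/-- Memory contents: `μ k i` is the content of cell `i` of array `k`. -/
abbrev Mem := ℕ → ℕ → ℚ

/-- Overwrite cell `i` of array `k`. -/
def Mem.set (μ : Mem) (k i : ℕ) (q : ℚ) : Mem :=
  Function.update μ k (Function.update (μ k) i q)

/-- Arithmetic expressions; `load k e` reads the cell of array `k` whose index is the value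
of `e` (rounded down to a natural number). -/
inductive Expr where
  | const (q : ℚ)
  | load (k : ℕ) (e : Expr)
  | add (e₁ e₂ : Expr)
  | sub (e₁ e₂ : Expr)
  | mul (e₁ e₂ : Expr)
  | div (e₁ e₂ : Expr)

namespace Expr

/-- The value of an expression. -/
def eval (μ : Mem) : Expr → ℚ
  | const q => q
  | load k e => μ k ⌊e.eval μ⌋₊
  | add e₁ e₂ => e₁.eval μ + e₂.eval μ
  | sub e₁ e₂ => e₁.eval μ - e₂.eval μ
  | mul e₁ e₂ => e₁.eval μ * e₂.eval μ
  | div e₁ e₂ => e₁.eval μ / e₂.eval μ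

/-- The cost of evaluating an expression: the encoding lengths of all constants, indices, loaded
numbers and intermediate results, plus one for each operation. -/
def cost (μ : Mem) : Expr → ℕ
  | const q => ratSize q + 1
  | load k e => e.cost μ + ratSize (μ k ⌊e.eval μ⌋₊) + 1
  | add e₁ e₂ => e₁.cost μ + e₂.cost μ + ratSize (e₁.eval μ + e₂.eval μ) + 1
  | sub e₁ e₂ => e₁.cost μ + e₂.cost μ + ratSize (e₁.eval μ - e₂.eval μ) + 1
  | mul e₁ e₂ => e₁.cost μ + e₂.cost μ + ratSize (e₁.eval μ * e₂.eval μ) + 1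
  | div e₁ e₂ => e₁.cost μ + e₂.cost μ + ratSize (e₁.eval μ / e₂.eval μ) + 1

end Expr

/-- Programs. `query k k'` calls the oracle on the halfspace stored in array `k` (normal vector
in cells `0, …, d-1`, right-hand side in cell `d`) and writes the answer to array `k'`. -/
inductive Prog where
  | skip
  | store (k : ℕ) (i e : Expr)
  | seq (p₁ p₂ : Prog)
  | ifLe (e₁ e₂ : Expr) (p₁ p₂ : Prog)
  | whileLt (e₁ e₂ : Expr) (p : Prog)
  | query (k k' : ℕ)

/-- Write an oracle answer to array `k'`: cell `0` holds `0` (inside) or `1` (not inside); in the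
second case cells `1, …, n` hold the returned solution. -/
def writeAnswer {n : ℕ} (μ : Mem) (k' : ℕ) : Option (Fin n → ℚ) → Mem
  | none => μ.set k' 0 0
  | some x => Function.update μ k' fun i =>
      if i = 0 then 1 else if h : i - 1 < n then x ⟨i - 1, h⟩ else μ k' i

/-- Encoding length of an oracle answer. -/
def answerSize {n : ℕ} : Option (Fin n → ℚ) → ℕ
  | none => 1
  | some x => vecSize x + 1

/-- `Exec ask askTime p μ t ℓ μ'`: started in memory `μ`, the program `p` halts in memory `μ'`
with total cost `t`, and `ℓ` lists, in order, the halfspaces on which it called the oracle. Here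
`ask` is the oracle and `askTime` its running time. (An oracle call whose array
does not hold a halfspace, i.e. with `w = 0`, blocks the machine.) -/
inductive Exec {d n : ℕ} (ask : Halfspace d → Option (Fin n → ℚ)) (askTime : Halfspace d → ℕ) :
    Prog → Mem → ℕ → List (Halfspace d) → Mem → Prop
  | skip (μ : Mem) : Exec ask askTime .skip μ 1 [] μ
  | store (μ : Mem) (k : ℕ) (i e : Expr) :
      Exec ask askTime (.store k i e) μ (i.cost μ + e.cost μ + 1) []
        (μ.set k ⌊i.eval μ⌋₊ (e.eval μ))
  | seq {p₁ p₂ : Prog} {μ μ' μ'' : Mem} {t₁ t₂ : ℕ} {ℓ₁ ℓ₂ : List (Halfspace d)} :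
      Exec ask askTime p₁ μ t₁ ℓ₁ μ' → Exec ask askTime p₂ μ' t₂ ℓ₂ μ'' →
      Exec ask askTime (.seq p₁ p₂) μ (t₁ + t₂ + 1) (ℓ₁ ++ ℓ₂) μ''
  | ifTrue {e₁ e₂ : Expr} {p₁ p₂ : Prog} {μ μ' : Mem} {t : ℕ} {ℓ : List (Halfspace d)} :
      e₁.eval μ ≤ e₂.eval μ → Exec ask askTime p₁ μ t ℓ μ' →
      Exec ask askTime (.ifLe e₁ e₂ p₁ p₂) μ (e₁.cost μ + e₂.cost μ + t + 1) ℓ μ'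
  | ifFalse {e₁ e₂ : Expr} {p₁ p₂ : Prog} {μ μ' : Mem} {t : ℕ} {ℓ : List (Halfspace d)} :
      ¬ e₁.eval μ ≤ e₂.eval μ → Exec ask askTime p₂ μ t ℓ μ' →
      Exec ask askTime (.ifLe e₁ e₂ p₁ p₂) μ (e₁.cost μ + e₂.cost μ + t + 1) ℓ μ'
  | whileDone {e₁ e₂ : Expr} {p : Prog} {μ : Mem} :
      ¬ e₁.eval μ < e₂.eval μ →
      Exec ask askTime (.whileLt e₁ e₂ p) μ (e₁.cost μ + e₂.cost μ + 1) [] μ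
  | whileStep {e₁ e₂ : Expr} {p : Prog} {μ μ' μ'' : Mem} {t₁ t₂ : ℕ}
      {ℓ₁ ℓ₂ : List (Halfspace d)} :
      e₁.eval μ < e₂.eval μ → Exec ask askTime p μ t₁ ℓ₁ μ' →
      Exec ask askTime (.whileLt e₁ e₂ p) μ' t₂ ℓ₂ μ'' →
      Exec ask askTime (.whileLt e₁ e₂ p) μ (e₁.cost μ + e₂.cost μ + t₁ + t₂ + 1)
        (ℓ₁ ++ ℓ₂) μ''
  | query (μ : Mem) (k k' : ℕ) (H : Halfspace d) :
      (∀ i : Fin d, H.normal i = (μ k i : ℝ)) → H.offset = (μ k d : ℝ) →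
      Exec ask askTime (.query k k') μ
        ((∑ i ∈ Finset.range (d + 1), ratSize (μ k i)) + askTime H + answerSize (ask H) + 1)
        [H] (writeAnswer μ k' (ask H))

/-- The initial memory: array `0` holds the numbers `nR`, `nZ`, `m`; arrays `1`, `2`, `3` hold
`Q`, `A` (row by row) and `b`; array `4` holds the given feasible solution; all other cells are
`0`. -/
def inputMem {d : ℕ} (I : MOMILP d) (x₀ : Fin I.n → ℚ) : Mem := fun k i =>
  match k with
  | 0 => if i = 0 then I.nR else if i = 1 then I.nZ else if i = 2 then I.m else 0
  | 1 => if h : i / I.n < d then I.Q ⟨i / I.n, h⟩ ⟨i % I.n, Nat.mod_lt _ I.n_pos⟩ else 0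
  | 2 => if h : i / I.n < I.m then I.A ⟨i / I.n, h⟩ ⟨i % I.n, Nat.mod_lt _ I.n_pos⟩ else 0
  | 3 => if h : i < I.m then I.b ⟨i, h⟩ else 0
  | 4 => if h : i < I.n then x₀ ⟨i, h⟩ else 0
  | _ => 0

/-- The final memory lists the finite set `R ⊆ ℚⁿ` without repetition: its cardinality is in
cell `0` of array `5`, and its elements are the consecutive blocks of length `n` of
array `6`. -/
def Outputs {n : ℕ} (μ : Mem) (R : Finset (Fin n → ℚ)) : Prop :=
  μ 5 0 = R.card ∧
    R = Finset.univ.image fun (i : Fin R.card) (j : Fin n) => μ 6 ((i : ℕ) * n + (j : ℕ))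

end InnerApx

open InnerApx

/-!
The iterations are counted by means of a logarithmic grid of ratio `1 + ε` on the nonnegative
orthant. The images of the solutions that occur have rational coordinates of bounded height, so
they meet only polynomially many cells of the grid. If the oracle answers `x` to a call for
`H_{1+ε}`, then the image of `x` lies in a cell that is not occupied yet, for otherwise `1 + ε`
times this image would dominate the image of a known solution and lie in `H` (`box_ne_of_answer`).
This bounds the number of solutions. A halfspace of a facet has `d` linearly independent
generators of the polyhedron (images of solutions and unit directions, homogenized to vectors of
`ℝ^(d+1)`) on its boundary, and is determined by them (`exists_candidate_of_mem_facetHalfspaces`);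
so the number of answers "inside" is polynomial, too (`ReachInv.length_add_one_le`).

The program searches through all `d`-tuples of generators with an odometer. The halfspace that a
tuple spans is a generalized cross product, scaled to have coordinate sum one, hence the value of
a fixed arithmetic expression. It belongs to a facet if and only if it is nonnegative on all
generators (`candidate_mem_facetHalfspaces`), and because of the scaling it is already known if
and only if it occurs in the list of halfspaces answered "inside" (`eq_of_hs_eq`). A new halfspace
is passed to the oracle, and the odometer is reset after the answer has been recorded; hence all
tuples before the position of the odometer are settled (`MainInv`), and an overflow means that the
run is complete.

For the running time, the height `|p| + q` of a rational `p / q` is submultiplicative under all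
four operations. So the cost of an expression is at most a constant times the logarithm of a bound
on the heights of the numbers in memory (`Expr.cost_le`), and the cost of a program is this bound
times the number of rounds of its loops (`Run`). The numbers stored are counters, data of the
input and of the oracle, partial sums of the objective function, and cross products of generators;
all of them have polynomial encoding length.
-/

namespace InnerApx

/-! ### Heights of rational numbers -/

/-- The height `|p| + q` of a rational number `p / q` in lowest terms. It is submultiplicative
under all four arithmetic operations, and its logarithm is the encoding length up to a factor. -/
def height (q : ℚ) : ℕ := q.num.natAbs + q.den

lemma height_div_le (p : ℤ) (m : ℕ) (hm : 0 < m) : height ((p : ℚ) / (m : ℚ)) ≤ p.natAbs + m := by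
  have hm' : (m : ℤ) ≠ 0 := by exact_mod_cast hm.ne'
  have e : ((p : ℚ) / (m : ℚ)) = Rat.divInt p (m : ℤ) := by
    rw [Rat.divInt_eq_div]; norm_cast
  rw [e]
  refine add_le_add ?_ ?_
  · rcases eq_or_ne p 0 with rfl | hp
    · simp
    · exact Nat.le_of_dvd (Int.natAbs_pos.mpr hp) (Int.natAbs_dvd_natAbs.mpr (Rat.num_dvd p hm'))
  · exact Nat.le_of_dvd hm (by exact_mod_cast Rat.den_dvd p m)

lemma height_zero : height 0 = 1 := by simp [height]

lemma height_natCast (n : ℕ) : height (n : ℚ) = n + 1 := by simp [height]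

lemma height_neg (a : ℚ) : height (-a) = height a := by simp [height]

lemma height_add_le (a b : ℚ) : height (a + b) ≤ height a * height b := by
  have e : a + b = ((a.num * b.den + b.num * a.den : ℤ) : ℚ) / ((a.den * b.den : ℕ) : ℚ) := by
    conv_lhs => rw [← Rat.num_div_den a, ← Rat.num_div_den b]
    have := a.den_ne_zero; have := b.den_ne_zero
    push_cast; field_simp
  rw [e]
  refine (height_div_le _ _ (Nat.mul_pos a.den_pos b.den_pos)).trans ?_
  have h := Int.natAbs_add_le (a.num * b.den) (b.num * a.den)
  simp only [Int.natAbs_mul, Int.natAbs_natCast] at h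
  unfold height
  nlinarith [Nat.zero_le (a.num.natAbs * b.num.natAbs)]

lemma height_mul_le (a b : ℚ) : height (a * b) ≤ height a * height b := by
  have e : a * b = ((a.num * b.num : ℤ) : ℚ) / ((a.den * b.den : ℕ) : ℚ) := by
    conv_lhs => rw [← Rat.num_div_den a, ← Rat.num_div_den b]
    have := a.den_ne_zero; have := b.den_ne_zero
    push_cast; field_simp
  rw [e]
  refine (height_div_le _ _ (Nat.mul_pos a.den_pos b.den_pos)).trans ?_
  simp only [Int.natAbs_mul]
  unfold height
  nlinarith [Nat.zero_le (a.num.natAbs * b.den), Nat.zero_le (b.num.natAbs * a.den)]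

lemma height_inv (a : ℚ) : height a⁻¹ ≤ height a := by
  rcases eq_or_ne a 0 with rfl | ha
  · simp
  · rw [height, height, Rat.inv_def, Rat.divInt_eq_div]
    have hn : a.num ≠ 0 := Rat.num_ne_zero.mpr ha
    have h : ((a.den : ℤ) : ℚ) / (a.num : ℚ)
        = ((a.den * a.num.sign : ℤ) : ℚ) / ((a.num.natAbs : ℕ) : ℚ) := by
      have h1 : ((a.num.natAbs : ℕ) : ℚ) = (a.num : ℚ) * (a.num.sign : ℚ) := by
        rw [← Int.cast_natCast, ← Int.sign_mul_self_eq_natAbs]; push_cast; ring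
      have h2 : (a.num.sign : ℚ) ≠ 0 := by
        exact_mod_cast fun h => hn (Int.sign_eq_zero_iff_zero.mp h)
      have h3 : (a.num : ℚ) ≠ 0 := by exact_mod_cast hn
      rw [h1]; push_cast; field_simp
    rw [h]
    refine (height_div_le _ _ (Int.natAbs_pos.mpr hn)).trans ?_
    rw [Int.natAbs_mul, Int.natAbs_sign_of_ne_zero hn]
    simp [add_comm]

lemma height_sub_le (a b : ℚ) : height (a - b) ≤ height a * height b := by
  rw [sub_eq_add_neg, ← height_neg b]; exact height_add_le _ _

lemma height_div_le_mul (a b : ℚ) : height (a / b) ≤ height a * height b := by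
  rw [div_eq_mul_inv]
  exact (height_mul_le _ _).trans (Nat.mul_le_mul_left _ (height_inv _))

lemma height_sum_le {ι : Type*} (s : Finset ι) (g : ι → ℚ) :
    height (∑ i ∈ s, g i) ≤ ∏ i ∈ s, height (g i) := by
  classical
  induction s using Finset.induction_on with
  | empty => simp [height_zero]
  | insert a s ha ih =>
    rw [Finset.sum_insert ha, Finset.prod_insert ha]
    exact (height_add_le _ _).trans (Nat.mul_le_mul_left _ ih)

lemma height_sum_le_two_pow {ι : Type*} (s : Finset ι) (g : ι → ℚ) (b : ι → ℕ)
    (h : ∀ i ∈ s, height (g i) ≤ 2 ^ b i) : height (∑ i ∈ s, g i) ≤ 2 ^ ∑ i ∈ s, b i := by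
  rw [← Finset.prod_pow_eq_pow_sum]
  exact (height_sum_le s g).trans (Finset.prod_le_prod' h)

lemma height_prod_le_two_pow {ι : Type*} (s : Finset ι) (g : ι → ℚ) (b : ℕ) (hs : s.Nonempty)
    (h : ∀ i ∈ s, height (g i) ≤ 2 ^ b) : height (∏ i ∈ s, g i) ≤ 2 ^ (s.card * b) := by
  classical
  induction hs using Finset.Nonempty.cons_induction with
  | singleton a => simpa using h
  | cons a s ha hs ih =>
    rw [Finset.prod_cons, Finset.card_cons, add_mul, one_mul, add_comm, pow_add]
    exact (height_mul_le _ _).trans (Nat.mul_le_mul (h a (by simp))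
      (ih fun i hi => h i (by simp [hi])))

lemma height_det_le {m : ℕ} (hm : 0 < m) (A : Matrix (Fin m) (Fin m) ℚ) (b : ℕ)
    (h : ∀ i j, height (A i j) ≤ 2 ^ b) : height A.det ≤ 2 ^ (m.factorial * (m * b)) := by
  have := Fin.pos_iff_nonempty.mp hm
  rw [Matrix.det_apply]
  refine (height_sum_le_two_pow _ _ (fun _ => m * b) fun σ _ => ?_).trans_eq ?_
  · have h1 : height (∏ i, A (σ i) i) ≤ 2 ^ (m * b) := by
      simpa using height_prod_le_two_pow Finset.univ (fun i => A (σ i) i) b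
        Finset.univ_nonempty fun i _ => h _ _
    rcases Int.units_eq_one_or (Equiv.Perm.sign σ) with e | e <;> rw [e]
    · simpa using h1
    · simpa [height_neg] using h1
  · simp [Fintype.card_perm]

lemma height_le_two_pow_ratSize (q : ℚ) : height q ≤ 2 ^ ratSize q := by
  have h1 := Nat.lt_size_self q.num.natAbs
  have h2 := Nat.lt_size_self q.den
  have h3 : 2 ^ q.num.natAbs.size ≤ 2 ^ (q.num.natAbs.size + q.den.size) :=
    Nat.pow_le_pow_right (by norm_num) (by omega)
  have h4 : 2 ^ q.den.size ≤ 2 ^ (q.num.natAbs.size + q.den.size) :=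
    Nat.pow_le_pow_right (by norm_num) (by omega)
  unfold height ratSize
  rw [pow_succ]; omega

lemma ratSize_le_of_height {q : ℚ} {B : ℕ} (h : height q ≤ 2 ^ B) : ratSize q ≤ 2 * B + 2 := by
  have hd := q.den_pos
  unfold height at h
  have h1 : q.num.natAbs.size ≤ B := Nat.size_le.mpr (by omega)
  have h2 : q.den.size ≤ B + 1 := Nat.size_le.mpr (by rw [pow_succ]; omega)
  unfold ratSize; omega

lemma one_le_ratSize (q : ℚ) : 1 ≤ ratSize q := by unfold ratSize; omega

lemma height_natCast_le {m B : ℕ} (h : m ≤ B) : height (m : ℚ) ≤ 2 ^ B := by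
  rw [height_natCast]
  exact (Nat.lt_two_pow_self (n := m)).trans_le (Nat.pow_le_pow_right (by norm_num) h)

lemma height_zero_le (B : ℕ) : height 0 ≤ 2 ^ B := by
  rw [height_zero]; exact Nat.one_le_two_pow

lemma height_one_le {B : ℕ} (hB : 1 ≤ B) : height 1 ≤ 2 ^ B := by
  simpa using height_natCast_le hB

/-! ### Costs in terms of a bound on the memory contents -/

/-- All numbers in memory have height at most `2 ^ B`. -/
def Bdd (B : ℕ) (μ : Mem) : Prop := ∀ k i, height (μ k i) ≤ 2 ^ B

/-- If the memory contents have height at most `2 ^ B`, then the value of the expression has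
height at most `2 ^ (wt * B)`. -/
def Expr.wt : Expr → ℕ
  | .const q => ratSize q
  | .load _ _ => 1
  | .add e₁ e₂ => e₁.wt + e₂.wt
  | .sub e₁ e₂ => e₁.wt + e₂.wt
  | .mul e₁ e₂ => e₁.wt + e₂.wt
  | .div e₁ e₂ => e₁.wt + e₂.wt

/-- The cost of an expression is at most `costConst * B` if the memory contents have height at
most `2 ^ B`. -/
def Expr.costConst : Expr → ℕ
  | .const q => ratSize q + 1
  | .load _ e => e.costConst + 5
  | .add e₁ e₂ => e₁.costConst + e₂.costConst + 2 * (e₁.wt + e₂.wt) + 3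
  | .sub e₁ e₂ => e₁.costConst + e₂.costConst + 2 * (e₁.wt + e₂.wt) + 3
  | .mul e₁ e₂ => e₁.costConst + e₂.costConst + 2 * (e₁.wt + e₂.wt) + 3
  | .div e₁ e₂ => e₁.costConst + e₂.costConst + 2 * (e₁.wt + e₂.wt) + 3

lemma Expr.height_eval_le {B : ℕ} (hB : 1 ≤ B) {μ : Mem} (h : Bdd B μ) (e : Expr) :
    height (e.eval μ) ≤ 2 ^ (e.wt * B) := by
  induction e with
  | const q =>
    exact (height_le_two_pow_ratSize q).trans
      (Nat.pow_le_pow_right (by norm_num) (Nat.le_mul_of_pos_right _ hB))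
  | load k e => simpa [Expr.wt, Expr.eval] using h k _
  | add e₁ e₂ h₁ h₂ =>
    simp only [Expr.wt, add_mul, pow_add]
    exact (height_add_le _ _).trans (Nat.mul_le_mul h₁ h₂)
  | sub e₁ e₂ h₁ h₂ =>
    simp only [Expr.wt, add_mul, pow_add]
    exact (height_sub_le _ _).trans (Nat.mul_le_mul h₁ h₂)
  | mul e₁ e₂ h₁ h₂ =>
    simp only [Expr.wt, add_mul, pow_add]
    exact (height_mul_le _ _).trans (Nat.mul_le_mul h₁ h₂)
  | div e₁ e₂ h₁ h₂ =>
    simp only [Expr.wt, add_mul, pow_add]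
    exact (height_div_le_mul _ _).trans (Nat.mul_le_mul h₁ h₂)

lemma Expr.cost_le {B : ℕ} (hB : 1 ≤ B) {μ : Mem} (h : Bdd B μ) (e : Expr) :
    e.cost μ ≤ e.costConst * B := by
  have key := fun e : Expr => ratSize_le_of_height (e.height_eval_le hB h)
  induction e with
  | const q => exact Nat.le_mul_of_pos_right _ hB
  | load k e ih =>
    have := key (.load k e)
    simp only [Expr.eval, Expr.wt, Expr.cost, Expr.costConst] at this ⊢
    nlinarith
  | add e₁ e₂ h₁ h₂ =>
    have := key (.add e₁ e₂)
    simp only [Expr.eval, Expr.wt, Expr.cost, Expr.costConst] at this ⊢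
    nlinarith
  | sub e₁ e₂ h₁ h₂ =>
    have := key (.sub e₁ e₂)
    simp only [Expr.eval, Expr.wt, Expr.cost, Expr.costConst] at this ⊢
    nlinarith
  | mul e₁ e₂ h₁ h₂ =>
    have := key (.mul e₁ e₂)
    simp only [Expr.eval, Expr.wt, Expr.cost, Expr.costConst] at this ⊢
    nlinarith
  | div e₁ e₂ h₁ h₂ =>
    have := key (.div e₁ e₂)
    simp only [Expr.eval, Expr.wt, Expr.cost, Expr.costConst] at this ⊢
    nlinarith

lemma Bdd.set {B : ℕ} {μ : Mem} (h : Bdd B μ) {k i : ℕ} {q : ℚ} (hq : height q ≤ 2 ^ B) :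
    Bdd B (μ.set k i q) := by
  intro k' i'
  unfold Mem.set
  by_cases hk : k' = k
  · subst hk
    by_cases hi : i' = i
    · subst hi; simpa using hq
    · simpa [hi] using h k' i'
  · simpa [hk] using h k' i'

/-! ### Memory updates -/

lemma Mem.set_same (μ : Mem) (k i : ℕ) (q : ℚ) : μ.set k i q k i = q := by simp [Mem.set]

lemma Mem.set_array_ne (μ : Mem) {k k' : ℕ} (i : ℕ) (q : ℚ) (h : k' ≠ k) :
    μ.set k i q k' = μ k' := by simp [Mem.set, h]

lemma Mem.set_cell_ne (μ : Mem) (k : ℕ) {i i' : ℕ} (q : ℚ) (h : i' ≠ i) :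
    μ.set k i q k i' = μ k i' := by simp [Mem.set, h]

/-! ### Executions with a cost bound -/

/-- The cost of a program on memory contents of height at most `2 ^ B` is at most `costConst * B`
times the number of rounds of its loops, apart from the time of the oracle. -/
def Prog.costConst (d : ℕ) : Prog → ℕ
  | .skip => 1
  | .store _ i e => i.costConst + e.costConst + 1
  | .seq p₁ p₂ => p₁.costConst d + p₂.costConst d + 1
  | .ifLe e₁ e₂ p₁ p₂ => e₁.costConst + e₂.costConst + p₁.costConst d + p₂.costConst d + 1
  | .whileLt e₁ e₂ p => e₁.costConst + e₂.costConst + p.costConst d + 1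
  | .query _ _ => 4 * d + 6

section Run

variable {d n : ℕ} (ask : Halfspace d → Option (Fin n → ℚ)) (askTime : Halfspace d → ℕ) (B : ℕ)

/-- Started in memory `μ`, the program `p` halts in memory `μ'`, calls the oracle on the halfspaces
`ℓ` and, not counting the time of the oracle, has cost at most `p.costConst d * B * N`. -/
def Run (p : Prog) (N : ℕ) (μ : Mem) (ℓ : List (Halfspace d)) (μ' : Mem) : Prop :=
  ∃ t, Exec ask askTime p μ t ℓ μ' ∧ t ≤ p.costConst d * B * N + (ℓ.map askTime).sum

variable {ask askTime B}

lemma Run.mono {p : Prog} {N N' : ℕ} {μ μ' : Mem} {ℓ : List (Halfspace d)}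
    (h : Run ask askTime B p N μ ℓ μ') (hN : N ≤ N') : Run ask askTime B p N' μ ℓ μ' := by
  obtain ⟨t, h, ht⟩ := h
  exact ⟨t, h, ht.trans (by gcongr)⟩

lemma Run.skip (hB : 1 ≤ B) (μ : Mem) : Run ask askTime B .skip 1 μ [] μ :=
  ⟨1, .skip μ, by simpa [Prog.costConst] using hB⟩

lemma Run.store (hB : 1 ≤ B) {μ : Mem} (h : Bdd B μ) (k : ℕ) (i e : Expr) {j : ℕ} {q : ℚ}
    (hi : i.eval μ = (j : ℚ)) (he : e.eval μ = q) :
    Run ask askTime B (.store k i e) 1 μ [] (μ.set k j q) := by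
  have := Exec.store (ask := ask) (askTime := askTime) μ k i e
  rw [hi, he, Nat.floor_natCast] at this
  refine ⟨_, this, ?_⟩
  have h1 := i.cost_le hB h
  have h2 := e.cost_le hB h
  simp only [Prog.costConst, List.map_nil, List.sum_nil]
  nlinarith

lemma Run.seq {p₁ p₂ : Prog} {N : ℕ} {μ μ' μ'' : Mem} {ℓ₁ ℓ₂ : List (Halfspace d)}
    (hB : 1 ≤ B) (hN : 1 ≤ N) (h₁ : Run ask askTime B p₁ N μ ℓ₁ μ')
    (h₂ : Run ask askTime B p₂ N μ' ℓ₂ μ'') :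
    Run ask askTime B (.seq p₁ p₂) N μ (ℓ₁ ++ ℓ₂) μ'' := by
  obtain ⟨t₁, h₁, ht₁⟩ := h₁
  obtain ⟨t₂, h₂, ht₂⟩ := h₂
  refine ⟨_, .seq h₁ h₂, ?_⟩
  have : 1 ≤ B * N := Nat.mul_pos hB hN
  simp only [Prog.costConst, List.map_append, List.sum_append, mul_assoc, add_mul, one_mul] at *
  omega

lemma Run.ifTrue {e₁ e₂ : Expr} {p₁ p₂ : Prog} {N : ℕ} {μ μ' : Mem} {ℓ : List (Halfspace d)}
    (hB : 1 ≤ B) (hN : 1 ≤ N) (hμ : Bdd B μ) (he : e₁.eval μ ≤ e₂.eval μ)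
    (h : Run ask askTime B p₁ N μ ℓ μ') :
    Run ask askTime B (.ifLe e₁ e₂ p₁ p₂) N μ ℓ μ' := by
  obtain ⟨t, h, ht⟩ := h
  refine ⟨_, .ifTrue he h, ?_⟩
  have h1 : e₁.cost μ ≤ e₁.costConst * (B * N) :=
    (e₁.cost_le hB hμ).trans (Nat.mul_le_mul_left _ (Nat.le_mul_of_pos_right _ hN))
  have h2 : e₂.cost μ ≤ e₂.costConst * (B * N) :=
    (e₂.cost_le hB hμ).trans (Nat.mul_le_mul_left _ (Nat.le_mul_of_pos_right _ hN))
  have : 1 ≤ B * N := Nat.mul_pos hB hN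
  have h4 := Nat.zero_le (p₂.costConst d * (B * N))
  simp only [Prog.costConst, mul_assoc, add_mul, one_mul] at *
  omega

lemma Run.ifFalse {e₁ e₂ : Expr} {p₁ p₂ : Prog} {N : ℕ} {μ μ' : Mem} {ℓ : List (Halfspace d)}
    (hB : 1 ≤ B) (hN : 1 ≤ N) (hμ : Bdd B μ) (he : ¬ e₁.eval μ ≤ e₂.eval μ)
    (h : Run ask askTime B p₂ N μ ℓ μ') :
    Run ask askTime B (.ifLe e₁ e₂ p₁ p₂) N μ ℓ μ' := by
  obtain ⟨t, h, ht⟩ := h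
  refine ⟨_, .ifFalse he h, ?_⟩
  have h1 : e₁.cost μ ≤ e₁.costConst * (B * N) :=
    (e₁.cost_le hB hμ).trans (Nat.mul_le_mul_left _ (Nat.le_mul_of_pos_right _ hN))
  have h2 : e₂.cost μ ≤ e₂.costConst * (B * N) :=
    (e₂.cost_le hB hμ).trans (Nat.mul_le_mul_left _ (Nat.le_mul_of_pos_right _ hN))
  have : 1 ≤ B * N := Nat.mul_pos hB hN
  have h4 := Nat.zero_le (p₁.costConst d * (B * N))
  simp only [Prog.costConst, mul_assoc, add_mul, one_mul] at *
  omega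

lemma Run.whileDone {e₁ e₂ : Expr} {p : Prog} {N : ℕ} {μ : Mem}
    (hB : 1 ≤ B) (hN : 1 ≤ N) (hμ : Bdd B μ) (he : ¬ e₁.eval μ < e₂.eval μ) :
    Run ask askTime B (.whileLt e₁ e₂ p) N μ [] μ := by
  refine ⟨_, .whileDone he, ?_⟩
  have h1 : e₁.cost μ ≤ e₁.costConst * (B * N) :=
    (e₁.cost_le hB hμ).trans (Nat.mul_le_mul_left _ (Nat.le_mul_of_pos_right _ hN))
  have h2 : e₂.cost μ ≤ e₂.costConst * (B * N) :=
    (e₂.cost_le hB hμ).trans (Nat.mul_le_mul_left _ (Nat.le_mul_of_pos_right _ hN))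
  have : 1 ≤ B * N := Nat.mul_pos hB hN
  have h4 := Nat.zero_le (p.costConst d * (B * N))
  simp only [Prog.costConst, mul_assoc, add_mul, one_mul] at *
  omega

lemma Run.whileStep {e₁ e₂ : Expr} {p : Prog} {N M : ℕ} {μ μ' μ'' : Mem}
    {ℓ₁ ℓ₂ : List (Halfspace d)}
    (hB : 1 ≤ B) (hN : 1 ≤ N) (hμ : Bdd B μ) (he : e₁.eval μ < e₂.eval μ)
    (h₁ : Run ask askTime B p N μ ℓ₁ μ')
    (h₂ : Run ask askTime B (.whileLt e₁ e₂ p) M μ' ℓ₂ μ'') :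
    Run ask askTime B (.whileLt e₁ e₂ p) (M + N) μ (ℓ₁ ++ ℓ₂) μ'' := by
  obtain ⟨t₁, h₁, ht₁⟩ := h₁
  obtain ⟨t₂, h₂, ht₂⟩ := h₂
  refine ⟨_, .whileStep he h₁ h₂, ?_⟩
  have h3 : e₁.cost μ ≤ e₁.costConst * (B * N) :=
    (e₁.cost_le hB hμ).trans (Nat.mul_le_mul_left _ (Nat.le_mul_of_pos_right _ hN))
  have h4 : e₂.cost μ ≤ e₂.costConst * (B * N) :=
    (e₂.cost_le hB hμ).trans (Nat.mul_le_mul_left _ (Nat.le_mul_of_pos_right _ hN))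
  have : 1 ≤ B * N := Nat.mul_pos hB hN
  simp only [Prog.costConst, mul_assoc, add_mul, one_mul, mul_add, List.map_append,
    List.sum_append] at *
  omega

lemma Run.query (hB : 1 ≤ B) {μ : Mem} (hμ : Bdd B μ) (k k' : ℕ) (H : Halfspace d)
    (hn : ∀ i : Fin d, H.normal i = (μ k i : ℝ)) (ho : H.offset = (μ k d : ℝ))
    (hs : answerSize (ask H) ≤ B) :
    Run ask askTime B (.query k k') 1 μ [H] (writeAnswer μ k' (ask H)) := by
  refine ⟨_, .query μ k k' H hn ho, ?_⟩
  have : ∑ i ∈ Finset.range (d + 1), ratSize (μ k i) ≤ (d + 1) * (2 * B + 2) := by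
    simpa using Finset.sum_le_card_nsmul (Finset.range (d + 1)) (fun i => ratSize (μ k i)) _
      fun i _ => ratSize_le_of_height (hμ k i)
  have h5 : d ≤ d * B := Nat.le_mul_of_pos_right _ hB
  simp only [Prog.costConst, List.map_cons, List.map_nil, List.sum_cons, List.sum_nil]
  nlinarith

/-- A loop that performs at most `W` rounds because the measure `meas` decreases. The invariant
also refers to the list of the halfspaces on which the oracle has been called so far. -/
lemma Run.while_measure {e₁ e₂ : Expr} {p : Prog} {N : ℕ} (hB : 1 ≤ B) (hN : 1 ≤ N)
    (Inv : Mem → List (Halfspace d) → ℕ → Prop)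
    (hbdd : ∀ μ ℓ W, Inv μ ℓ W → Bdd B μ)
    (hstep : ∀ μ ℓ W, Inv μ ℓ W → e₁.eval μ < e₂.eval μ →
      ∃ ℓ₁ μ' W', Run ask askTime B p N μ ℓ₁ μ' ∧ W' < W ∧ Inv μ' (ℓ ++ ℓ₁) W')
    (W : ℕ) (μ : Mem) (ℓ : List (Halfspace d)) (h : Inv μ ℓ W) :
    ∃ ℓ' μ' W', Run ask askTime B (.whileLt e₁ e₂ p) ((W + 1) * N) μ ℓ' μ' ∧
      Inv μ' (ℓ ++ ℓ') W' ∧ ¬ e₁.eval μ' < e₂.eval μ' := by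
  induction W using Nat.strong_induction_on generalizing μ ℓ with
  | _ W ih =>
    by_cases hc : e₁.eval μ < e₂.eval μ
    · obtain ⟨ℓ₁, μ₁, W₁, hr, hW, hI⟩ := hstep μ ℓ W h hc
      obtain ⟨ℓ₂, μ₂, W₂, hr₂, hI₂, hc₂⟩ := ih W₁ hW μ₁ _ hI
      refine ⟨_, _, W₂, (Run.whileStep hB hN (hbdd _ _ _ h) hc hr hr₂).mono ?_,
        by simpa using hI₂, hc₂⟩
      calc (W₁ + 1) * N + N = (W₁ + 1 + 1) * N := by ring
        _ ≤ _ := by gcongr; omega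
    · exact ⟨[], μ, W, (Run.whileDone hB hN (hbdd _ _ _ h) hc).mono
        (Nat.le_mul_of_pos_left _ (by omega)), by simpa using h, hc⟩

end Run

/-- `for i < lim: body`, with the counter in cell `0` of array `c`. -/
def forLoop (c : ℕ) (lim : Expr) (body : Prog) : Prog :=
  .seq (.store c (.const 0) (.const 0))
    (.whileLt (.load c (.const 0)) lim
      (.seq body (.store c (.const 0) (.add (.load c (.const 0)) (.const 1)))))

lemma Run.forLoop {d n : ℕ} {ask : Halfspace d → Option (Fin n → ℚ)} {askTime : Halfspace d → ℕ}
    {B : ℕ} (hB : 1 ≤ B) {c : ℕ} {lim : Expr} {body : Prog} {N m : ℕ} (hN : 1 ≤ N)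
    (Inv : ℕ → Mem → Prop) (hbdd : ∀ j μ, Inv j μ → Bdd B μ)
    (hlim : ∀ j μ, Inv j μ → lim.eval μ = (m : ℚ))
    (hstep : ∀ j < m, ∀ μ, Inv j μ → μ c 0 = (j : ℚ) →
      ∃ μ', Run ask askTime B body N μ [] μ' ∧ Bdd B μ' ∧ μ' c 0 = (j : ℚ) ∧
        Inv (j + 1) (μ'.set c 0 ((j + 1 : ℕ) : ℚ)))
    {μ : Mem} (hμ : Bdd B μ) (h0 : Inv 0 (μ.set c 0 0)) :
    ∃ μ', Run ask askTime B (InnerApx.forLoop c lim body) ((m + 1) * N) μ [] μ' ∧ Inv m μ' := by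
  have key := Run.while_measure (ask := ask) (askTime := askTime) (e₁ := .load c (.const 0))
    (e₂ := lim) (p := .seq body (.store c (.const 0) (.add (.load c (.const 0)) (.const 1))))
    (N := N) hB hN
    (fun μ ℓ W => ℓ = [] ∧ W ≤ m ∧ Inv (m - W) μ ∧ μ c 0 = ((m - W : ℕ) : ℚ))
    (fun μ ℓ W h => hbdd _ _ h.2.2.1) ?_ m (μ.set c 0 0) []
    ⟨rfl, le_rfl, by simpa using h0, by simp [Mem.set_same]⟩
  · obtain ⟨ℓ', μ', W', hr, ⟨h1, h2, h3, h4⟩, h5⟩ := key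
    simp only [List.nil_append] at h1
    subst h1
    have hc := hlim _ _ h3
    simp only [Expr.eval, Nat.floor_zero, h4, hc, Nat.cast_lt] at h5
    have : W' = 0 := by omega
    subst this
    refine ⟨μ', ?_, by simpa using h3⟩
    have h1 := Run.store (ask := ask) (askTime := askTime) hB hμ c (.const 0) (.const 0)
      (j := 0) (q := 0) (by simp [Expr.eval]) (by simp [Expr.eval])
    exact Run.seq hB (Nat.mul_pos (by omega) hN)
      (h1.mono (Nat.mul_pos (by omega) hN)) hr
  · rintro μ ℓ W ⟨rfl, hW, hI, hc⟩ hlt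
    simp only [Expr.eval, Nat.floor_zero, hc, hlim _ _ hI, Nat.cast_lt] at hlt
    obtain ⟨μ', hr, hb', hc', hI'⟩ := hstep _ hlt μ hI hc
    have h2 := Run.store (ask := ask) (askTime := askTime) hB hb' c (.const 0)
      (.add (.load c (.const 0)) (.const 1)) (j := 0) (q := ((m - W + 1 : ℕ) : ℚ))
      (by simp [Expr.eval]) (by simp [Expr.eval, hc'])
    have e : m - (W - 1) = m - W + 1 := by omega
    exact ⟨_, _, W - 1, Run.seq hB hN hr (h2.mono hN), by omega, rfl, by omega, by rwa [e],
      by rw [e, Mem.set_same]⟩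

/-! ### Homogenization -/

section Homogenization

variable {d : ℕ}

/-- The vector `(z, t)` of `K^(d+1)`. A halfspace `{z | wᵀ z ≥ c}` is encoded as `(w, c)`, a point
`z` as `(z, -1)` and a direction `z` as `(z, 0)`, so that the dot product decides incidence. -/
def emb {K : Type*} (z : Fin d → K) (t : K) : Fin (d + 1) → K :=
  Fin.snoc (α := fun _ => K) z t

@[simp] lemma emb_castSucc {K : Type*} (z : Fin d → K) (t : K) (i : Fin d) :
    emb z t i.castSucc = z i := by simp [emb]

@[simp] lemma emb_last {K : Type*} (z : Fin d → K) (t : K) : emb z t (Fin.last d) = t := by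
  simp [emb]

lemma emb_init {K : Type*} (v : Fin (d + 1) → K) :
    emb (fun i => v i.castSucc) (v (Fin.last d)) = v := by
  funext i
  refine Fin.lastCases ?_ (fun j => ?_) i <;> simp

lemma dotProduct_emb (v : Fin (d + 1) → ℝ) (z : Fin d → ℝ) (t : ℝ) :
    v ⬝ᵥ emb z t = (fun i => v i.castSucc) ⬝ᵥ z + v (Fin.last d) * t := by
  simp [dotProduct, Fin.sum_univ_castSucc]

lemma emb_add (z z' : Fin d → ℝ) (t t' : ℝ) : emb (z + z') (t + t') = emb z t + emb z' t' := by
  funext i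
  refine Fin.lastCases ?_ (fun j => ?_) i <;> simp

lemma emb_smul (a : ℝ) (z : Fin d → ℝ) (t : ℝ) : emb (a • z) (a * t) = a • emb z t := by
  funext i
  refine Fin.lastCases ?_ (fun j => ?_) i <;> simp

lemma emb_sub (z z' : Fin d → ℝ) (t t' : ℝ) : emb (z - z') (t - t') = emb z t - emb z' t' := by
  funext i
  refine Fin.lastCases ?_ (fun j => ?_) i <;> simp

/-- `z ↦ (z, 0)` as a linear map. -/
def embLin (d : ℕ) : (Fin d → ℝ) →ₗ[ℝ] (Fin (d + 1) → ℝ) where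
  toFun z := emb z 0
  map_add' z z' := by simpa using emb_add z z' 0 0
  map_smul' a z := by simpa using emb_smul a z 0

lemma embLin_injective : Function.Injective (embLin d) := by
  intro z z' h
  funext i
  simpa [embLin] using congrFun h i.castSucc

/-- Homogenizing a nonempty set raises its dimension by one. -/
lemma finrank_span_emb {G : Set (Fin d → ℝ)} (hG : G.Nonempty) :
    Module.finrank ℝ (Submodule.span ℝ ((fun z => emb z (-1)) '' G)) = affDim G + 1 := by
  obtain ⟨z₀, hz₀⟩ := hG
  have hsup : Submodule.span ℝ ((fun z => emb z (-1)) '' G)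
      = (vectorSpan ℝ G).map (embLin d) ⊔ Submodule.span ℝ {emb z₀ (-1)} := by
    apply le_antisymm
    · rw [Submodule.span_le]
      rintro _ ⟨z, hz, rfl⟩
      have e : emb z (-1) = embLin d (z - z₀) + emb z₀ (-1) := by
        change _ = emb (z - z₀) 0 + _
        rw [← emb_add]; simp
      simp only [SetLike.mem_coe]
      rw [e]
      exact Submodule.add_mem_sup (Submodule.mem_map_of_mem (vsub_mem_vectorSpan ℝ hz hz₀))
        (Submodule.mem_span_singleton_self _)
    · refine sup_le ?_ ?_
      · rw [Submodule.map_le_iff_le_comap, vectorSpan_eq_span_vsub_set_right ℝ hz₀,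
          Submodule.span_le]
        rintro _ ⟨z, hz, rfl⟩
        have e : embLin d (z - z₀) = emb z (-1) - emb z₀ (-1) := by
          change emb (z - z₀) 0 = _
          rw [← emb_sub]; simp
        simp only [vsub_eq_sub, SetLike.mem_coe, Submodule.mem_comap]
        rw [e]
        exact Submodule.sub_mem _ (Submodule.subset_span ⟨z, hz, rfl⟩)
          (Submodule.subset_span ⟨z₀, hz₀, rfl⟩)
      · rw [Submodule.span_singleton_le_iff_mem]
        exact Submodule.subset_span ⟨z₀, hz₀, rfl⟩
  have hinf : (vectorSpan ℝ G).map (embLin d) ⊓ Submodule.span ℝ {emb z₀ (-1)} = ⊥ := by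
    rw [Submodule.eq_bot_iff]
    rintro x ⟨⟨z, -, hz⟩, hx⟩
    obtain ⟨a, rfl⟩ := Submodule.mem_span_singleton.mp hx
    have : a = 0 := by simpa [embLin] using congrFun hz (Fin.last d)
    simp [this]
  have hne : emb z₀ (-1 : ℝ) ≠ 0 := fun h => by simpa using congrFun h (Fin.last d)
  have h := Submodule.finrank_sup_add_finrank_inf_eq ((vectorSpan ℝ G).map (embLin d))
    (Submodule.span ℝ {emb z₀ (-1 : ℝ)})
  rw [hinf, finrank_bot, add_zero, finrank_span_singleton hne,
    ← (Submodule.equivMapOfInjective (embLin d) embLin_injective _).finrank_eq] at h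
  rw [hsup, h, affDim]

/-- The halfspace with normal vector and right-hand side `u`, as a point set. -/
def hs (u : Fin (d + 1) → ℝ) : Set (Fin d → ℝ) := {z | 0 ≤ u ⬝ᵥ emb z (-1)}

lemma mem_hs {u : Fin (d + 1) → ℝ} {z : Fin d → ℝ} :
    z ∈ hs u ↔ u (Fin.last d) ≤ ∑ i : Fin d, u i.castSucc * z i := by
  simp only [hs, Set.mem_ofPred_eq, dotProduct_emb]
  simp [dotProduct]

lemma Halfspace.toSet_eq (H : Halfspace d) : H.toSet = hs (emb H.normal H.offset) := by
  ext z
  simp [Halfspace.toSet, hs, dotProduct_emb]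

lemma Halfspace.mem_boundary (H : Halfspace d) (z : Fin d → ℝ) :
    z ∈ H.boundary ↔ emb H.normal H.offset ⬝ᵥ emb z (-1) = 0 := by
  simp only [Halfspace.boundary, Set.mem_ofPred_eq, dotProduct_emb, emb_castSucc, emb_last]
  constructor <;> intro h <;> linarith

lemma hs_smul {a : ℝ} (ha : 0 < a) (u : Fin (d + 1) → ℝ) : hs (a • u) = hs u := by
  ext z
  simp [hs, mul_nonneg_iff_of_pos_left ha]

/-- A halfspace determines its normal vector and right-hand side up to scaling. -/
lemma eq_of_hs_eq {u u' : Fin (d + 1) → ℝ} (hu : ∑ i : Fin d, u i.castSucc = 1)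
    (hu' : ∑ i : Fin d, u' i.castSucc = 1) (h : hs u = hs u') : u = u' := by
  have key : ∀ v v' : Fin (d + 1) → ℝ, ∑ i : Fin d, v i.castSucc = 1 →
      ∑ i : Fin d, v' i.castSucc = 1 → hs v ⊆ hs v' → v' (Fin.last d) ≤ v (Fin.last d) := by
    intro v v' hv hv' hsub
    have := @hsub (fun _ => v (Fin.last d)) (by
      rw [mem_hs, ← Finset.sum_mul, hv, one_mul])
    rwa [mem_hs, ← Finset.sum_mul, hv', one_mul] at this
  have hlast : u (Fin.last d) = u' (Fin.last d) :=
    le_antisymm (key u' u hu' hu h.ge) (key u u' hu hu' h.le)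
  -- the points `t e_i + (c - t u_i) 1` lie on the boundary of `hs u`, for all `t`
  have key2 : ∀ (i : Fin d) (t : ℝ), 0 ≤ t * (u' i.castSucc - u i.castSucc) := by
    intro i t
    have := h.subset (show (fun j => Pi.single (M := fun _ => ℝ) i t j
        + (u (Fin.last d) - t * u i.castSucc)) ∈ hs u by
      rw [mem_hs]
      simp [mul_add, Finset.sum_add_distrib, ← Finset.sum_mul, hu, Pi.single_apply, mul_comm])
    rw [mem_hs] at this
    simp only [mul_add, Finset.sum_add_distrib, ← Finset.sum_mul, hu', Pi.single_apply, hlast,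
      mul_ite, mul_zero, Finset.sum_ite_eq', Finset.mem_univ, if_true] at this
    linarith
  funext i
  refine Fin.lastCases hlast (fun j => ?_) i
  have h1 := key2 j 1
  have h2 := key2 j (-1)
  linarith

end Homogenization

/-! ### Generators of the inner approximation polyhedron -/

section Generators

variable {d : ℕ}

/-- The homogenized unit directions and points that generate the cone over
`conv Y + ℝᵈ_{≥0}`. -/
def gens (Y : Set (Fin d → ℝ)) : Set (Fin (d + 1) → ℝ) :=
  Set.range (fun i : Fin d => emb (Pi.single i (1 : ℝ)) 0) ∪ (fun y => emb y (-1)) '' Y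

/-- The polyhedron `conv Y + ℝᵈ_{≥0}`. -/
def upperHull (Y : Set (Fin d → ℝ)) : Set (Fin d → ℝ) := convexHull ℝ Y + {z | 0 ≤ z}

lemma dir_mem_gens (Y : Set (Fin d → ℝ)) (i : Fin d) : emb (Pi.single i (1 : ℝ)) 0 ∈ gens Y :=
  Or.inl ⟨i, rfl⟩

lemma point_mem_gens {Y : Set (Fin d → ℝ)} {y : Fin d → ℝ} (hy : y ∈ Y) : emb y (-1) ∈ gens Y :=
  Or.inr ⟨y, hy, rfl⟩

lemma dotProduct_dir (v : Fin (d + 1) → ℝ) (i : Fin d) :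
    v ⬝ᵥ emb (Pi.single i (1 : ℝ)) 0 = v i.castSucc := by simp [dotProduct_emb]

lemma subset_upperHull (Y : Set (Fin d → ℝ)) : Y ⊆ upperHull Y := fun y hy =>
  ⟨y, subset_convexHull ℝ Y hy, 0, by simp, by simp⟩

lemma add_mem_upperHull {Y : Set (Fin d → ℝ)} {z p : Fin d → ℝ} (hz : z ∈ upperHull Y)
    (hp : 0 ≤ p) : z + p ∈ upperHull Y := by
  obtain ⟨a, ha, b, hb, rfl⟩ := hz
  exact ⟨a, ha, b + p, add_nonneg (by exact hb) hp, by simp [add_assoc]⟩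

lemma single_nonneg (i : Fin d) {t : ℝ} (ht : 0 ≤ t) : (0 : Fin d → ℝ) ≤ Pi.single i t :=
  Pi.single_nonneg.mpr ht

/-- If `v` is nonnegative on the generators, it is nonnegative on the polyhedron, and the points of
the polyhedron where it vanishes are combinations of the generators where it vanishes: in a
nonnegative combination that vanishes, every term does. -/
lemma exposed_mem_span {Y : Set (Fin d → ℝ)} {v : Fin (d + 1) → ℝ}
    (hv : ∀ g ∈ gens Y, 0 ≤ v ⬝ᵥ g) {z : Fin d → ℝ} (hz : z ∈ upperHull Y) :
    0 ≤ v ⬝ᵥ emb z (-1) ∧ (v ⬝ᵥ emb z (-1) = 0 →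
      emb z (-1) ∈ Submodule.span ℝ {g ∈ gens Y | v ⬝ᵥ g = 0}) := by
  set L := Submodule.span ℝ {g ∈ gens Y | v ⬝ᵥ g = 0}
  obtain ⟨a, ha, p, hp, rfl⟩ := hz
  have hC : a ∈ {z : Fin d → ℝ | 0 ≤ v ⬝ᵥ emb z (-1) ∧
      (v ⬝ᵥ emb z (-1) = 0 → emb z (-1) ∈ L)} := by
    refine convexHull_min ?_ ?_ ha
    · intro y hy
      exact ⟨hv _ (point_mem_gens hy), fun h => Submodule.subset_span ⟨point_mem_gens hy, h⟩⟩
    · rintro z₁ ⟨h1, h1'⟩ z₂ ⟨h2, h2'⟩ s t hs ht hst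
      have e : emb (s • z₁ + t • z₂) (-1) = s • emb z₁ (-1) + t • emb z₂ (-1) := by
        rw [← emb_smul, ← emb_smul, ← emb_add]
        congr 1; linear_combination hst
      simp only [Set.mem_ofPred_eq]
      rw [e]
      simp only [dotProduct_add, dotProduct_smul, smul_eq_mul]
      have q1 := mul_nonneg hs h1
      have q2 := mul_nonneg ht h2
      refine ⟨by linarith, fun h0 => Submodule.add_mem _ ?_ ?_⟩
      · rcases mul_eq_zero.mp (by linarith : s * (v ⬝ᵥ emb z₁ (-1)) = 0) with h | h
        · simp [h]
        · exact Submodule.smul_mem _ _ (h1' h)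
      · rcases mul_eq_zero.mp (by linarith : t * (v ⬝ᵥ emb z₂ (-1)) = 0) with h | h
        · simp [h]
        · exact Submodule.smul_mem _ _ (h2' h)
  have e : emb (a + p) (-1) = emb a (-1) + emb p 0 := by rw [← emb_add]; simp
  have hw : ∀ i : Fin d, 0 ≤ v i.castSucc := fun i => by
    simpa [dotProduct_dir] using hv _ (dir_mem_gens Y i)
  have e2 : v ⬝ᵥ emb p 0 = ∑ i : Fin d, v i.castSucc * p i := by
    rw [dotProduct_emb]; simp [dotProduct]
  have hp' : ∀ i ∈ Finset.univ, 0 ≤ v (Fin.castSucc i) * p i :=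
    fun i _ => mul_nonneg (hw i) (hp i)
  simp only
  rw [e, dotProduct_add, e2]
  refine ⟨add_nonneg hC.1 (Finset.sum_nonneg hp'), fun h0 => ?_⟩
  have hs0 := Finset.sum_nonneg hp'
  have h1 := hC.1
  have h2 := (Finset.sum_eq_zero_iff_of_nonneg hp').mp (by linarith)
  refine Submodule.add_mem _ (hC.2 (by linarith)) ?_
  have e3 : emb p 0 = ∑ i : Fin d, p i • emb (Pi.single i (1 : ℝ)) 0 := by
    change embLin d p = ∑ i : Fin d, p i • embLin d (Pi.single i (1 : ℝ))
    simp only [← map_smul, ← map_sum]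
    congr 1
    exact pi_eq_sum_univ' p
  rw [e3]
  refine Submodule.sum_mem _ fun i _ => ?_
  rcases mul_eq_zero.mp (h2 i (Finset.mem_univ i)) with h | h
  · exact Submodule.smul_mem _ _ (Submodule.subset_span
      ⟨dir_mem_gens Y i, by rw [dotProduct_dir, h]⟩)
  · simp [h]

lemma upperHull_subset_hs {Y : Set (Fin d → ℝ)} {v : Fin (d + 1) → ℝ}
    (hv : ∀ g ∈ gens Y, 0 ≤ v ⬝ᵥ g) : upperHull Y ⊆ hs v :=
  fun _ hz => (exposed_mem_span hv hz).1

/-- A halfspace that contains the polyhedron is nonnegative on all generators: on the directions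
because it contains the orthant they span, shifted to a point. -/
lemma nonneg_of_upperHull_subset_hs {Y : Set (Fin d → ℝ)} (hY : Y.Nonempty)
    {v : Fin (d + 1) → ℝ} (h : upperHull Y ⊆ hs v) : ∀ g ∈ gens Y, 0 ≤ v ⬝ᵥ g := by
  rintro _ (⟨i, rfl⟩ | ⟨y, hy, rfl⟩)
  · simp only [dotProduct_dir]
    obtain ⟨y, hy⟩ := hY
    by_contra! hneg
    set b := v ⬝ᵥ emb y (-1)
    have hb : 0 ≤ b := h (subset_upperHull Y hy)
    have ht : 0 ≤ (b + 1) / (-v i.castSucc) := div_nonneg (by linarith) (by linarith)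
    have h1 := h (add_mem_upperHull (subset_upperHull Y hy) (single_nonneg i ht))
    have e : emb (y + Pi.single i ((b + 1) / (-v i.castSucc))) (-1)
        = emb y (-1) + emb (Pi.single i ((b + 1) / (-v i.castSucc))) 0 := by
      rw [← emb_add]; simp
    simp only [hs, Set.mem_ofPred_eq] at h1
    rw [e, dotProduct_add] at h1
    have e2 : v ⬝ᵥ emb (Pi.single i ((b + 1) / (-v i.castSucc))) 0 = -(b + 1) := by
      have := hneg.ne
      simp only [dotProduct_emb, dotProduct_single, mul_zero, add_zero]
      field_simp
    rw [e2] at h1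
    linarith
  · exact h (subset_upperHull Y hy)

lemma span_exposed {Y : Set (Fin d → ℝ)} {v : Fin (d + 1) → ℝ}
    (hv : ∀ g ∈ gens Y, 0 ≤ v ⬝ᵥ g)
    (hne : (upperHull Y ∩ {z | v ⬝ᵥ emb z (-1) = 0}).Nonempty) :
    Submodule.span ℝ ((fun z => emb z (-1)) '' (upperHull Y ∩ {z | v ⬝ᵥ emb z (-1) = 0}))
      = Submodule.span ℝ {g ∈ gens Y | v ⬝ᵥ g = 0} := by
  apply le_antisymm
  · rw [Submodule.span_le]
    rintro _ ⟨z, ⟨hz, hz0⟩, rfl⟩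
    exact (exposed_mem_span hv hz).2 hz0
  · rw [Submodule.span_le]
    rintro _ ⟨⟨i, rfl⟩ | ⟨y, hy, rfl⟩, h0⟩
    · obtain ⟨z, hz, hz0⟩ := hne
      have e : emb (Pi.single i (1 : ℝ)) 0 = emb (z + Pi.single i 1) (-1) - emb z (-1) := by
        rw [← emb_sub]; simp
      have e' : emb (z + Pi.single i 1) (-1) = emb z (-1) + emb (Pi.single i (1 : ℝ)) 0 := by
        rw [← emb_add]; simp
      simp only [SetLike.mem_coe]
      rw [e]
      refine Submodule.sub_mem _ (Submodule.subset_span ⟨_, ⟨?_, ?_⟩, rfl⟩)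
        (Submodule.subset_span ⟨z, ⟨hz, hz0⟩, rfl⟩)
      · exact add_mem_upperHull hz (single_nonneg i zero_le_one)
      · simp only [Set.mem_ofPred_eq] at hz0 ⊢
        rw [e', dotProduct_add, hz0, zero_add]; exact h0
    · exact Submodule.subset_span ⟨y, ⟨subset_upperHull Y hy, h0⟩, rfl⟩

lemma affDim_upperHull {Y : Set (Fin d → ℝ)} (hY : Y.Nonempty) : affDim (upperHull Y) = d := by
  have h : vectorSpan ℝ (upperHull Y) = ⊤ := by
    rw [eq_top_iff]
    rintro x -
    rw [pi_eq_sum_univ' x]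
    refine Submodule.sum_mem _ fun i _ => Submodule.smul_mem _ _ ?_
    obtain ⟨y, hy⟩ := hY
    have := vsub_mem_vectorSpan ℝ
      (add_mem_upperHull (subset_upperHull Y hy) (single_nonneg i zero_le_one))
      (subset_upperHull Y hy)
    simpa using this
  rw [affDim, h, finrank_top, Module.finrank_fin_fun]

end Generators

/-! ### The halfspace spanned by generators -/

section Candidate

variable {d : ℕ} {K : Type*} [Field K]

/-- The generalized cross product of `d` vectors of `K^(d+1)`. -/
def crossProd (g : Fin d → Fin (d + 1) → K) : Fin (d + 1) → K := fun i =>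
  (Matrix.of (Fin.cons (Pi.single i 1) g : Fin (d + 1) → Fin (d + 1) → K)).det

/-- The generalized cross product of `d` generators, scaled so that its first `d` entries add up to
one: the normal vector and right-hand side of the halfspace whose boundary is spanned by the
generators. It is zero if these entries add up to zero, in particular if the generators are linearly
dependent. -/
def candidate (g : Fin d → Fin (d + 1) → K) : Fin (d + 1) → K := fun i =>
  crossProd g i / ∑ j : Fin d, crossProd g j.castSucc

lemma crossProd_dotProduct (g : Fin d → Fin (d + 1) → K) (v : Fin (d + 1) → K) :
    crossProd g ⬝ᵥ v = (Matrix.of (Fin.cons v g : Fin (d + 1) → Fin (d + 1) → K)).det := by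
  have h : ∀ v : Fin (d + 1) → K, Matrix.of (Fin.cons v g : Fin (d + 1) → Fin (d + 1) → K)
      = Matrix.updateRow (Matrix.of (Fin.cons 0 g : Fin (d + 1) → Fin (d + 1) → K)) 0 v := by
    intro v
    ext i j
    refine Fin.cases ?_ (fun i => ?_) i <;> simp
  let φ : (Fin (d + 1) → K) →ₗ[K] K :=
    { toFun := fun v =>
        (Matrix.updateRow (Matrix.of (Fin.cons 0 g : Fin (d + 1) → Fin (d + 1) → K)) 0 v).det
      map_add' := fun u v => Matrix.det_updateRow_add _ _ _ _
      map_smul' := fun a v => by simp [Matrix.det_updateRow_smul] }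
  have h2 := LinearMap.pi_apply_eq_sum_univ φ v
  rw [h v]
  refine Eq.trans ?_ h2.symm
  have h3 : ∀ i, crossProd g i = φ (Pi.single i 1) := fun i => by rw [crossProd, h]; rfl
  simp only [dotProduct, h3, smul_eq_mul]
  refine Finset.sum_congr rfl fun i _ => ?_
  rw [mul_comm]
  congr 1
  congr 1
  funext j
  simp [Pi.single_apply, eq_comm]

lemma crossProd_dotProduct_self (g : Fin d → Fin (d + 1) → K) (j : Fin d) :
    crossProd g ⬝ᵥ g j = 0 := by
  rw [crossProd_dotProduct]
  exact Matrix.det_zero_of_row_eq (i := 0) (j := j.succ) (Fin.succ_ne_zero j).symm (by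
    funext i; simp)

lemma linearIndependent_of_crossProd_ne {g : Fin d → Fin (d + 1) → K} (h : crossProd g ≠ 0) :
    LinearIndependent K g := by
  obtain ⟨i, hi⟩ := Function.ne_iff.mp h
  have hu : IsUnit (Matrix.of (Fin.cons (Pi.single i 1) g : Fin (d + 1) → Fin (d + 1) → K)) := by
    rw [Matrix.isUnit_iff_isUnit_det]; exact isUnit_iff_ne_zero.mpr hi
  have := Matrix.linearIndependent_rows_iff_isUnit.mpr hu
  exact (linearIndependent_finCons.mp this).1

lemma candidate_eq_smul (g : Fin d → Fin (d + 1) → K) :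
    candidate g = (∑ j : Fin d, crossProd g j.castSucc)⁻¹ • crossProd g := by
  funext i
  simp [candidate, div_eq_inv_mul]

lemma candidate_dotProduct_self (g : Fin d → Fin (d + 1) → K) (j : Fin d) :
    candidate g ⬝ᵥ g j = 0 := by
  rw [candidate_eq_smul, smul_dotProduct, crossProd_dotProduct_self, smul_zero]

lemma sum_ne_of_candidate_ne {g : Fin d → Fin (d + 1) → K} (h : candidate g ≠ 0) :
    ∑ j : Fin d, crossProd g j.castSucc ≠ 0 := by
  intro h0
  exact h (by rw [candidate_eq_smul, h0]; simp)

lemma sum_candidate {g : Fin d → Fin (d + 1) → K} (h : candidate g ≠ 0) :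
    ∑ i : Fin d, candidate g i.castSucc = 1 := by
  have := sum_ne_of_candidate_ne h
  simp only [candidate, ← Finset.sum_div]
  exact div_self this

/-- A nonzero vector that is orthogonal to `d` independent vectors of `ℝ^(d+1)` is a multiple of
their cross product. -/
lemma exists_crossProd_eq_smul {g : Fin d → Fin (d + 1) → ℝ} (hg : LinearIndependent ℝ g)
    {v : Fin (d + 1) → ℝ} (hv : v ≠ 0) (hvg : ∀ j, v ⬝ᵥ g j = 0) :
    ∃ a : ℝ, a ≠ 0 ∧ crossProd g = a • v := by
  have hvv : v ⬝ᵥ v ≠ 0 := fun h => hv (dotProduct_self_eq_zero.mp h)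
  have hmem : v ∉ Submodule.span ℝ (Set.range g) := by
    intro h
    have : Submodule.span ℝ (Set.range g) ≤ LinearMap.ker (dotProductBilin ℝ ℝ v) := by
      rw [Submodule.span_le]
      rintro _ ⟨j, rfl⟩
      simpa using hvg j
    exact hvv (by simpa using this h)
  set M := Matrix.of (Fin.cons v g : Fin (d + 1) → Fin (d + 1) → ℝ) with hM
  have hdet : M.det ≠ 0 := by
    have hli : LinearIndependent ℝ M.row := linearIndependent_finCons.mpr ⟨hg, hmem⟩
    have := Matrix.linearIndependent_rows_iff_isUnit.mp hli
    rw [Matrix.isUnit_iff_isUnit_det] at this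
    exact this.ne_zero
  have hNv : crossProd g ⬝ᵥ v = M.det := crossProd_dotProduct g v
  set a := (crossProd g ⬝ᵥ v) / (v ⬝ᵥ v) with ha
  refine ⟨a, div_ne_zero (by rw [hNv]; exact hdet) hvv, ?_⟩
  have h0 : M *ᵥ (crossProd g - a • v) = 0 := by
    funext i
    refine Fin.cases ?_ (fun j => ?_) i
    · change v ⬝ᵥ _ = 0
      rw [dotProduct_sub, dotProduct_smul, dotProduct_comm, ha]
      rw [smul_eq_mul, div_mul_cancel₀ _ hvv, sub_self]
    · change g j ⬝ᵥ _ = 0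
      rw [dotProduct_sub, dotProduct_smul, dotProduct_comm, crossProd_dotProduct_self,
        dotProduct_comm, hvg]
      simp
  exact sub_eq_zero.mp (Matrix.eq_zero_of_mulVec_eq_zero hdet h0)

lemma crossProd_cast (g : Fin d → Fin (d + 1) → ℚ) (i : Fin (d + 1)) :
    ((crossProd g i : ℚ) : ℝ) = crossProd (fun j l => (g j l : ℝ)) i := by
  unfold crossProd
  change Rat.castHom ℝ _ = _
  rw [RingHom.map_det]
  congr 1
  ext k l
  refine Fin.cases ?_ (fun k => ?_) k
  · by_cases h : l = i
    · subst h; simp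
    · simp [h]
  · simp

lemma candidate_cast (g : Fin d → Fin (d + 1) → ℚ) (i : Fin (d + 1)) :
    ((candidate g i : ℚ) : ℝ) = candidate (fun j l => (g j l : ℝ)) i := by
  simp only [candidate, ← crossProd_cast]
  push_cast
  rfl

end Candidate

/-! ### Facets and generators -/

section Facets

variable {d : ℕ} {Y : Set (Fin d → ℝ)}

lemma normal_ne_of_candidate_ne {g : Fin d → Fin (d + 1) → ℝ} (h : candidate g ≠ 0) :
    (fun i : Fin d => candidate g i.castSucc) ≠ 0 := by
  intro h0
  have := sum_candidate h
  simp only [fun i => congrFun h0 i, Pi.zero_apply, Finset.sum_const_zero] at this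
  exact zero_ne_one this

/-- The halfspace whose boundary is spanned by `g`. -/
noncomputable def candidateHalfspace (g : Fin d → Fin (d + 1) → ℝ) (h : candidate g ≠ 0) : Halfspace d where
  normal i := candidate g i.castSucc
  offset := candidate g (Fin.last d)
  normal_ne := normal_ne_of_candidate_ne h

lemma candidateHalfspace_emb (g : Fin d → Fin (d + 1) → ℝ) (h : candidate g ≠ 0) :
    emb (candidateHalfspace g h).normal (candidateHalfspace g h).offset = candidate g :=
  emb_init (candidate g)

lemma candidateHalfspace_toSet (g : Fin d → Fin (d + 1) → ℝ) (h : candidate g ≠ 0) :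
    (candidateHalfspace g h).toSet = hs (candidate g) := by
  rw [Halfspace.toSet_eq, candidateHalfspace_emb]

/-- If the halfspace spanned by `d` generators contains all generators, then it belongs to a
facet. -/
lemma candidate_mem_facetHalfspaces (hY : Y.Nonempty) {g : Fin d → Fin (d + 1) → ℝ}
    (hg : ∀ j, g j ∈ gens Y) (hne : candidate g ≠ 0)
    (hnn : ∀ x ∈ gens Y, 0 ≤ candidate g ⬝ᵥ x) :
    (candidateHalfspace g hne).toSet ∈ facetHalfspaces (upperHull Y) := by
  set H := candidateHalfspace g hne with hH
  have hcp : crossProd g ≠ 0 := by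
    intro h; apply hne; rw [candidate_eq_smul, h, smul_zero]
  have hli := linearIndependent_of_crossProd_ne hcp
  have hsub : upperHull Y ⊆ H.toSet := by
    rw [hH, candidateHalfspace_toSet]; exact upperHull_subset_hs hnn
  have hbd : H.boundary = {z | candidate g ⬝ᵥ emb z (-1) = 0} := by
    ext z; rw [Halfspace.mem_boundary, hH, candidateHalfspace_emb]; rfl
  -- not all the generators are directions: then the normal vector would vanish
  have hpt : ∃ j, ∃ y ∈ Y, g j = emb y (-1) := by
    by_contra! hno
    have hlast : ∀ j, g j (Fin.last d) = 0 := by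
      intro j
      rcases hg j with ⟨i, hi⟩ | ⟨y, hy, hi⟩
      · rw [← hi]; simp
      · exact absurd hi.symm (hno j y hy)
    have hE : (emb 0 1 : Fin (d + 1) → ℝ) ≠ 0 := fun h => by
      simpa using congrFun h (Fin.last d)
    obtain ⟨a, -, ha⟩ := exists_crossProd_eq_smul hli hE (fun j => by
      rw [dotProduct_comm, dotProduct_emb]; simp [hlast])
    apply normal_ne_of_candidate_ne hne
    funext i
    simp [candidate, ha]
  have hnemp : (upperHull Y ∩ {z | candidate g ⬝ᵥ emb z (-1) = 0}).Nonempty := by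
    obtain ⟨j, y, hy, hj⟩ := hpt
    refine ⟨y, subset_upperHull Y hy, ?_⟩
    simp only [Set.mem_ofPred_eq]
    rw [← hj, candidate_dotProduct_self]
  have hspan := span_exposed hnn hnemp
  have hfin := finrank_span_emb hnemp
  rw [hspan] at hfin
  set L := Submodule.span ℝ {x ∈ gens Y | candidate g ⬝ᵥ x = 0} with hL
  have hge : d ≤ Module.finrank ℝ L := by
    have hmem : ∀ j, g j ∈ L := fun j =>
      Submodule.subset_span ⟨hg j, candidate_dotProduct_self g j⟩
    have hli' : LinearIndependent ℝ (fun j => (⟨g j, hmem j⟩ : L)) :=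
      LinearIndependent.of_comp L.subtype hli
    simpa using hli'.fintype_card_le_finrank
  have hlt : Module.finrank ℝ L < d + 1 := by
    have hker : L ≤ LinearMap.ker (dotProductBilin ℝ ℝ (candidate g)) := by
      rw [hL, Submodule.span_le]
      rintro x ⟨-, hx⟩
      simpa using hx
    have hne' : L ≠ ⊤ := by
      intro htop
      have : candidate g ∈ L := htop ▸ Submodule.mem_top
      have := hker this
      simp only [LinearMap.mem_ker, dotProductBilin_apply_apply] at this
      exact hne (dotProduct_self_eq_zero.mp this)
    simpa using Submodule.finrank_lt hne'
  refine ⟨H, rfl, hsub, upperHull Y ∩ H.boundary, ⟨Or.inr ⟨H, hsub, rfl⟩, ?_, ?_⟩,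
    Set.inter_subset_right⟩
  · rw [hbd]; exact hnemp
  · rw [hbd, affDim_upperHull hY]; omega

/-- Every halfspace that belongs to a facet is spanned by `d` generators. -/
lemma exists_candidate_of_mem_facetHalfspaces (hY : Y.Nonempty) {S : Set (Fin d → ℝ)}
    (hS : S ∈ facetHalfspaces (upperHull Y)) :
    ∃ g : Fin d → Fin (d + 1) → ℝ, (∀ j, g j ∈ gens Y) ∧ candidate g ≠ 0 ∧
      (∀ x ∈ gens Y, 0 ≤ candidate g ⬝ᵥ x) ∧ hs (candidate g) = S := by
  obtain ⟨H, rfl, hsub, G, ⟨hface, hGne, hdim⟩, hGH⟩ := hS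
  set v := emb H.normal H.offset with hv
  have hGP : G ⊆ upperHull Y := by
    rcases hface with rfl | ⟨H', -, rfl⟩
    · exact subset_rfl
    · exact Set.inter_subset_left
  have hbd : H.boundary = {z | v ⬝ᵥ emb z (-1) = 0} := by
    ext z; rw [Halfspace.mem_boundary]; rfl
  rw [Halfspace.toSet_eq] at hsub ⊢
  have hnn := nonneg_of_upperHull_subset_hs hY hsub
  rw [affDim_upperHull hY] at hdim
  have hGE : G ⊆ upperHull Y ∩ {z | v ⬝ᵥ emb z (-1) = 0} :=
    fun z hz => ⟨hGP hz, by have := hGH hz; rwa [hbd] at this⟩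
  have hspan := span_exposed hnn (hGne.mono hGE)
  have hle := Submodule.finrank_mono (Submodule.span_mono (R := ℝ)
    (Set.image_mono (f := fun z : Fin d → ℝ => emb z (-1 : ℝ)) hGE))
  rw [finrank_span_emb hGne, hdim, hspan] at hle
  obtain ⟨f, hf, -, hli⟩ := Submodule.exists_fun_fin_finrank_span_eq ℝ
    {g ∈ gens Y | v ⬝ᵥ g = 0}
  set g : Fin d → Fin (d + 1) → ℝ := fun j => f (Fin.castLE hle j)
  have hlig : LinearIndependent ℝ g := hli.comp _ (Fin.castLE_injective hle)
  have hv0 : v ≠ 0 := fun h => H.normal_ne (by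
    funext i; simpa [hv] using congrFun h i.castSucc)
  obtain ⟨a, ha, hcp⟩ := exists_crossProd_eq_smul hlig hv0 (fun j => (hf _).2)
  have hσ : 0 < ∑ i : Fin d, v i.castSucc := by
    have h1 : ∀ i ∈ Finset.univ, 0 ≤ v (Fin.castSucc (n := d) i) := fun i _ => by
      have := hnn _ (dir_mem_gens Y i)
      rwa [dotProduct_dir] at this
    refine (Finset.sum_nonneg h1).lt_of_ne fun h0 => H.normal_ne ?_
    funext i
    simpa [hv] using (Finset.sum_eq_zero_iff_of_nonneg h1).mp h0.symm i (Finset.mem_univ i)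
  have hc : candidate g = (∑ i : Fin d, v i.castSucc)⁻¹ • v := by
    rw [candidate_eq_smul, hcp]
    simp only [Pi.smul_apply, smul_eq_mul, ← Finset.mul_sum, smul_smul]
    congr 1
    field_simp
  refine ⟨g, fun j => (hf _).1, ?_, ?_, ?_⟩
  · rw [hc]; exact smul_ne_zero (inv_ne_zero hσ.ne') hv0
  · intro x hx
    rw [hc, smul_dotProduct, smul_eq_mul]
    exact mul_nonneg (inv_nonneg.mpr hσ.le) (hnn x hx)
  · rw [hc, hs_smul (inv_pos.mpr hσ)]

/-- The halfspaces of an inner approximation polyhedron have nonnegative normal vectors. -/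
lemma normal_nonneg_of_mem_facetHalfspaces (hY : Y.Nonempty) {H : Halfspace d}
    (hH : H.toSet ∈ facetHalfspaces (upperHull Y)) : 0 ≤ H.normal := by
  obtain ⟨-, -, hsub, -⟩ := hH
  rw [Halfspace.toSet_eq] at hsub
  intro i
  simpa [dotProduct_dir] using nonneg_of_upperHull_subset_hs hY hsub _ (dir_mem_gens Y i)

end Facets

/-! ### Encoding lengths of images -/

section Values

variable {d : ℕ} (I : MOMILP d)

/-- The objective function on rational points. -/
def MOMILP.ratF (x : Fin I.n → ℚ) (i : Fin d) : ℚ := ∑ j, I.Q i j * x j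

lemma MOMILP.f_toReal (x : Fin I.n → ℚ) (i : Fin d) : I.f (toReal x) i = (I.ratF x i : ℝ) := by
  simp [MOMILP.f, MOMILP.ratF, toReal]

lemma MOMILP.sum_ratSize_row_le (i : Fin d) : ∑ j, ratSize (I.Q i j) ≤ I.size := by
  have h : ∑ j, ratSize (I.Q i j) ≤ ∑ i, ∑ j, ratSize (I.Q i j) :=
    Finset.single_le_sum (f := fun i => ∑ j, ratSize (I.Q i j))
      (fun _ _ => Nat.zero_le _) (Finset.mem_univ i)
  unfold MOMILP.size
  omega

lemma MOMILP.n_le_size (hd : 0 < d) : I.n ≤ I.size := by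
  refine le_trans ?_ (I.sum_ratSize_row_le ⟨0, hd⟩)
  simpa using Finset.card_nsmul_le_sum Finset.univ (fun j => ratSize (I.Q ⟨0, hd⟩ j)) 1
    fun j _ => one_le_ratSize _

/-- Partial sums of the objective function have small height. -/
lemma MOMILP.height_partial_sum_le (x : Fin I.n → ℚ) (i : Fin d) (S : Finset (Fin I.n)) :
    height (∑ j ∈ S, I.Q i j * x j) ≤ 2 ^ (I.size + vecSize x) := by
  refine (height_sum_le_two_pow S _ (fun j => ratSize (I.Q i j) + ratSize (x j))
    fun j _ => ?_).trans (Nat.pow_le_pow_right (by norm_num) ?_)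
  · rw [pow_add]
    exact (height_mul_le _ _).trans
      (Nat.mul_le_mul (height_le_two_pow_ratSize _) (height_le_two_pow_ratSize _))
  · rw [Finset.sum_add_distrib]
    exact add_le_add ((Finset.sum_le_univ_sum_of_nonneg fun _ => Nat.zero_le _).trans
      (I.sum_ratSize_row_le i)) (Finset.sum_le_univ_sum_of_nonneg fun _ => Nat.zero_le _)

end Values

/-! ### The logarithmic grid -/

section Grid

/-- The cell of the logarithmic grid of ratio `1 + ε` that contains the number `y`, which is
assumed to be `0` or at least `2⁻ᴹ`. -/
noncomputable def gridIndex (ε : ℝ) (M : ℕ) (y : ℝ) : ℕ :=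
  if y = 0 then 0 else 1 + ⌊(Real.log y + M * Real.log 2) / Real.log (1 + ε)⌋₊

/-- The grid has `gridSize ε M + 2` cells between `2⁻ᴹ` and `2ᴹ`. -/
noncomputable def gridSize (ε : ℝ) (M : ℕ) : ℕ := ⌊2 * M * (1 + ε⁻¹)⌋₊

lemma log_bounds_of_height {q : ℚ} {M : ℕ} (h : height q ≤ 2 ^ M) (hq : 0 < q) :
    0 ≤ Real.log (q : ℝ) + M * Real.log 2 ∧ Real.log (q : ℝ) ≤ M * Real.log 2 := by
  have hn : (1 : ℝ) ≤ q.num := by exact_mod_cast Rat.num_pos.mpr hq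
  have hn' : (q.num : ℝ) ≤ 2 ^ M := by
    have h1 : q.num.natAbs ≤ 2 ^ M := (Nat.le_add_right _ _).trans h
    have h2 : ((q.num.natAbs : ℕ) : ℤ) = q.num := Int.natAbs_of_nonneg (Rat.num_pos.mpr hq).le
    have h3 : q.num ≤ 2 ^ M := by rw [← h2]; exact_mod_cast h1
    exact_mod_cast h3
  have hd : (1 : ℝ) ≤ q.den := by exact_mod_cast q.den_pos
  have hd' : (q.den : ℝ) ≤ 2 ^ M := by exact_mod_cast (Nat.le_add_left _ _).trans h
  have e : (q : ℝ) = q.num / q.den := by exact_mod_cast (Rat.num_div_den q).symm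
  have l1 := Real.log_nonneg hn
  have l2 := Real.log_nonneg hd
  have l3 := Real.log_le_log (by linarith) hn'
  have l4 := Real.log_le_log (by linarith) hd'
  rw [Real.log_pow] at l3 l4
  rw [e, Real.log_div (by linarith) (by linarith)]
  constructor <;> linarith

lemma gridIndex_lt {ε : ℝ} (hε : 0 < ε) {q : ℚ} {M : ℕ} (h : height q ≤ 2 ^ M) (hq : 0 ≤ q) :
    gridIndex ε M q < gridSize ε M + 2 := by
  unfold gridIndex
  split_ifs with h0
  · omega
  · have hq' : 0 < q := hq.lt_of_ne fun h => h0 (by simp [← h])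
    obtain ⟨h1, h2⟩ := log_bounds_of_height h hq'
    have hl : ε / (1 + ε) ≤ Real.log (1 + ε) := by
      have := Real.one_sub_inv_le_log_of_pos (show (0 : ℝ) < 1 + ε by linarith)
      have e : 1 - (1 + ε)⁻¹ = ε / (1 + ε) := by field_simp; ring
      rwa [e] at this
    have hpos : 0 < ε / (1 + ε) := by positivity
    have hlog2 : Real.log 2 ≤ 1 := by linarith [Real.log_two_lt_d9]
    have : ⌊(Real.log (q : ℝ) + M * Real.log 2) / Real.log (1 + ε)⌋₊ ≤ gridSize ε M := by
      refine Nat.floor_le_floor ?_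
      calc _ ≤ (2 * M : ℝ) / (ε / (1 + ε)) := by
            refine div_le_div₀ (by positivity) ?_ hpos hl
            have : (M : ℝ) * Real.log 2 ≤ M * 1 := by gcongr
            linarith
        _ = 2 * M * (1 + ε⁻¹) := by field_simp; ring
    omega

/-- Numbers in the same cell agree up to a factor of `1 + ε`. -/
lemma le_of_gridIndex_eq {ε : ℝ} (hε : 0 < ε) {q q' : ℚ} {M : ℕ} (h : height q ≤ 2 ^ M)
    (h' : height q' ≤ 2 ^ M) (hq : 0 ≤ q) (hq' : 0 ≤ q')
    (he : gridIndex ε M q = gridIndex ε M q') : (q : ℝ) ≤ (1 + ε) * q' := by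
  unfold gridIndex at he
  split_ifs at he with h0 h1 h1
  · rw [h0, h1]; simp
  · omega
  · omega
  · have hp : 0 < q := hq.lt_of_ne fun h => h0 (by simp [← h])
    have hp' : 0 < q' := hq'.lt_of_ne fun h => h1 (by simp [← h])
    obtain ⟨a1, -⟩ := log_bounds_of_height h hp
    obtain ⟨a1', -⟩ := log_bounds_of_height h' hp'
    have hL : 0 < Real.log (1 + ε) := Real.log_pos (by linarith)
    have hfl : ⌊(Real.log (q : ℝ) + M * Real.log 2) / Real.log (1 + ε)⌋₊
        = ⌊(Real.log (q' : ℝ) + M * Real.log 2) / Real.log (1 + ε)⌋₊ := by omega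
    have b1 := Nat.lt_floor_add_one ((Real.log (q : ℝ) + M * Real.log 2) / Real.log (1 + ε))
    have b2 := Nat.floor_le (div_nonneg a1' hL.le)
    rw [hfl] at b1
    have b3 : (Real.log (q : ℝ) + M * Real.log 2) / Real.log (1 + ε)
        < (Real.log (q' : ℝ) + M * Real.log 2) / Real.log (1 + ε) + 1 := by linarith
    rw [div_add_one hL.ne', div_lt_div_iff_of_pos_right hL] at b3
    have hpr : (0 : ℝ) < q := by exact_mod_cast hp
    have hpr' : (0 : ℝ) < q' := by exact_mod_cast hp'
    rw [← Real.log_le_log_iff hpr (by positivity), Real.log_mul (by positivity) hpr'.ne']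
    linarith

end Grid

/-! ### The number of iterations -/

section Iterations

variable {d : ℕ} (I : MOMILP d)

/-- The images of the solutions found so far. -/
def images (R : Finset (Fin I.n → ℚ)) : Set (Fin d → ℝ) :=
  (fun x => I.f (toReal x)) '' (R : Set (Fin I.n → ℚ))

/-- A bound on the logarithms of the heights of the images of the solutions that occur. -/
def imageBound (s : Polynomial ℕ) : ℕ := I.size + s.eval I.size

variable {I} {s : Polynomial ℕ}

lemma height_ratF_le {x : Fin I.n → ℚ} (hx : vecSize x ≤ s.eval I.size) (i : Fin d) :
    height (I.ratF x i) ≤ 2 ^ imageBound I s :=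
  (I.height_partial_sum_le x i Finset.univ).trans
    (Nat.pow_le_pow_right (by norm_num) (by unfold imageBound; omega))

variable (I s) in
/-- The grid cell of the image of a solution. -/
noncomputable def box (ε : ℝ) (x : Fin I.n → ℚ) (i : Fin d) : ℕ :=
  gridIndex ε (imageBound I s) (I.ratF x i)

variable (I s) in
/-- A feasible solution of encoding length at most `s(⟨I⟩)`. -/
def IsShort (x : Fin I.n → ℚ) : Prop := toReal x ∈ I.feasible ∧ vecSize x ≤ s.eval I.size

lemma ratF_nonneg (hI : ∀ x ∈ I.feasible, 0 ≤ I.f x) {x : Fin I.n → ℚ}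
    (hx : toReal x ∈ I.feasible) (i : Fin d) : 0 ≤ I.ratF x i := by
  have := hI _ hx i
  rw [I.f_toReal, Pi.zero_apply] at this
  exact Rat.cast_nonneg.mp this

/-- A solution that the oracle returns lies in a new cell of the grid. Otherwise its image times
`1 + ε` would dominate the image of a known solution, hence lie in the halfspace `H`. -/
lemma box_ne_of_answer (hI : ∀ x ∈ I.feasible, 0 ≤ I.f x) {ε : ℝ} (hε : 0 < ε)
    (hpO : PlaneSepOracle I s) {R : Finset (Fin I.n → ℚ)} (hR : ∀ x ∈ R, IsShort I s x)
    {H : Halfspace d} (hH : H.toSet ∈ facetHalfspaces (innerPoly I R)) {x : Fin I.n → ℚ}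
    (hx : hpO.answer (H.relax ε hε) = some x) {x' : Fin I.n → ℚ} (hx' : x' ∈ R) :
    box I s ε x' ≠ box I s ε x := by
  intro he
  have hmem : I.f (toReal x') ∈ (fun x => I.f (toReal x)) '' (R : Set (Fin I.n → ℚ)) :=
    ⟨x', hx', rfl⟩
  have hw : 0 ≤ H.normal := normal_nonneg_of_mem_facetHalfspaces ⟨_, hmem⟩ hH
  have hw' : 0 ≤ (H.relax ε hε).normal := smul_nonneg (by positivity) hw
  obtain ⟨h1, h2, h3⟩ := hpO.notInside _ x hw' hx
  apply h2
  have hin : H.offset ≤ H.normal ⬝ᵥ I.f (toReal x') := by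
    obtain ⟨-, -, hsub, -⟩ := hH
    exact hsub (subset_upperHull _ hmem)
  change H.offset ≤ ((1 + ε) • H.normal) ⬝ᵥ I.f (toReal x)
  refine hin.trans ?_
  simp only [dotProduct, Pi.smul_apply, smul_eq_mul]
  refine Finset.sum_le_sum fun i _ => ?_
  rw [I.f_toReal, I.f_toReal, mul_comm (1 + ε), mul_assoc]
  exact mul_le_mul_of_nonneg_left (le_of_gridIndex_eq hε (height_ratF_le (hR x' hx').2 i)
    (height_ratF_le h3 i) (ratF_nonneg hI (hR x' hx').1 i) (ratF_nonneg hI h1 i)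
    (congrFun he i)) (hw i)

variable (I) in
open Classical in
/-- The generators as a finite set. -/
noncomputable def gensFinset (R : Finset (Fin I.n → ℚ)) : Finset (Fin (d + 1) → ℝ) :=
  Finset.univ.image (fun i : Fin d => emb (Pi.single i (1 : ℝ)) 0)
    ∪ R.image fun x => emb (I.f (toReal x)) (-1)

lemma coe_gensFinset (R : Finset (Fin I.n → ℚ)) :
    (gensFinset I R : Set (Fin (d + 1) → ℝ)) = gens (images I R) := by
  simp [gensFinset, gens, images, Set.image_image]

lemma card_gensFinset_le (R : Finset (Fin I.n → ℚ)) : (gensFinset I R).card ≤ d + R.card := by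
  classical
  refine (Finset.card_union_le _ _).trans (add_le_add ?_ Finset.card_image_le)
  exact Finset.card_image_le.trans (by simp)

variable (I) in
open Classical in
/-- The halfspaces that are spanned by generators. -/
noncomputable def spannedHalfspaces (R : Finset (Fin I.n → ℚ)) : Finset (Set (Fin d → ℝ)) :=
  (Fintype.piFinset fun _ : Fin d => gensFinset I R).image fun g => hs (candidate g)

lemma card_spannedHalfspaces_le (R : Finset (Fin I.n → ℚ)) :
    (spannedHalfspaces I R).card ≤ (d + R.card) ^ d := by
  refine Finset.card_image_le.trans ?_
  simp only [Fintype.card_piFinset, Finset.prod_const, Finset.card_univ, Fintype.card_fin]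
  exact Nat.pow_le_pow_left (card_gensFinset_le R) d

lemma spannedHalfspaces_mono {R R' : Finset (Fin I.n → ℚ)} (h : R ⊆ R') :
    spannedHalfspaces I R ⊆ spannedHalfspaces I R' := by
  classical
  refine Finset.image_subset_image (Fintype.piFinset_subset _ _ fun _ => ?_)
  exact Finset.union_subset_union_right (Finset.image_subset_image h)

lemma mem_spannedHalfspaces {R : Finset (Fin I.n → ℚ)} (hR : R.Nonempty) {S : Set (Fin d → ℝ)}
    (hS : S ∈ facetHalfspaces (innerPoly I R)) : S ∈ spannedHalfspaces I R := by
  classical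
  obtain ⟨g, hg, -, -, rfl⟩ := exists_candidate_of_mem_facetHalfspaces (Y := images I R)
    (by simpa [images] using hR) hS
  refine Finset.mem_image.mpr ⟨g, Fintype.mem_piFinset.mpr fun j => ?_, rfl⟩
  rw [← Finset.mem_coe, coe_gensFinset]
  exact hg j

/-- What holds whenever the main loop of the algorithm is entered. -/
structure ReachInv (s : Polynomial ℕ) (ε : ℝ) (ℓ : List (Halfspace d))
    (R : Finset (Fin I.n → ℚ)) (F : Set (Set (Fin d → ℝ))) : Prop where
  nonempty : R.Nonempty
  short : ∀ x ∈ R, IsShort I s x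
  inj : Set.InjOn (box I s ε) (R : Set (Fin I.n → ℚ))
  spanned : F ⊆ spannedHalfspaces I R
  length : ℓ.length + 1 = R.card + F.ncard

lemma Reaches.inv (hI : ∀ x ∈ I.feasible, 0 ≤ I.f x) {x₀ : Fin I.n → ℚ} (hx₀ : IsShort I s x₀)
    {ε : ℝ} (hε : 0 < ε) (hpO : PlaneSepOracle I s) {ℓ : List (Halfspace d)}
    {R : Finset (Fin I.n → ℚ)} {F : Set (Set (Fin d → ℝ))}
    (h : Reaches I ε hε hpO.answer x₀ ℓ R F) : ReachInv s ε ℓ R F := by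
  induction h with
  | start =>
    exact ⟨by simp, by simpa using hx₀, by simp, by simp, by simp⟩
  | @notInside ℓ R F H x h hH hx ih =>
    have hbox := fun x' hx' => box_ne_of_answer hI hε hpO ih.short hH.1 hx (x' := x') hx'
    have hxR : x ∉ R := fun hxR => hbox x hxR rfl
    have hw : 0 ≤ (H.relax ε hε).normal := smul_nonneg (by positivity)
      (normal_nonneg_of_mem_facetHalfspaces (Y := images I R)
        (by simpa [images] using ih.nonempty) hH.1)
    obtain ⟨h1, -, h3⟩ := hpO.notInside _ x hw hx
    refine ⟨by simp, ?_, ?_, ih.spanned.trans ?_, ?_⟩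
    · intro y hy
      rcases Finset.mem_insert.mp hy with rfl | hy
      · exact ⟨h1, h3⟩
      · exact ih.short y hy
    · rw [Finset.coe_insert, Set.injOn_insert (by simpa using hxR)]
      refine ⟨ih.inj, ?_⟩
      rintro ⟨x', hx', he⟩
      exact hbox x' hx' he
    · exact_mod_cast spannedHalfspaces_mono (Finset.subset_insert x R)
    · have := ih.length
      rw [Finset.card_insert_of_notMem hxR, List.length_append, List.length_singleton]
      omega
  | @inside ℓ R F H h hH hx ih =>
    have hfin : F.Finite := (Finset.finite_toSet _).subset ih.spanned
    refine ⟨ih.nonempty, ih.short, ih.inj, ?_, ?_⟩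
    · rw [Set.union_subset_iff, Set.singleton_subset_iff]
      exact ⟨ih.spanned, mem_spannedHalfspaces ih.nonempty hH.1⟩
    · have := ih.length
      rw [Set.union_singleton, Set.ncard_insert_of_notMem hH.2 hfin, List.length_append,
        List.length_singleton]
      omega

/-- A bound on the number of solutions that are found. -/
noncomputable def cardBound (d : ℕ) (ε : ℝ) (M : ℕ) : ℕ := (gridSize ε M + 2) ^ d

/-- A bound on the number of iterations. -/
noncomputable def lengthBound (d : ℕ) (ε : ℝ) (M : ℕ) : ℕ :=
  cardBound d ε M + (d + cardBound d ε M) ^ d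

lemma ReachInv.card_le (hI : ∀ x ∈ I.feasible, 0 ≤ I.f x) {ε : ℝ} (hε : 0 < ε)
    {ℓ : List (Halfspace d)} {R : Finset (Fin I.n → ℚ)} {F : Set (Set (Fin d → ℝ))}
    (h : ReachInv s ε ℓ R F) : R.card ≤ cardBound d ε (imageBound I s) := by
  classical
  have := Finset.card_le_card_of_injOn
    (t := Fintype.piFinset fun _ : Fin d => Finset.range (gridSize ε (imageBound I s) + 2))
    (box I s ε) (fun x hx => ?_) h.inj
  · simpa [cardBound] using this
  · rw [Finset.mem_coe, Fintype.mem_piFinset]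
    intro i
    rw [Finset.mem_range]
    exact gridIndex_lt hε (height_ratF_le (h.short x hx).2 i) (ratF_nonneg hI (h.short x hx).1 i)

lemma ReachInv.length_add_one_le (hI : ∀ x ∈ I.feasible, 0 ≤ I.f x) {ε : ℝ} (hε : 0 < ε)
    {ℓ : List (Halfspace d)} {R : Finset (Fin I.n → ℚ)} {F : Set (Set (Fin d → ℝ))}
    (h : ReachInv s ε ℓ R F) : ℓ.length + 1 ≤ lengthBound d ε (imageBound I s) := by
  have h1 := h.card_le hI hε
  have h2 : F.ncard ≤ (d + cardBound d ε (imageBound I s)) ^ d := by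
    refine (Set.ncard_le_ncard h.spanned (Finset.finite_toSet _)).trans ?_
    rw [Set.ncard_coe_finset]
    exact (card_spannedHalfspaces_le R).trans (Nat.pow_le_pow_left (by omega) d)
  rw [h.length, lengthBound]
  omega

end Iterations

/-! ### Building blocks of the program -/

section Blocks

/-- Cell `i` of array `k`. -/
def cell (k i : ℕ) : Expr := .load k (.const i)

/-- Entry `l` of row `r` of array `k`, whose rows have width `w`. -/
def entry (k : ℕ) (r w l : Expr) : Expr := .load k (.add (.mul r w) l)

/-- The sum of finitely many expressions. -/
def sumExpr : (m : ℕ) → (Fin m → Expr) → Expr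
  | 0, _ => .const 0
  | m + 1, e => .add (e 0) (sumExpr m fun j => e j.succ)

/-- The determinant of a matrix of expressions, expanded along the first row. -/
def detExpr : (m : ℕ) → (Fin m → Fin m → Expr) → Expr
  | 0, _ => .const 1
  | m + 1, a => sumExpr (m + 1) fun j =>
      .mul (.mul (.const ((-1) ^ (j : ℕ))) (a 0 j))
        (detExpr m fun i l => a i.succ (j.succAbove l))

/-- Store the values of `e 0, …, e (m - 1)` in the cells `base, …, base + m - 1` of array `k`. -/
def storeRow (k : ℕ) (base : Expr) (e : ℕ → Expr) : ℕ → Prog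
  | 0 => .skip
  | m + 1 => .seq (storeRow k base e m) (.store k (.add base (.const m)) (e m))

/-- The memory after the numbers `v 0, …, v (m - 1)` have been written to the cells
`b, …, b + m - 1` of array `k`. -/
def writeRow (μ : Mem) (k b m : ℕ) (v : ℕ → ℚ) : Mem :=
  Function.update μ k fun c => if b ≤ c ∧ c < b + m then v (c - b) else μ k c

lemma eval_add (μ : Mem) (e₁ e₂ : Expr) : (e₁.add e₂).eval μ = e₁.eval μ + e₂.eval μ := rfl

lemma eval_mul (μ : Mem) (e₁ e₂ : Expr) : (e₁.mul e₂).eval μ = e₁.eval μ * e₂.eval μ := rfl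

lemma eval_cell (μ : Mem) (k i : ℕ) : (cell k i).eval μ = μ k i := by
  simp [cell, Expr.eval]

lemma eval_load {μ : Mem} {k m : ℕ} {e : Expr} (h : e.eval μ = (m : ℚ)) :
    (Expr.load k e).eval μ = μ k m := by
  simp [Expr.eval, h]

lemma eval_entry {μ : Mem} {k a w l : ℕ} {r w' l' : Expr} (hr : r.eval μ = (a : ℚ))
    (hw : w'.eval μ = (w : ℚ)) (hl : l'.eval μ = (l : ℚ)) :
    (entry k r w' l').eval μ = μ k (a * w + l) :=
  eval_load (by simp [Expr.eval, hr, hw, hl])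

lemma eval_sumExpr (μ : Mem) (m : ℕ) (e : Fin m → Expr) :
    (sumExpr m e).eval μ = ∑ j, (e j).eval μ := by
  induction m with
  | zero => simp [sumExpr, Expr.eval]
  | succ m ih => rw [sumExpr, Expr.eval, ih, Fin.sum_univ_succ]

lemma eval_detExpr (μ : Mem) (m : ℕ) (a : Fin m → Fin m → Expr) :
    (detExpr m a).eval μ = (Matrix.of fun i j => (a i j).eval μ).det := by
  induction m with
  | zero => simp [detExpr, Expr.eval]
  | succ m ih =>
    rw [detExpr, eval_sumExpr, Matrix.det_succ_row_zero]
    refine Finset.sum_congr rfl fun j _ => ?_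
    simp only [Expr.eval, ih]
    rfl

lemma writeRow_array_ne {μ : Mem} {k b m : ℕ} {v : ℕ → ℚ} {k' : ℕ} (h : k' ≠ k) :
    writeRow μ k b m v k' = μ k' := by simp [writeRow, h]

lemma writeRow_in {μ : Mem} {k b m : ℕ} {v : ℕ → ℚ} {i : ℕ} (h : i < m) :
    writeRow μ k b m v k (b + i) = v i := by simp [writeRow, h]

lemma writeRow_out {μ : Mem} {k b m : ℕ} {v : ℕ → ℚ} {c : ℕ} (h : ¬ (b ≤ c ∧ c < b + m)) :
    writeRow μ k b m v k c = μ k c := by simp only [writeRow, Function.update_self, if_neg h]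

lemma writeRow_zero (μ : Mem) (k b : ℕ) (v : ℕ → ℚ) : writeRow μ k b 0 v = μ := by
  unfold writeRow
  convert Function.update_eq_self k μ using 2
  funext c
  rw [if_neg (by omega)]

lemma writeRow_succ (μ : Mem) (k b m : ℕ) (v : ℕ → ℚ) :
    (writeRow μ k b m v).set k (b + m) (v m) = writeRow μ k b (m + 1) v := by
  funext k' c
  by_cases hk : k' = k
  · subst hk
    by_cases hc : c = b + m
    · subst hc; rw [Mem.set_same, writeRow_in (by omega)]
    · rw [Mem.set_cell_ne _ _ _ hc]
      simp only [writeRow, Function.update_self]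
      congr 1
      simp only [eq_iff_iff]; omega
  · rw [Mem.set_array_ne _ _ _ hk, writeRow_array_ne hk, writeRow_array_ne hk]

lemma Bdd.writeRow {B : ℕ} {μ : Mem} (h : Bdd B μ) {k b m : ℕ} {v : ℕ → ℚ}
    (hv : ∀ j < m, height (v j) ≤ 2 ^ B) : Bdd B (writeRow μ k b m v) := by
  intro k' c
  by_cases hk : k' = k
  · subst hk
    simp only [InnerApx.writeRow, Function.update_self]
    split_ifs with hc
    · exact hv _ (by omega)
    · exact h _ _
  · rw [writeRow_array_ne hk]; exact h _ _

variable {d n : ℕ} {ask : Halfspace d → Option (Fin n → ℚ)} {askTime : Halfspace d → ℕ} {B : ℕ}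

lemma Run.storeRow (hB : 1 ≤ B) {μ : Mem} (hμ : Bdd B μ) {k : ℕ} {base : Expr} {e : ℕ → Expr}
    {b m : ℕ} {v : ℕ → ℚ} (hbase : ∀ j < m, base.eval (writeRow μ k b j v) = (b : ℚ))
    (he : ∀ j < m, (e j).eval (writeRow μ k b j v) = v j) (hv : ∀ j < m, height (v j) ≤ 2 ^ B) :
    Run ask askTime B (storeRow k base e m) 1 μ [] (writeRow μ k b m v) := by
  induction m with
  | zero => rw [writeRow_zero]; exact .skip hB μ
  | succ m ih =>
    have h1 := ih (fun j hj => hbase j (by omega)) (fun j hj => he j (by omega))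
      (fun j hj => hv j (by omega))
    have h2 := Run.store (ask := ask) (askTime := askTime) hB
      (hμ.writeRow (k := k) (b := b) fun j (hj : j < m) => hv j (by omega)) k
      (.add base (.const m)) (e m) (j := b + m) (q := v m)
      (by simp [Expr.eval, hbase m (by omega)]) (he m (by omega))
    rw [writeRow_succ] at h2
    exact .seq hB le_rfl h1 h2

/-- Set the flag in array `14` if the body does so in some round. -/
lemma Run.searchLoop (hB : 1 ≤ B) {lim : Expr} {body : Prog} {m : ℕ} (hm : m ≤ B)
    {μ : Mem} (hμ : Bdd B μ) (V : ℕ → Prop)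
    (hlim : ∀ μ' : Mem, (∀ k, k ≠ 14 → k ≠ 15 → μ' k = μ k) → lim.eval μ' = (m : ℚ))
    (hbody : ∀ r < m, ∀ μ' : Mem, (∀ k, k ≠ 14 → k ≠ 15 → μ' k = μ k) → μ' 15 0 = (r : ℚ) →
      Bdd B μ' → (V r → Run ask askTime B body 1 μ' [] (μ'.set 14 0 1)) ∧
        (¬ V r → Run ask askTime B body 1 μ' [] μ')) :
    ∃ μ' : Mem, Run ask askTime B (InnerApx.forLoop 15 lim body) (m + 1) μ [] μ' ∧ Bdd B μ' ∧
      (∀ k, k ≠ 14 → k ≠ 15 → μ' k = μ k) ∧ (μ' 14 0 = 0 ↔ μ 14 0 = 0 ∧ ∀ r < m, ¬ V r) ∧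
      (0 ≤ μ 14 0 → 0 ≤ μ' 14 0) := by
  have key := Run.forLoop (ask := ask) (askTime := askTime) (c := 15) (lim := lim)
    (body := body) (N := 1) (m := m) (μ := μ) hB le_rfl
    (fun j μ' => j ≤ m ∧ Bdd B μ' ∧ (∀ k, k ≠ 14 → k ≠ 15 → μ' k = μ k) ∧
      (μ' 14 0 = 0 ↔ μ 14 0 = 0 ∧ ∀ r < j, ¬ V r) ∧ (0 ≤ μ 14 0 → 0 ≤ μ' 14 0))
    (fun j μ' h => h.2.1) (fun j μ' h => hlim μ' h.2.2.1) ?_ hμ ?_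
  · obtain ⟨μ', hr, h⟩ := key
    exact ⟨μ', by simpa using hr, h.2⟩
  · rintro j hj μ' ⟨-, hb, hag, hfl, hnn⟩ hc
    obtain ⟨h1, h2⟩ := hbody j hj μ' hag hc hb
    have hq : height ((j + 1 : ℕ) : ℚ) ≤ 2 ^ B := height_natCast_le (by omega)
    by_cases hV : V j
    · have hb1 : Bdd B (μ'.set 14 0 1) := hb.set (height_one_le hB)
      refine ⟨_, h1 hV, hb1, ?_, hj, hb1.set hq, ?_, ?_, ?_⟩
      · rw [Mem.set_array_ne _ _ _ (by norm_num), hc]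
      · intro k h14 h15
        rw [Mem.set_array_ne _ _ _ h15, Mem.set_array_ne _ _ _ h14, hag k h14 h15]
      · rw [Mem.set_array_ne _ _ _ (by norm_num), Mem.set_same]
        simp only [one_ne_zero, false_iff, not_and, not_forall]
        exact fun _ => ⟨j, by omega, not_not.mpr hV⟩
      · rw [Mem.set_array_ne _ _ _ (by norm_num), Mem.set_same]
        exact fun _ => zero_le_one
    · refine ⟨_, h2 hV, hb, hc, hj, hb.set hq, ?_, ?_, ?_⟩
      · intro k h14 h15
        rw [Mem.set_array_ne _ _ _ h15, hag k h14 h15]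
      · rw [Mem.set_array_ne _ _ _ (by norm_num), hfl]
        refine and_congr_right fun _ => ⟨fun h r hr => ?_, fun h r hr => h r (by omega)⟩
        rcases Nat.lt_succ_iff_lt_or_eq.mp hr with hr | rfl
        · exact h r hr
        · exact hV
      · rwa [Mem.set_array_ne _ _ _ (by norm_num)]
  · refine ⟨Nat.zero_le _, hμ.set (height_zero_le B), ?_, ?_, ?_⟩
    · intro k _ h15
      rw [Mem.set_array_ne _ _ _ h15]
    · rw [Mem.set_array_ne _ _ _ (by norm_num)]; simp
    · rw [Mem.set_array_ne _ _ _ (by norm_num)]; exact id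

end Blocks

/-! ### The odometer -/

section Odometer

variable (d : ℕ)

/-- The number of generators, that is, `d` plus the number of solutions. -/
def numGens : Expr := .add (.const d) (cell 5 0)

/-- Propagate carries through the first `m` digits of array `10`, to the base given by the number of
generators. -/
def carry : ℕ → Prog
  | 0 => .skip
  | m + 1 => .seq (carry m) (.ifLe (numGens d) (cell 10 m)
      (.seq (.store 10 (.const m) (.const 0))
        (.store 10 (.const (m + 1 : ℕ)) (.add (cell 10 (m + 1)) (.const 1)))) .skip)

/-- Pass to the next tuple of generators. -/
def increment : Prog :=
  .seq (.store 10 (.const 0) (.add (cell 10 0) (.const 1))) (carry d d)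

/-- The number with the digits `D 0, …, D d` to base `N`. -/
def value (N : ℕ) (D : ℕ → ℕ) : ℕ := ∑ j ∈ Finset.range (d + 1), D j * N ^ j

variable {d} {n : ℕ} {ask : Halfspace d → Option (Fin n → ℚ)} {askTime : Halfspace d → ℕ} {B : ℕ}

lemma Run.carry (hB : 1 ≤ B) {μ : Mem} (hμ : Bdd B μ) {c : ℕ} (hc : μ 5 0 = (c : ℚ))
    (hcB : d + c < B) {D : ℕ → ℕ} (hD : ∀ j ≤ d, μ 10 j = (D j : ℚ)) (hD0 : D 0 ≤ d + c)
    (hDj : ∀ j, 1 ≤ j → j < d → D j < d + c) (hDd : 1 ≤ d → D d = 0) (m : ℕ) (hm : m ≤ d) :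
    ∃ (μ' : Mem) (D' : ℕ → ℕ), Run ask askTime B (carry d m) 1 μ [] μ' ∧ Bdd B μ' ∧
      (∀ k, k ≠ 10 → μ' k = μ k) ∧ (∀ j ≤ d, μ' 10 j = (D' j : ℚ)) ∧
      value d (d + c) D' = value d (d + c) D ∧ (∀ j < m, D' j < d + c) ∧
      D' m ≤ d + c ∧ ∀ j, m < j → D' j = D j := by
  induction m with
  | zero => exact ⟨μ, D, .skip hB μ, hμ, fun _ _ => rfl, hD, rfl, by simp, hD0,
      fun _ _ => rfl⟩
  | succ m ih =>
    obtain ⟨μ', D', hr, hb, hag, hd, hval, hlt, hm2, hgt⟩ := ih (by omega)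
    have hN : (numGens d).eval μ' = ((d + c : ℕ) : ℚ) := by
      simp [numGens, Expr.eval, eval_cell, hag 5 (by norm_num), hc]
    have hcell : (cell 10 m).eval μ' = (D' m : ℚ) := by rw [eval_cell, hd m (by omega)]
    have hnext : D' (m + 1) = D (m + 1) := hgt _ (by omega)
    have hDm : D (m + 1) < d + c ∨ D (m + 1) = 0 := by
      rcases Nat.lt_or_ge (m + 1) d with h | h
      · exact Or.inl (hDj _ (by omega) h)
      · obtain rfl : m + 1 = d := by omega
        exact Or.inr (hDd (by omega))
    by_cases hcase : d + c ≤ D' m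
    · have hDN : D' m = d + c := le_antisymm hm2 hcase
      have r1 := Run.store (ask := ask) (askTime := askTime) hB hb 10 (.const m) (.const 0)
        (j := m) (q := 0) (by simp [Expr.eval]) (by simp [Expr.eval])
      have hb1 : Bdd B (μ'.set 10 m 0) := hb.set (height_zero_le B)
      have r2 := Run.store (ask := ask) (askTime := askTime) hB hb1 10 (.const (m + 1 : ℕ))
        (.add (cell 10 (m + 1)) (.const 1)) (j := m + 1) (q := ((D' (m + 1) + 1 : ℕ) : ℚ))
        (by simp [Expr.eval]) (by
          simp only [Expr.eval, eval_cell]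
          rw [Mem.set_cell_ne _ _ _ (by omega), hd _ hm]
          push_cast; ring)
      refine ⟨_, Function.update (Function.update D' m 0) (m + 1) (D' (m + 1) + 1),
        .seq hB le_rfl hr (.ifTrue hB le_rfl hb ?_ (.seq hB le_rfl r1 r2)),
        hb1.set (height_natCast_le (by omega)), ?_, ?_, ?_, ?_, ?_, ?_⟩
      · rw [hN, hcell]; exact_mod_cast hcase
      · intro k hk
        rw [Mem.set_array_ne _ _ _ hk, Mem.set_array_ne _ _ _ hk, hag k hk]
      · intro j hj
        by_cases h1 : j = m + 1
        · subst h1; simp [Mem.set_same]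
        · rw [Mem.set_cell_ne _ _ _ h1, Function.update_of_ne h1]
          by_cases h2 : j = m
          · subst h2; simp [Mem.set_same]
          · rw [Mem.set_cell_ne _ _ _ h2, Function.update_of_ne h2, hd j hj]
      · rw [← hval]
        unfold value
        -- only the digits `m` and `m + 1` change
        have hsub : ({m, m + 1} : Finset ℕ) ⊆ Finset.range (d + 1) := by
          intro j hj
          simp only [Finset.mem_insert, Finset.mem_singleton] at hj
          rw [Finset.mem_range]; omega
        rw [← Finset.sum_sdiff hsub, ← Finset.sum_sdiff hsub]
        congr 1
        · refine Finset.sum_congr rfl fun j hj => ?_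
          simp only [Finset.mem_sdiff, Finset.mem_insert, Finset.mem_singleton, not_or] at hj
          rw [Function.update_of_ne hj.2.2, Function.update_of_ne hj.2.1]
        · rw [Finset.sum_pair (by omega), Finset.sum_pair (by omega), Function.update_self,
            Function.update_of_ne (by omega), Function.update_self, hDN]
          ring
      · intro j hj
        rw [Function.update_of_ne (by omega)]
        by_cases h2 : j = m
        · subst h2; simp only [Function.update_self]; omega
        · rw [Function.update_of_ne h2]; exact hlt j (by omega)
      · simp only [Function.update_self]; omega
      · intro j hj
        rw [Function.update_of_ne (by omega), Function.update_of_ne (by omega)]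
        exact hgt j (by omega)
    · refine ⟨μ', D', .seq hB le_rfl hr (.ifFalse hB le_rfl hb ?_ (.skip hB _)), hb, hag, hd,
        hval, ?_, by omega, fun j hj => hgt j (by omega)⟩
      · rw [hN, hcell]; exact_mod_cast hcase
      · intro j hj
        rcases Nat.lt_succ_iff_lt_or_eq.mp hj with h | rfl
        · exact hlt j h
        · omega

lemma Run.increment (hd : 0 < d) (hB : 1 ≤ B) {μ : Mem} (hμ : Bdd B μ) {c : ℕ}
    (hc : μ 5 0 = (c : ℚ)) (hcB : d + c < B) {D : ℕ → ℕ} (hD : ∀ j ≤ d, μ 10 j = (D j : ℚ))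
    (hDj : ∀ j < d, D j < d + c) (hDd : D d = 0) :
    ∃ (μ' : Mem) (D' : ℕ → ℕ), Run ask askTime B (increment d) 1 μ [] μ' ∧ Bdd B μ' ∧
      (∀ k, k ≠ 10 → μ' k = μ k) ∧ (∀ j ≤ d, μ' 10 j = (D' j : ℚ)) ∧
      value d (d + c) D' = value d (d + c) D + 1 ∧ ∀ j < d, D' j < d + c := by
  have r1 := Run.store (ask := ask) (askTime := askTime) hB hμ 10 (.const 0)
    (.add (cell 10 0) (.const 1)) (j := 0) (q := ((D 0 + 1 : ℕ) : ℚ)) (by simp [Expr.eval])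
    (by simp [Expr.eval, eval_cell, hD 0 (by omega)])
  have h0 := hDj 0 hd
  have hb1 : Bdd B (μ.set 10 0 ((D 0 + 1 : ℕ) : ℚ)) := hμ.set (height_natCast_le (by omega))
  obtain ⟨μ', D', hr, hb, hag, hd', hval, hlt, -, -⟩ := Run.carry (ask := ask)
    (askTime := askTime) (c := c) (D := Function.update D 0 (D 0 + 1)) hB hb1
    (by rw [Mem.set_array_ne _ _ _ (by norm_num), hc]) hcB
    (fun j hj => by
      by_cases h : j = 0
      · subst h; simp [Mem.set_same]
      · rw [Mem.set_cell_ne _ _ _ h, Function.update_of_ne h, hD j hj])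
    (by simp only [Function.update_self]; omega)
    (fun j h1 hj => by rw [Function.update_of_ne (by omega)]; exact hDj j hj)
    (fun _ => by rw [Function.update_of_ne (by omega), hDd]) d le_rfl
  refine ⟨μ', D', .seq hB le_rfl r1 hr, hb, ?_, hd', ?_, hlt⟩
  · intro k hk
    rw [hag k hk, Mem.set_array_ne _ _ _ hk]
  · rw [hval]
    unfold value
    rw [Finset.sum_range_succ', Finset.sum_range_succ']
    simp only [Function.update_self, pow_zero, mul_one]
    rw [← add_assoc]
    congr 2

/-- Digits are determined by the number they represent. -/
lemma digits_unique {N m : ℕ} {D D' : ℕ → ℕ} (hD : ∀ j < m, D j < N) (hD' : ∀ j < m, D' j < N)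
    (h : ∑ j ∈ Finset.range m, D j * N ^ j = ∑ j ∈ Finset.range m, D' j * N ^ j) :
    ∀ j < m, D j = D' j := by
  induction m generalizing D D' with
  | zero => intro j hj; omega
  | succ m ih =>
    have key : ∀ D : ℕ → ℕ, ∑ j ∈ Finset.range (m + 1), D j * N ^ j
        = D 0 + N * ∑ j ∈ Finset.range m, D (j + 1) * N ^ j := by
      intro D
      rw [Finset.sum_range_succ', Finset.mul_sum, pow_zero, mul_one, add_comm]
      congr 1
      exact Finset.sum_congr rfl fun j _ => by ring
    rw [key, key] at h
    have h0 := hD 0 (by omega)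
    have h0' := hD' 0 (by omega)
    have e0 : D 0 = D' 0 := by
      have := congrArg (· % N) h
      simpa [Nat.add_mul_mod_self_left, Nat.mod_eq_of_lt h0, Nat.mod_eq_of_lt h0'] using this
    rw [e0] at h
    have h2 := Nat.eq_of_mul_eq_mul_left (by omega) (Nat.add_left_cancel h)
    have h3 := ih (D := fun j => D (j + 1)) (D' := fun j => D' (j + 1))
      (fun j hj => hD _ (by omega)) (fun j hj => hD' _ (by omega)) h2
    intro j hj
    cases j with
    | zero => exact e0
    | succ j => exact h3 j (by omega)

lemma sum_digits_lt {N m : ℕ} {D : ℕ → ℕ} (hD : ∀ j < m, D j < N) :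
    ∑ j ∈ Finset.range m, D j * N ^ j < N ^ m := by
  induction m with
  | zero => simp
  | succ m ih =>
    rw [Finset.sum_range_succ, pow_succ]
    have h1 := ih fun j hj => hD j (by omega)
    have h2 := hD m (by omega)
    calc _ < N ^ m + D m * N ^ m := by omega
      _ = (D m + 1) * N ^ m := by ring
      _ ≤ N * N ^ m := Nat.mul_le_mul_right _ h2
      _ = _ := mul_comm _ _

end Odometer

/-! ### Recording a solution -/

section AddPoint

/-- The number of variables. -/
def numVars : Expr := .add (cell 0 0) (cell 0 1)

/-- Append the solution in the cells `off, off + 1, …` of array `src` to the list of solutions in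
array `6`, append its homogenized image to the list of generators in array `8`, and increase the
number of solutions in array `5`. -/
def addPoint (d src off : ℕ) : Prog :=
  .seq (storeRow 8 (.mul (numGens d) (.const (d + 1 : ℕ)))
      (fun i => if i < d then .const 0 else .const (-1)) (d + 1))
    (.seq (forLoop 15 numVars
        (.seq (.store 6 (.add (.mul (cell 5 0) numVars) (cell 15 0))
            (.load src (.add (cell 15 0) (.const off))))
          (storeRow 8 (.mul (numGens d) (.const (d + 1 : ℕ)))
            (fun i => .add (entry 8 (numGens d) (.const (d + 1 : ℕ)) (.const i))
              (.mul (entry 1 (.const i) numVars (cell 15 0))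
                (.load src (.add (cell 15 0) (.const off))))) d)))
      (.store 5 (.const 0) (.add (cell 5 0) (.const 1))))

variable {d : ℕ} {I : MOMILP d} {ask : Halfspace d → Option (Fin I.n → ℚ)}
  {askTime : Halfspace d → ℕ} {B : ℕ}

lemma eval_numVars {μ : Mem} (h0 : μ 0 0 = I.nR) (h1 : μ 0 1 = I.nZ) :
    numVars.eval μ = (I.n : ℚ) := by
  simp [numVars, Expr.eval, eval_cell, h0, h1]

lemma eval_numGens {μ : Mem} {c : ℕ} (hc : μ 5 0 = (c : ℚ)) :
    (numGens d).eval μ = ((d + c : ℕ) : ℚ) := by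
  simp [numGens, Expr.eval, eval_cell, hc]

lemma Run.addPoint (hB : 1 ≤ B) {μ : Mem} (hμ : Bdd B μ) (h0 : μ 0 0 = I.nR) (h1 : μ 0 1 = I.nZ)
    (hQ : ∀ (i : Fin d) (j : Fin I.n), μ 1 (i * I.n + j) = I.Q i j) {x : Fin I.n → ℚ}
    {src off : ℕ} (hsrc : ∀ j : Fin I.n, μ src (j + off) = x j)
    (hne : src ≠ 6 ∧ src ≠ 8 ∧ src ≠ 15) {c : ℕ} (hc : μ 5 0 = (c : ℚ))
    (hcB : c + 1 ≤ B) (hn : I.n ≤ B) (hx : I.size + vecSize x ≤ B) :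
    ∃ μ' : Mem, Run ask askTime B (addPoint d src off) (B + 1) μ [] μ' ∧ Bdd B μ' ∧
      (∀ k, k ≠ 5 → k ≠ 6 → k ≠ 8 → k ≠ 15 → μ' k = μ k) ∧ μ' 5 0 = ((c + 1 : ℕ) : ℚ) ∧
      (∀ i < c * I.n, μ' 6 i = μ 6 i) ∧ (∀ j : Fin I.n, μ' 6 (c * I.n + j) = x j) ∧
      (∀ i < (d + c) * (d + 1), μ' 8 i = μ 8 i) ∧
      ∀ i : Fin (d + 1), μ' 8 ((d + c) * (d + 1) + i) = emb (I.ratF x) (-1) i := by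
  -- the contents of the new row of array `8` after `j` rounds
  set v : ℕ → ℕ → ℚ := fun j i =>
    if h : i < d then ∑ l ∈ Finset.univ.filter fun l : Fin I.n => (l : ℕ) < j,
      I.Q ⟨i, h⟩ l * x l else -1 with hv
  have hvB : ∀ j i, height (v j i) ≤ 2 ^ B := by
    intro j i
    simp only [hv]
    split_ifs with h
    · exact (I.height_partial_sum_le x _ _).trans (Nat.pow_le_pow_right (by norm_num) hx)
    · rw [height_neg]; exact height_one_le hB
  have hbase : ∀ μ' : Mem, μ' 5 0 = (c : ℚ) →
      (Expr.mul (numGens d) (.const (d + 1 : ℕ))).eval μ' = (((d + c) * (d + 1) : ℕ) : ℚ) := by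
    intro μ' h
    rw [Expr.eval, eval_numGens h]; simp [Expr.eval]
  have r1 := Run.storeRow (ask := ask) (askTime := askTime) hB hμ (k := 8)
    (base := .mul (numGens d) (.const (d + 1 : ℕ)))
    (e := fun i => if i < d then .const 0 else .const (-1))
    (b := (d + c) * (d + 1)) (m := d + 1) (v := v 0)
    (fun j _ => hbase _ (by rw [writeRow_array_ne (by norm_num), hc]))
    (fun j _ => by
      by_cases h : j < d <;> simp [hv, h, Expr.eval]) (fun j _ => hvB 0 j)
  set μ1 := writeRow μ 8 ((d + c) * (d + 1)) (d + 1) (v 0) with hμ1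
  have hb1 : Bdd B μ1 := hμ.writeRow fun j _ => hvB 0 j
  have key := Run.forLoop (ask := ask) (askTime := askTime) (c := 15) (lim := numVars)
    (body := .seq (.store 6 (.add (.mul (cell 5 0) numVars) (cell 15 0))
            (.load src (.add (cell 15 0) (.const off))))
          (InnerApx.storeRow 8 (.mul (numGens d) (.const (d + 1 : ℕ)))
            (fun i => .add (entry 8 (numGens d) (.const (d + 1 : ℕ)) (.const i))
              (.mul (entry 1 (.const i) numVars (cell 15 0))
                (.load src (.add (cell 15 0) (.const off))))) d))
    (N := 1) (m := I.n) (μ := μ1) hB le_rfl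
    (fun j μ' => j ≤ I.n ∧ Bdd B μ' ∧ (∀ k, k ≠ 6 → k ≠ 8 → k ≠ 15 → μ' k = μ k) ∧
      (∀ i < c * I.n, μ' 6 i = μ 6 i) ∧
      (∀ l : Fin I.n, (l : ℕ) < j → μ' 6 (c * I.n + l) = x l) ∧
      (∀ i < (d + c) * (d + 1), μ' 8 i = μ 8 i) ∧
      ∀ i < d + 1, μ' 8 ((d + c) * (d + 1) + i) = v j i)
    (fun j μ' h => h.2.1) (fun j μ' h => eval_numVars
      (by rw [h.2.2.1 0 (by norm_num) (by norm_num) (by norm_num), h0])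
      (by rw [h.2.2.1 0 (by norm_num) (by norm_num) (by norm_num), h1])) ?_ hb1 ?_
  · obtain ⟨μ2, r2, -, hb2, hag, h6, h6', h8, h8'⟩ := key
    have r3 := Run.store (ask := ask) (askTime := askTime) hB hb2 5 (.const 0)
      (.add (cell 5 0) (.const 1)) (j := 0) (q := ((c + 1 : ℕ) : ℚ)) (by simp [Expr.eval])
      (by simp [Expr.eval, eval_cell, hag 5, hc])
    refine ⟨_, .seq hB (by omega) (r1.mono (by omega))
      (.seq hB (by omega) (r2.mono (by omega)) (r3.mono (by omega))),
      hb2.set (height_natCast_le hcB), ?_, ?_, ?_, ?_, ?_, ?_⟩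
    · intro k k5 k6 k8 k15
      rw [Mem.set_array_ne _ _ _ k5, hag k k6 k8 k15]
    · rw [Mem.set_same]
    · intro i hi
      rw [Mem.set_array_ne _ _ _ (by norm_num), h6 i hi]
    · intro j
      rw [Mem.set_array_ne _ _ _ (by norm_num), h6' j j.2]
    · intro i hi
      rw [Mem.set_array_ne _ _ _ (by norm_num), h8 i hi]
    · intro i
      rw [Mem.set_array_ne _ _ _ (by norm_num), h8' i i.2]
      refine Fin.lastCases ?_ (fun i => ?_) i
      · simp [hv]
      · simp [hv, MOMILP.ratF]
  · rintro j hj μ' ⟨-, hb, hag, h6, h6', h8, h8'⟩ hcj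
    have hnv : ∀ μ'' : Mem, (∀ k, k ≠ 6 → k ≠ 8 → k ≠ 15 → μ'' k = μ k) →
        numVars.eval μ'' = (I.n : ℚ) := fun μ'' h => eval_numVars
      (by rw [h 0 (by norm_num) (by norm_num) (by norm_num), h0])
      (by rw [h 0 (by norm_num) (by norm_num) (by norm_num), h1])
    have hxj : ∀ μ'' : Mem, (∀ k, k ≠ 6 → k ≠ 8 → k ≠ 15 → μ'' k = μ k) → μ'' 15 0 = (j : ℚ) →
        (Expr.load src (.add (cell 15 0) (.const off))).eval μ'' = x ⟨j, hj⟩ := by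
      intro μ'' h h15
      rw [eval_load (m := j + off) (by simp [Expr.eval, eval_cell, h15]),
        h src hne.1 hne.2.1 hne.2.2, ← hsrc ⟨j, hj⟩]
    have hxB : height (x ⟨j, hj⟩) ≤ 2 ^ B := by
      rw [← hsrc]; exact hμ _ _
    have q1 := Run.store (ask := ask) (askTime := askTime) hB hb 6
      (.add (.mul (cell 5 0) numVars) (cell 15 0)) (.load src (.add (cell 15 0) (.const off)))
      (j := c * I.n + j) (q := x ⟨j, hj⟩)
      (by simp [Expr.eval, eval_cell, hag 5, hc, hcj, hnv μ' hag]) (hxj μ' hag hcj)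
    set μ2 := μ'.set 6 (c * I.n + j) (x ⟨j, hj⟩) with hμ2
    have hb2 : Bdd B μ2 := hb.set hxB
    have hag2 : ∀ k, k ≠ 6 → k ≠ 8 → k ≠ 15 → μ2 k = μ k := fun k k6 k8 k15 => by
      rw [hμ2, Mem.set_array_ne _ _ _ k6, hag k k6 k8 k15]
    have hc2 : μ2 15 0 = (j : ℚ) := by rw [hμ2, Mem.set_array_ne _ _ _ (by norm_num), hcj]
    have hagw : ∀ m, ∀ k, k ≠ 6 → k ≠ 8 → k ≠ 15 →
        writeRow μ2 8 ((d + c) * (d + 1)) m (v (j + 1)) k = μ k := fun m k k6 k8 k15 => by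
      rw [writeRow_array_ne k8, hag2 k k6 k8 k15]
    have hcw : ∀ m, writeRow μ2 8 ((d + c) * (d + 1)) m (v (j + 1)) 15 0 = (j : ℚ) := fun m => by
      rw [writeRow_array_ne (by norm_num), hc2]
    have hw5 : ∀ m, writeRow μ2 8 ((d + c) * (d + 1)) m (v (j + 1)) 5 0 = (c : ℚ) := fun m => by
      rw [hagw m 5 (by norm_num) (by norm_num) (by norm_num), hc]
    have q2 := Run.storeRow (ask := ask) (askTime := askTime) hB hb2 (k := 8)
      (base := .mul (numGens d) (.const (d + 1 : ℕ)))
      (e := fun i => .add (entry 8 (numGens d) (.const (d + 1 : ℕ)) (.const i))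
              (.mul (entry 1 (.const i) numVars (cell 15 0))
                (.load src (.add (cell 15 0) (.const off)))))
      (b := (d + c) * (d + 1)) (m := d) (v := v (j + 1))
      (fun m _ => hbase _ (hw5 m))
      (fun m hm => by
        rw [eval_add, eval_mul, hxj _ (hagw m) (hcw m),
          eval_entry (eval_numGens (hw5 m)) (w := d + 1) (by simp [Expr.eval]) (l := m)
            (by simp [Expr.eval]),
          eval_entry (a := m) (by simp [Expr.eval]) (hnv _ (hagw m)) (l := j)
            (by rw [eval_cell, hcw]),
          hagw m 1 (by norm_num) (by norm_num) (by norm_num), hQ ⟨m, hm⟩ ⟨j, hj⟩,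
          writeRow_out (by omega), hμ2, Mem.set_array_ne _ _ _ (by norm_num), h8' m (by omega)]
        simp only [hv, dif_pos hm]
        have e : (Finset.univ.filter fun l : Fin I.n => (l : ℕ) < j + 1)
            = insert ⟨j, hj⟩ (Finset.univ.filter fun l : Fin I.n => (l : ℕ) < j) := by
          ext l
          simp only [Finset.mem_filter, Finset.mem_univ, true_and, Finset.mem_insert, Fin.ext_iff]
          omega
        rw [e, Finset.sum_insert (by simp)]
        ring) (fun m _ => hvB _ m)
    have hb3 : Bdd B (writeRow μ2 8 ((d + c) * (d + 1)) d (v (j + 1))) :=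
      hb2.writeRow fun m _ => hvB _ m
    refine ⟨_, .seq hB le_rfl q1 q2, hb3, hcw d, hj,
      hb3.set (height_natCast_le (by omega)), ?_, ?_, ?_, ?_, ?_⟩
    · intro k k6 k8 k15
      rw [Mem.set_array_ne _ _ _ k15, hagw d k k6 k8 k15]
    · intro i hi
      rw [Mem.set_array_ne _ _ _ (by norm_num), writeRow_array_ne (by norm_num), hμ2,
        Mem.set_cell_ne _ _ _ (by omega), h6 i hi]
    · intro l hl
      rw [Mem.set_array_ne _ _ _ (by norm_num), writeRow_array_ne (by norm_num), hμ2]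
      by_cases hlj : (l : ℕ) = j
      · subst hlj; rw [Mem.set_same]
      · rw [Mem.set_cell_ne _ _ _ (by omega), h6' l (by omega)]
    · intro i hi
      rw [Mem.set_array_ne _ _ _ (by norm_num), writeRow_out (by omega), hμ2,
        Mem.set_array_ne _ _ _ (by norm_num), h8 i hi]
    · intro i hi
      rw [Mem.set_array_ne _ _ _ (by norm_num)]
      rcases Nat.lt_succ_iff_lt_or_eq.mp hi with h | rfl
      · rw [writeRow_in h]
      · rw [writeRow_out (by omega), hμ2, Mem.set_array_ne _ _ _ (by norm_num), h8' i (by omega)]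
        simp [hv]
  · refine ⟨Nat.zero_le _, hb1.set (height_zero_le B), ?_, ?_, ?_, ?_, ?_⟩
    · intro k k6 k8 k15
      rw [Mem.set_array_ne _ _ _ k15, hμ1, writeRow_array_ne k8]
    · intro i hi
      rw [Mem.set_array_ne _ _ _ (by norm_num), hμ1, writeRow_array_ne (by norm_num)]
    · intro l hl
      omega
    · intro i hi
      rw [Mem.set_array_ne _ _ _ (by norm_num), hμ1, writeRow_out (by omega)]
    · intro i hi
      rw [Mem.set_array_ne _ _ _ (by norm_num), hμ1, writeRow_in hi]

end AddPoint

/-! ### Computing and testing a candidate -/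

section Test

/-- Entry `i` of the generalized cross product of the generators selected by the odometer. -/
def crossExpr (d i : ℕ) : Expr :=
  detExpr (d + 1) (Fin.cons (α := fun _ => Fin (d + 1) → Expr)
    (fun l => .const (if (l : ℕ) = i then 1 else 0))
    (fun j l => entry 8 (cell 10 j) (.const (d + 1 : ℕ)) (.const (l : ℕ))))

/-- Entry `i` of the candidate that belongs to the generators selected by the odometer. -/
def candExpr (d i : ℕ) : Expr := .div (crossExpr d i) (sumExpr d fun j => crossExpr d j)

/-- Set the flag if the current generator violates the candidate. -/
def nonnegTest (d : ℕ) : Prog :=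
  .ifLe (.const 0) (sumExpr (d + 1) fun l => .mul (cell 11 l)
      (entry 8 (cell 15 0) (.const (d + 1 : ℕ)) (.const (l : ℕ))))
    .skip (.store 14 (.const 0) (.const 1))

/-- The difference of an entry of the candidate and an entry of the current known halfspace. -/
def diffExpr (d l : ℕ) : Expr :=
  .sub (cell 11 l) (entry 12 (cell 15 0) (.const (d + 1 : ℕ)) (.const l))

/-- Set the flag if the current known halfspace equals the candidate, that is, if their squared
distance vanishes. -/
def equalTest (d : ℕ) : Prog :=
  .ifLe (sumExpr (d + 1) fun l => .mul (diffExpr d l) (diffExpr d l)) (.const 0)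
    (.store 14 (.const 0) (.const 1)) .skip

/-- Compute the candidate, and clear the flag in array `14` if and only if the candidate is
nonnegative on all generators and does not occur among the known halfspaces in array `12`. -/
def testCandidate (d : ℕ) : Prog :=
  .seq (storeRow 11 (.const 0) (candExpr d) (d + 1))
    (.seq (.store 14 (.const 0) (.const 0))
      (.seq (forLoop 15 (numGens d) (nonnegTest d)) (forLoop 15 (cell 13 0) (equalTest d))))

/-- Row `r` of array `k`, for rows of width `d + 1`. -/
def row (d : ℕ) (μ : Mem) (k r : ℕ) : Fin (d + 1) → ℚ := fun l => μ k (r * (d + 1) + l)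

/-- The candidate that belongs to the generators with the indices `τ 0, …, τ (d - 1)`. -/
def candAt (d : ℕ) (μ : Mem) (τ : ℕ → ℕ) : Fin (d + 1) → ℚ :=
  candidate fun j : Fin d => row d μ 8 (τ j)

/-- A bound on the logarithms of the heights of the entries of candidates, for generators of height
at most `2 ^ b`. -/
def candBound (d b : ℕ) : ℕ := (d + 1) * ((d + 1).factorial * ((d + 1) * b))

variable {d : ℕ}

lemma height_crossProd_le {g : Fin d → Fin (d + 1) → ℚ} {b : ℕ} (hb : 1 ≤ b)
    (hg : ∀ j l, height (g j l) ≤ 2 ^ b) (i : Fin (d + 1)) :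
    height (crossProd g i) ≤ 2 ^ ((d + 1).factorial * ((d + 1) * b)) := by
  refine height_det_le (by omega) _ b fun r l => ?_
  refine Fin.cases ?_ (fun j => ?_) r
  · by_cases h : l = i
    · subst h; simpa using height_one_le hb
    · simpa [h] using height_zero_le b
  · simpa using hg j l

lemma height_candidate_le {g : Fin d → Fin (d + 1) → ℚ} {b : ℕ} (hb : 1 ≤ b)
    (hg : ∀ j l, height (g j l) ≤ 2 ^ b) (i : Fin (d + 1)) :
    height (candidate g i) ≤ 2 ^ candBound d b := by
  have h1 := height_crossProd_le hb hg i
  have h2 := height_sum_le_two_pow Finset.univ (fun j : Fin d => crossProd g j.castSucc) _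
    fun j _ => height_crossProd_le hb hg j.castSucc
  refine (height_div_le_mul _ _).trans ((Nat.mul_le_mul h1 h2).trans_eq ?_)
  rw [← pow_add, candBound]
  congr 1
  simp; ring

lemma eval_crossExpr {μ : Mem} {D : ℕ → ℕ} (hD : ∀ j < d, μ 10 j = (D j : ℚ))
    (i : Fin (d + 1)) :
    (crossExpr d i).eval μ = crossProd (fun j : Fin d => row d μ 8 (D j)) i := by
  rw [crossExpr, eval_detExpr, crossProd]
  congr 1
  ext r l
  refine Fin.cases ?_ (fun j => ?_) r
  · simp [Expr.eval, Pi.single_apply, Fin.ext_iff]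
  · simp only [Matrix.of_apply, Fin.cons_succ]
    rw [eval_entry (a := D j) (by rw [eval_cell, hD j j.2]) (w := d + 1) (by simp [Expr.eval])
      (l := l) (by simp [Expr.eval])]
    rfl

lemma eval_candExpr {μ : Mem} {D : ℕ → ℕ} (hD : ∀ j < d, μ 10 j = (D j : ℚ))
    (i : Fin (d + 1)) : (candExpr d i).eval μ = candAt d μ D i := by
  rw [candExpr, Expr.eval, eval_crossExpr hD, eval_sumExpr, candAt, candidate]
  congr 1
  exact Finset.sum_congr rfl fun j _ => eval_crossExpr hD j.castSucc

lemma row_congr {μ μ' : Mem} {k : ℕ} (h : μ' k = μ k) (r : ℕ) : row d μ' k r = row d μ k r := by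
  funext l; simp [row, h]

lemma candAt_congr {μ μ' : Mem} (h : μ' 8 = μ 8) (τ : ℕ → ℕ) :
    candAt d μ' τ = candAt d μ τ := by
  simp only [candAt, row_congr h]

variable {n : ℕ} {ask : Halfspace d → Option (Fin n → ℚ)} {askTime : Halfspace d → ℕ} {B : ℕ}

lemma Run.testCandidate (hB : 1 ≤ B) {μ : Mem} (hμ : Bdd B μ) {c fc b : ℕ}
    (hc : μ 5 0 = (c : ℚ)) (hcB : d + c ≤ B) (hfc : μ 13 0 = (fc : ℚ)) (hfcB : fc ≤ B)
    (hb : 1 ≤ b) (hbB : candBound d b ≤ B) {D : ℕ → ℕ} (hD : ∀ j < d, μ 10 j = (D j : ℚ))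
    (hrow : ∀ j < d, ∀ l, height (row d μ 8 (D j) l) ≤ 2 ^ b) :
    ∃ μ' : Mem, Run ask askTime B (testCandidate d) (B + 1) μ [] μ' ∧ Bdd B μ' ∧
      (∀ k, k ≠ 11 → k ≠ 14 → k ≠ 15 → μ' k = μ k) ∧
      (∀ i : Fin (d + 1), μ' 11 i = candAt d μ D i) ∧
      (μ' 14 0 ≤ 0 ↔ (∀ r < d + c, 0 ≤ candAt d μ D ⬝ᵥ row d μ 8 r) ∧
        ∀ r < fc, candAt d μ D ≠ row d μ 12 r) := by
  set u := candAt d μ D with hu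
  set v : ℕ → ℚ := fun i => if h : i < d + 1 then u ⟨i, h⟩ else 0 with hv
  have hvu : ∀ i : Fin (d + 1), v i = u i := fun i => by simp only [hv, dif_pos i.2]
  have hvB : ∀ i < d + 1, height (v i) ≤ 2 ^ B := fun i hi => by
    simp only [hv, dif_pos hi]
    exact (height_candidate_le hb (fun j l => hrow j j.2 l) _).trans
      (Nat.pow_le_pow_right (by norm_num) hbB)
  have r1 := Run.storeRow (ask := ask) (askTime := askTime) hB hμ (k := 11) (base := .const 0)
    (e := candExpr d) (b := 0) (m := d + 1) (v := v) (fun j _ => by simp [Expr.eval])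
    (fun j hj => by
      have h8 : writeRow μ 11 0 j v 8 = μ 8 := writeRow_array_ne (by norm_num)
      rw [hvu ⟨j, hj⟩, hu, ← candAt_congr h8]
      exact eval_candExpr (fun j hj => by rw [writeRow_array_ne (by norm_num), hD j hj])
        ⟨j, hj⟩) hvB
  set μ1 := writeRow μ 11 0 (d + 1) v with hμ1
  have hb1 : Bdd B μ1 := hμ.writeRow hvB
  have r2 := Run.store (ask := ask) (askTime := askTime) hB hb1 14 (.const 0) (.const 0)
    (j := 0) (q := 0) (by simp [Expr.eval]) (by simp [Expr.eval])
  set μ2 := μ1.set 14 0 0 with hμ2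
  have hb2 : Bdd B μ2 := hb1.set (height_zero_le B)
  have hag2 : ∀ k, k ≠ 11 → k ≠ 14 → μ2 k = μ k := fun k k11 k14 => by
    rw [hμ2, Mem.set_array_ne _ _ _ k14, hμ1, writeRow_array_ne k11]
  have hu2 : ∀ i : Fin (d + 1), μ2 11 i = u i := fun i => by
    have := writeRow_in (μ := μ) (k := 11) (b := 0) (m := d + 1) (v := v) i.2
    rw [zero_add, hvu] at this
    rw [hμ2, Mem.set_array_ne _ _ _ (by norm_num), hμ1, this]
  have hset : ∀ μ' : Mem, Bdd B μ' →
      Run ask askTime B (.store 14 (.const 0) (.const 1)) 1 μ' [] (μ'.set 14 0 1) :=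
    fun μ' h => Run.store hB h 14 (.const 0) (.const 1) (by simp [Expr.eval]) (by simp [Expr.eval])
  have hent : ∀ (k r : ℕ), k ≠ 11 → k ≠ 14 → k ≠ 15 → ∀ μ' : Mem,
      (∀ k, k ≠ 14 → k ≠ 15 → μ' k = μ2 k) → μ' 15 0 = (r : ℚ) → ∀ l : Fin (d + 1),
      (entry k (cell 15 0) (.const (d + 1 : ℕ)) (.const (l : ℕ))).eval μ' = row d μ k r l := by
    intro k r k11 k14 k15 μ' h h15 l
    rw [eval_entry (a := r) (by rw [eval_cell, h15]) (w := d + 1) (by simp [Expr.eval])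
      (l := l) (by simp [Expr.eval]), h k k14 k15, hag2 k k11 k14]
    rfl
  have hcell : ∀ μ' : Mem, (∀ k, k ≠ 14 → k ≠ 15 → μ' k = μ2 k) → ∀ l : Fin (d + 1),
      (cell 11 l).eval μ' = u l := fun μ' h l => by
    rw [eval_cell, h 11 (by norm_num) (by norm_num), hu2]
  obtain ⟨μ3, r3, hb3, hag3, hfl3, hnn3⟩ := Run.searchLoop (ask := ask) (askTime := askTime) hB
    (lim := numGens d) (body := nonnegTest d) hcB hb2 (fun r => u ⬝ᵥ row d μ 8 r < 0)
    (fun μ' h => eval_numGens (by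
      rw [h 5 (by norm_num) (by norm_num), hag2 5 (by norm_num) (by norm_num), hc]))
    (fun r _ μ' h h15 hb' => by
      have he : (sumExpr (d + 1) fun l => .mul (cell 11 l)
          (entry 8 (cell 15 0) (.const (d + 1 : ℕ)) (.const (l : ℕ)))).eval μ'
          = u ⬝ᵥ row d μ 8 r := by
        rw [eval_sumExpr]
        refine Finset.sum_congr rfl fun l _ => ?_
        rw [Expr.eval, hcell μ' h, hent 8 r (by norm_num) (by norm_num) (by norm_num) μ' h h15]
      constructor
      · intro hV
        exact .ifFalse hB le_rfl hb' (by rw [he, Expr.eval]; exact not_le.mpr hV) (hset μ' hb')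
      · intro hV
        exact .ifTrue hB le_rfl hb' (by rw [he, Expr.eval]; exact not_lt.mp hV) (.skip hB _))
  obtain ⟨μ4, r4, hb4, hag4, hfl4, hnn4⟩ := Run.searchLoop (ask := ask) (askTime := askTime) hB
    (lim := cell 13 0) (body := equalTest d) hfcB hb3 (fun r => u = row d μ 12 r)
    (fun μ' h => by
      rw [eval_cell, h 13 (by norm_num) (by norm_num), hag3 13 (by norm_num) (by norm_num),
        hag2 13 (by norm_num) (by norm_num), hfc])
    (fun r _ μ' h h15 hb' => by
      have h' : ∀ k, k ≠ 14 → k ≠ 15 → μ' k = μ2 k := fun k k14 k15 => by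
        rw [h k k14 k15, hag3 k k14 k15]
      have he : (sumExpr (d + 1) fun l => .mul (diffExpr d l) (diffExpr d l)).eval μ'
          = (u - row d μ 12 r) ⬝ᵥ (u - row d μ 12 r) := by
        rw [eval_sumExpr]
        refine Finset.sum_congr rfl fun l _ => ?_
        rw [Expr.eval, diffExpr, Expr.eval, hcell μ' h',
          hent 12 r (by norm_num) (by norm_num) (by norm_num) μ' h' h15]
        rfl
      have hz : (u - row d μ 12 r) ⬝ᵥ (u - row d μ 12 r) ≤ 0 ↔ u = row d μ 12 r := by
        rw [← sub_eq_zero, ← dotProduct_self_eq_zero (v := u - row d μ 12 r)]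
        exact ⟨fun h => le_antisymm h (Finset.sum_nonneg fun i _ => mul_self_nonneg _),
          fun h => h.le⟩
      constructor
      · intro hV
        exact .ifTrue hB le_rfl hb' (by rw [he, Expr.eval]; exact hz.mpr hV) (hset μ' hb')
      · intro hV
        exact .ifFalse hB le_rfl hb' (by rw [he, Expr.eval]; exact fun h => hV (hz.mp h))
          (.skip hB _))
  have h14 : μ2 14 0 = 0 := by rw [hμ2, Mem.set_same]
  refine ⟨μ4, .seq hB (by omega) (r1.mono (by omega)) (.seq hB (by omega) (r2.mono (by omega))
    (.seq hB (by omega) (r3.mono (by omega)) (r4.mono (by omega)))), hb4, ?_, ?_, ?_⟩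
  · intro k k11 k14 k15
    rw [hag4 k k14 k15, hag3 k k14 k15, hag2 k k11 k14]
  · intro i
    rw [hag4 11 (by norm_num) (by norm_num), hag3 11 (by norm_num) (by norm_num), hu2]
  · have hnn : 0 ≤ μ4 14 0 := hnn4 (hnn3 h14.ge)
    rw [show μ4 14 0 ≤ 0 ↔ μ4 14 0 = 0 from ⟨fun h => le_antisymm h hnn, fun h => h.le⟩,
      hfl4, hfl3]
    simp only [h14, true_and, not_lt, ne_eq]

end Test

/-! ### The program -/

section Program

/-- Append the candidate to the list of known halfspaces in array `12`, whose length is in array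
`13`. -/
def appendKnown (d : ℕ) : Prog :=
  .seq (storeRow 12 (.mul (cell 13 0) (.const (d + 1 : ℕ))) (fun l => cell 11 l) (d + 1))
    (.store 13 (.const 0) (.add (cell 13 0) (.const 1)))

/-- Call the oracle on the candidate, record the answer, and reset the odometer. -/
def queryStep (d : ℕ) : Prog :=
  .seq (.query 11 16)
    (.seq (.ifLe (.const 1) (cell 16 0) (addPoint d 16 1) (appendKnown d))
      (storeRow 10 (.const 0) (fun _ => .const 0) (d + 1)))

/-- One round of the main loop: test the candidate that belongs to the current tuple of generators,
and query the oracle or pass to the next tuple. -/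
def mainBody (d : ℕ) : Prog :=
  .seq (testCandidate d) (.ifLe (cell 14 0) (.const 0) (queryStep d) (increment d))

/-- Store the homogenized unit directions in array `8`. -/
def initDirections (d : ℕ) : Prog :=
  storeRow 8 (.const 0) (fun c => .const (if c / (d + 1) = c % (d + 1) then 1 else 0))
    (d * (d + 1))

/-- The inner approximation algorithm. Array `5` holds the number of solutions, array `6` the
solutions, array `8` the generators, array `10` the odometer that runs through all `d`-tuples of
generators, array `11` the candidate, array `12` the known halfspaces (preceded by a zero row, so
that the zero vector is never taken for a new candidate), array `13` their number, array `14` a flag,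
array `15` a loop counter, and array `16` the answer of the oracle. -/
def innerApxProg (d : ℕ) : Prog :=
  .seq (initDirections d)
    (.seq (addPoint d 4 0)
      (.seq (.store 13 (.const 0) (.const 1))
        (.whileLt (cell 10 d) (.const 1) (mainBody d))))

end Program

/-! ### The data structure -/

section Data

variable {d : ℕ} {I : MOMILP d}

/-- The `i`-th solution stored in memory. -/
def pt (I : MOMILP d) (μ : Mem) (i : ℕ) : Fin I.n → ℚ := fun j => μ 6 (i * I.n + j)

variable (I) in
/-- The memory represents the set `R`, listed as `c` solutions together with their generators. -/
structure HoldsPoints (μ : Mem) (c : ℕ) (R : Finset (Fin I.n → ℚ)) : Prop where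
  nR : μ 0 0 = I.nR
  nZ : μ 0 1 = I.nZ
  obj : ∀ (i : Fin d) (j : Fin I.n), μ 1 (i * I.n + j) = I.Q i j
  count : μ 5 0 = (c : ℚ)
  card : R.card = c
  points : R = (Finset.range c).image (pt I μ)
  dirs : ∀ i : Fin d, row d μ 8 i = emb (Pi.single i 1) 0
  images : ∀ i < c, row d μ 8 (d + i) = emb (I.ratF (pt I μ i)) (-1)

/-- The memory represents the set `F` of known halfspaces, as `fc` rows the first of which is the
zero vector. -/
structure HoldsKnown (d : ℕ) (μ : Mem) (fc : ℕ) (F : Set (Set (Fin d → ℝ))) : Prop where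
  count : μ 13 0 = (fc : ℚ)
  pos : 1 ≤ fc
  zero : row d μ 12 0 = 0
  normalized : ∀ r, 1 ≤ r → r < fc → ∑ i : Fin d, row d μ 12 r i.castSucc = 1
  eq : F = {S | ∃ r, 1 ≤ r ∧ r < fc ∧ S = hs (toReal (row d μ 12 r))}

lemma HoldsPoints.congr {μ μ' : Mem} {c : ℕ} {R : Finset (Fin I.n → ℚ)}
    (h : HoldsPoints I μ c R) (h0 : μ' 0 = μ 0) (h1 : μ' 1 = μ 1) (h5 : μ' 5 = μ 5)
    (h6 : μ' 6 = μ 6) (h8 : μ' 8 = μ 8) : HoldsPoints I μ' c R := by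
  have hp : pt I μ' = pt I μ := by funext i j; simp only [pt, h6]
  exact ⟨by rw [h0, h.nR], by rw [h0, h.nZ], by rw [h1]; exact h.obj, by rw [h5, h.count], h.card,
    by rw [hp]; exact h.points, fun i => by rw [row_congr h8, h.dirs],
    fun i hi => by rw [row_congr h8, hp, h.images i hi]⟩

lemma HoldsKnown.congr {μ μ' : Mem} {fc : ℕ} {F : Set (Set (Fin d → ℝ))}
    (h : HoldsKnown d μ fc F) (h12 : μ' 12 = μ 12) (h13 : μ' 13 = μ 13) :
    HoldsKnown d μ' fc F := by
  refine ⟨by rw [h13, h.count], h.pos, by rw [row_congr h12, h.zero], ?_, ?_⟩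
  · simp only [row_congr h12]; exact h.normalized
  · simp only [row_congr h12]; exact h.eq

lemma toReal_emb (z : Fin d → ℚ) (t : ℚ) :
    toReal (emb z t) = emb (fun i => (z i : ℝ)) (t : ℝ) := by
  funext i
  refine Fin.lastCases ?_ (fun j => ?_) i <;> simp [toReal]

lemma toReal_dir (i : Fin d) :
    toReal (emb (Pi.single i (1 : ℚ)) 0) = emb (Pi.single i (1 : ℝ)) 0 := by
  rw [toReal_emb]
  congr 1
  · funext j
    by_cases h : j = i
    · subst h; simp
    · simp [h]
  · simp

lemma toReal_image (x : Fin I.n → ℚ) :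
    toReal (emb (I.ratF x) (-1)) = emb (I.f (toReal x)) (-1) := by
  rw [toReal_emb]
  congr 1
  · funext i; rw [I.f_toReal]
  · simp

lemma toReal_dotProduct {m : ℕ} (u v : Fin m → ℚ) :
    toReal u ⬝ᵥ toReal v = ((u ⬝ᵥ v : ℚ) : ℝ) := by
  simp [dotProduct, toReal]

lemma toReal_candidate (g : Fin d → Fin (d + 1) → ℚ) :
    toReal (candidate g) = candidate fun j => toReal (g j) := by
  funext i
  exact candidate_cast g i

lemma toReal_injective {m : ℕ} : Function.Injective (toReal (n := m)) := by
  intro u v h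
  funext i
  exact Rat.cast_injective (congrFun h i)

/-- The rows of array `8` are the generators. -/
lemma HoldsPoints.mem_gens_iff {μ : Mem} {c : ℕ} {R : Finset (Fin I.n → ℚ)}
    (h : HoldsPoints I μ c R) (v : Fin (d + 1) → ℝ) :
    v ∈ gens (InnerApx.images I R) ↔ ∃ r < d + c, v = toReal (row d μ 8 r) := by
  constructor
  · rintro (⟨i, rfl⟩ | ⟨y, ⟨x, hx, rfl⟩, rfl⟩)
    · exact ⟨i, by omega, by rw [h.dirs, toReal_dir]⟩
    · rw [h.points] at hx
      obtain ⟨i, hi, rfl⟩ := Finset.mem_image.mp (Finset.mem_coe.mp hx)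
      rw [Finset.mem_range] at hi
      exact ⟨d + i, by omega, by rw [h.images i hi, toReal_image]⟩
  · rintro ⟨r, hr, rfl⟩
    by_cases hrd : r < d
    · rw [h.dirs ⟨r, hrd⟩, toReal_dir]
      exact dir_mem_gens _ _
    · obtain ⟨i, rfl⟩ := Nat.exists_eq_add_of_le (not_lt.mp hrd)
      have hi : i < c := by omega
      rw [h.images i hi, toReal_image]
      refine point_mem_gens ⟨_, ?_, rfl⟩
      rw [h.points]
      exact Finset.mem_coe.mpr (Finset.mem_image_of_mem _ (Finset.mem_range.mpr hi))

lemma HoldsPoints.height_row_le {s : Polynomial ℕ} {μ : Mem} {c : ℕ}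
    {R : Finset (Fin I.n → ℚ)} (h : HoldsPoints I μ c R) (hR : ∀ x ∈ R, IsShort I s x) {r : ℕ}
    (hr : r < d + c) (l : Fin (d + 1)) :
    height (row d μ 8 r l) ≤ 2 ^ (imageBound I s + 1) := by
  by_cases hrd : r < d
  · rw [h.dirs ⟨r, hrd⟩]
    refine Fin.lastCases ?_ (fun j => ?_) l
    · rw [emb_last]; exact height_zero_le _
    · rw [emb_castSucc]
      by_cases hj : j = ⟨r, hrd⟩
      · subst hj; simpa using height_one_le (by omega)
      · simpa [hj] using height_zero_le _
  · obtain ⟨i, rfl⟩ := Nat.exists_eq_add_of_le (not_lt.mp hrd)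
    have hi : i < c := by omega
    rw [h.images i hi]
    have hx : pt I μ i ∈ R := by
      rw [h.points]; exact Finset.mem_image_of_mem _ (Finset.mem_range.mpr hi)
    refine Fin.lastCases ?_ (fun j => ?_) l
    · rw [emb_last, height_neg]; exact height_one_le (by omega)
    · rw [emb_castSucc]
      exact (height_ratF_le (hR _ hx).2 j).trans (Nat.pow_le_pow_right (by norm_num) (by omega))

lemma HoldsPoints.insert {μ μ' : Mem} {c : ℕ} {R : Finset (Fin I.n → ℚ)}
    (h : HoldsPoints I μ c R) {x : Fin I.n → ℚ} (hx : x ∉ R) (h0 : μ' 0 = μ 0) (h1 : μ' 1 = μ 1)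
    (h5 : μ' 5 0 = ((c + 1 : ℕ) : ℚ)) (h6 : ∀ i < c * I.n, μ' 6 i = μ 6 i)
    (h6' : ∀ j : Fin I.n, μ' 6 (c * I.n + j) = x j)
    (h8 : ∀ i < (d + c) * (d + 1), μ' 8 i = μ 8 i)
    (h8' : ∀ i : Fin (d + 1), μ' 8 ((d + c) * (d + 1) + i) = emb (I.ratF x) (-1) i) :
    HoldsPoints I μ' (c + 1) (insert x R) := by
  have hlt : ∀ {a b w l : ℕ}, a < b → l < w → a * w + l < b * w := by
    intro a b w l hab hl
    calc a * w + l < (a + 1) * w := by rw [add_mul, one_mul]; omega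
      _ ≤ b * w := Nat.mul_le_mul_right _ hab
  have hp : ∀ i < c, pt I μ' i = pt I μ i := fun i hi => by
    funext j; exact h6 _ (hlt hi j.2)
  have hpc : pt I μ' c = x := by funext j; exact h6' j
  have hr : ∀ r < d + c, row d μ' 8 r = row d μ 8 r := fun r hr => by
    funext l; exact h8 _ (hlt hr l.2)
  refine ⟨by rw [h0, h.nR], by rw [h0, h.nZ], by rw [h1]; exact h.obj, h5,
    by rw [Finset.card_insert_of_notMem hx, h.card], ?_, fun i => by rw [hr _ (by omega), h.dirs],
    fun i hi => ?_⟩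
  · rw [Finset.range_add_one, Finset.image_insert, hpc]
    conv_lhs => rw [h.points]
    congr 1
    exact Finset.image_congr fun i hi => (hp i (Finset.mem_range.mp (Finset.mem_coe.mp hi))).symm
  · rcases Nat.lt_succ_iff_lt_or_eq.mp hi with hi | rfl
    · rw [hr _ (by omega), hp i hi, h.images i hi]
    · rw [hpc]; funext l; exact h8' l

variable {n : ℕ} {ask : Halfspace d → Option (Fin n → ℚ)} {askTime : Halfspace d → ℕ} {B : ℕ}

lemma Run.appendKnown (hB : 1 ≤ B) {μ : Mem} (hμ : Bdd B μ) {fc : ℕ}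
    {F : Set (Set (Fin d → ℝ))} (h : HoldsKnown d μ fc F) (hfcB : fc + 1 ≤ B)
    {u : Fin (d + 1) → ℚ} (hu : ∀ i : Fin (d + 1), μ 11 i = u i)
    (hsum : ∑ i : Fin d, u i.castSucc = 1) :
    ∃ μ' : Mem, Run ask askTime B (appendKnown d) 1 μ [] μ' ∧ Bdd B μ' ∧
      (∀ k, k ≠ 12 → k ≠ 13 → μ' k = μ k) ∧
      HoldsKnown d μ' (fc + 1) (F ∪ {hs (toReal u)}) := by
  set v : ℕ → ℚ := fun l => μ 11 l with hv
  have hw : ∀ m k, k ≠ 12 → writeRow μ 12 (fc * (d + 1)) m v k = μ k := fun m k hk =>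
    writeRow_array_ne hk
  have r1 := Run.storeRow (ask := ask) (askTime := askTime) hB hμ (k := 12)
    (base := .mul (cell 13 0) (.const (d + 1 : ℕ))) (e := fun l => cell 11 l)
    (b := fc * (d + 1)) (m := d + 1) (v := v)
    (fun j _ => by simp [Expr.eval, eval_cell, hw, h.count])
    (fun j _ => by rw [eval_cell, hw _ _ (by norm_num)]) (fun j _ => hμ _ _)
  set μ1 := writeRow μ 12 (fc * (d + 1)) (d + 1) v with hμ1
  have hb1 : Bdd B μ1 := hμ.writeRow fun j _ => hμ _ _
  have r2 := Run.store (ask := ask) (askTime := askTime) hB hb1 13 (.const 0)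
    (.add (cell 13 0) (.const 1)) (j := 0) (q := ((fc + 1 : ℕ) : ℚ)) (by simp [Expr.eval])
    (by simp [Expr.eval, eval_cell, hμ1, hw, h.count])
  have hrow : ∀ r < fc, row d (μ1.set 13 0 ((fc + 1 : ℕ) : ℚ)) 12 r = row d μ 12 r := by
    intro r hr
    funext l
    have : r * (d + 1) + l < fc * (d + 1) := by
      calc r * (d + 1) + l < (r + 1) * (d + 1) := by rw [add_mul r, one_mul]; omega
        _ ≤ _ := Nat.mul_le_mul_right _ hr
    rw [row, Mem.set_array_ne _ _ _ (by norm_num), hμ1, writeRow_out (by omega)]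
    rfl
  have hnew : row d (μ1.set 13 0 ((fc + 1 : ℕ) : ℚ)) 12 fc = u := by
    funext l
    rw [row, Mem.set_array_ne _ _ _ (by norm_num), hμ1, writeRow_in l.2, hv, ← hu]
  refine ⟨_, .seq hB le_rfl r1 r2, hb1.set (height_natCast_le hfcB), ?_, ?_, ?_, ?_, ?_, ?_⟩
  · intro k k12 k13
    rw [Mem.set_array_ne _ _ _ k13, hμ1, hw _ _ k12]
  · rw [Mem.set_same]
  · omega
  · rw [hrow 0 h.pos, h.zero]
  · intro r h1 hr
    rcases Nat.lt_succ_iff_lt_or_eq.mp hr with hr | rfl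
    · rw [hrow r hr]; exact h.normalized r h1 hr
    · rw [hnew]; exact hsum
  · rw [h.eq]
    ext S
    simp only [Set.mem_union, Set.mem_ofPred_eq, Set.mem_singleton_iff]
    constructor
    · rintro (⟨r, h1, hr, rfl⟩ | rfl)
      · exact ⟨r, h1, by omega, by rw [hrow r hr]⟩
      · exact ⟨fc, h.pos, by omega, by rw [hnew]⟩
    · rintro ⟨r, h1, hr, rfl⟩
      rcases Nat.lt_succ_iff_lt_or_eq.mp hr with hr | rfl
      · exact Or.inl ⟨r, h1, hr, by rw [hrow r hr]⟩
      · exact Or.inr (by rw [hnew])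

end Data

/-! ### The main loop -/

section MainLoop

variable {d : ℕ} {I : MOMILP d} {s : Polynomial ℕ}

/-- Nothing remains to be done for the candidate of the tuple `τ`: it is known, or it is violated by
a generator. -/
def Settled (d : ℕ) (μ : Mem) (c fc : ℕ) (τ : ℕ → ℕ) : Prop :=
  (∃ r < fc, candAt d μ τ = row d μ 12 r) ∨ ∃ r < d + c, candAt d μ τ ⬝ᵥ row d μ 8 r < 0

/-- The invariant of the main loop: the memory represents a state that the algorithm reaches, and
all tuples of generators before the current position of the odometer are settled. -/
structure MainInv (ε : ℝ) (hε : 0 < ε) (hpO : PlaneSepOracle I s) (x₀ : Fin I.n → ℚ) (B : ℕ)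
    (μ : Mem) (ℓ : List (Halfspace d)) (c fc : ℕ) (D : ℕ → ℕ) (R : Finset (Fin I.n → ℚ))
    (F : Set (Set (Fin d → ℝ))) : Prop where
  reaches : Reaches I ε hε hpO.answer x₀ ℓ R F
  bdd : Bdd B μ
  points : HoldsPoints I μ c R
  known : HoldsKnown d μ fc F
  known_le : fc ≤ ℓ.length + 1
  digits : ∀ j ≤ d, μ 10 j = (D j : ℚ)
  digits_lt : ∀ j < d, D j < d + c
  settled : ∀ τ : ℕ → ℕ, (∀ j < d, τ j < d + c) →
    ∑ j ∈ Finset.range d, τ j * (d + c) ^ j < value d (d + c) D → Settled d μ c fc τ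

/-- A bound on the logarithms of the heights of all numbers that occur in memory. -/
noncomputable def memBound (I : MOMILP d) (s : Polynomial ℕ) (ε : ℝ) : ℕ :=
  candBound d (imageBound I s + 1) + d + cardBound d ε (imageBound I s)
    + lengthBound d ε (imageBound I s) + imageBound I s + 2

/-- A measure that decreases in each round of the main loop. -/
noncomputable def mainMeasure (I : MOMILP d) (s : Polynomial ℕ) (ε : ℝ) (c : ℕ) (D : ℕ → ℕ)
    (ℓ : List (Halfspace d)) : ℕ :=
  (lengthBound d ε (imageBound I s) - ℓ.length) * ((d + cardBound d ε (imageBound I s)) ^ d + 1)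
    + ((d + cardBound d ε (imageBound I s)) ^ d - value d (d + c) D)

lemma writeAnswer_array_ne {m : ℕ} {μ : Mem} {k k' : ℕ} {a : Option (Fin m → ℚ)} (h : k ≠ k') :
    writeAnswer μ k' a k = μ k := by
  cases a with
  | none => exact Mem.set_array_ne _ _ _ h
  | some x => simp [writeAnswer, h]

lemma height_le_of_vecSize_le {m B : ℕ} {x : Fin m → ℚ} (h : vecSize x ≤ B) (j : Fin m) :
    height (x j) ≤ 2 ^ B := by
  refine (height_le_two_pow_ratSize _).trans (Nat.pow_le_pow_right (by norm_num) ?_)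
  exact (Finset.single_le_sum (f := fun j => ratSize (x j)) (fun _ _ => Nat.zero_le _)
    (Finset.mem_univ j)).trans h

lemma Bdd.writeAnswer {m B : ℕ} {μ : Mem} (hμ : Bdd B μ) {k : ℕ} {a : Option (Fin m → ℚ)}
    (ha : answerSize a ≤ B) : Bdd B (writeAnswer μ k a) := by
  cases a with
  | none => exact hμ.set (height_zero_le B)
  | some x =>
    simp only [answerSize] at ha
    intro k' i
    by_cases hk : k' = k
    · subst hk
      simp only [InnerApx.writeAnswer, Function.update_self]
      split_ifs with h1 h2
      · exact height_one_le (by omega)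
      · exact height_le_of_vecSize_le (by omega) _
      · exact hμ _ _
    · rw [writeAnswer_array_ne hk]; exact hμ _ _

/-- The round of the main loop in which the candidate is new and nonnegative on all generators: the
candidate belongs to a facet, so that the algorithm may pick it. -/
lemma MainInv.query (hd : 0 < d) (hI : ∀ x ∈ I.feasible, 0 ≤ I.f x) {x₀ : Fin I.n → ℚ}
    (hx₀ : IsShort I s x₀) {ε : ℝ} {hε : 0 < ε} {hpO : PlaneSepOracle I s}
    {μ μ₁ : Mem} {ℓ : List (Halfspace d)} {c fc : ℕ} {D : ℕ → ℕ} {R : Finset (Fin I.n → ℚ)}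
    {F : Set (Set (Fin d → ℝ))}
    (h : MainInv ε hε hpO x₀ (memBound I s ε) μ ℓ c fc D R F) (hb₁ : Bdd (memBound I s ε) μ₁)
    (hag : ∀ k, k ≠ 11 → k ≠ 14 → k ≠ 15 → μ₁ k = μ k)
    (hu : ∀ i : Fin (d + 1), μ₁ 11 i = candAt d μ D i)
    (hnn : ∀ r < d + c, 0 ≤ candAt d μ D ⬝ᵥ row d μ 8 r)
    (hnew : ∀ r < fc, candAt d μ D ≠ row d μ 12 r) :
    ∃ ℓ₁ μ' c' fc' D' R' F',
      Run (fun H => hpO.answer (H.relax ε hε)) (fun H => hpO.time (H.relax ε hε))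
        (memBound I s ε) (queryStep d) (memBound I s ε + 1) μ₁ ℓ₁ μ' ∧
      mainMeasure I s ε c' D' (ℓ ++ ℓ₁) < mainMeasure I s ε c D ℓ ∧
      MainInv ε hε hpO x₀ (memBound I s ε) μ' (ℓ ++ ℓ₁) c' fc' D' R' F' := by
  have hinv := h.reaches.inv hI hx₀ hε hpO
  set B := memBound I s ε with hBdef
  have hB : 1 ≤ B := by rw [hBdef, memBound]; omega
  have hc : c ≤ cardBound d ε (imageBound I s) := by
    rw [← h.points.card]; exact hinv.card_le hI hε
  have hlen := hinv.length_add_one_le hI hε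
  have hY : (images I R).Nonempty := by simpa [images] using hinv.nonempty
  set g : Fin d → Fin (d + 1) → ℝ := fun j => toReal (row d μ 8 (D j)) with hg
  have hcand : candidate g = toReal (candAt d μ D) := (toReal_candidate _).symm
  have hne : candidate g ≠ 0 := by
    rw [hcand]
    intro h0
    refine hnew 0 h.known.pos ?_
    rw [h.known.zero]
    exact toReal_injective (h0.trans (by funext i; simp [toReal]))
  set H := candidateHalfspace g hne with hH
  have hfacet : H.toSet ∈ facetHalfspaces (innerPoly I R) := by
    refine candidate_mem_facetHalfspaces hY (fun j => ?_) hne fun x hx => ?_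
    · exact (h.points.mem_gens_iff _).mpr ⟨D j, h.digits_lt j j.2, rfl⟩
    · obtain ⟨r, hr, rfl⟩ := (h.points.mem_gens_iff _).mp hx
      rw [hcand, toReal_dotProduct]
      exact_mod_cast hnn r hr
  have hsumR : ∑ i : Fin d, candidate g i.castSucc = 1 := sum_candidate hne
  have hsum : ∑ i : Fin d, candAt d μ D i.castSucc = 1 := by
    rw [hcand] at hsumR
    simp only [toReal] at hsumR
    exact_mod_cast hsumR
  have hset : H.toSet = hs (toReal (candAt d μ D)) := by
    rw [hH, candidateHalfspace_toSet, hcand]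
  have hF : H.toSet ∉ F := by
    rw [h.known.eq]
    rintro ⟨r, h1, hr, he⟩
    refine hnew r hr (toReal_injective (eq_of_hs_eq ?_ ?_ (hset.symm.trans he)))
    · rw [← hcand]; exact hsumR
    · have := h.known.normalized r h1 hr
      simp only [toReal]
      exact_mod_cast this
  have hw : 0 ≤ (H.relax ε hε).normal := smul_nonneg (by positivity)
    (normal_nonneg_of_mem_facetHalfspaces hY hfacet)
  have hans : answerSize (hpO.answer (H.relax ε hε)) ≤ B := by
    cases ha : hpO.answer (H.relax ε hε) with
    | none => exact hB
    | some x =>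
      have := (hpO.notInside _ x hw ha).2.2
      simp only [answerSize]
      rw [hBdef, memBound, imageBound]; omega
  have r1 := Run.query (ask := fun H => hpO.answer (H.relax ε hε))
    (askTime := fun H => hpO.time (H.relax ε hε)) hB hb₁ 11 16 H
    (fun i => by
      have := hu i.castSucc
      rw [Fin.val_castSucc] at this
      rw [this, hH]
      exact congrFun hcand i.castSucc)
    (by
      have := hu (Fin.last d)
      rw [Fin.val_last] at this
      rw [this, hH]
      exact congrFun hcand (Fin.last d)) hans
  set μ2 := InnerApx.writeAnswer μ₁ 16 (hpO.answer (H.relax ε hε)) with hμ2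
  have hb2 : Bdd B μ2 := hb₁.writeAnswer hans
  have hag2 : ∀ k, k ≠ 11 → k ≠ 14 → k ≠ 15 → k ≠ 16 → μ2 k = μ k := fun k k11 k14 k15 k16 => by
    rw [hμ2, writeAnswer_array_ne k16, hag k k11 k14 k15]
  have hpts2 : HoldsPoints I μ2 c R := h.points.congr
    (hag2 0 (by norm_num) (by norm_num) (by norm_num) (by norm_num))
    (hag2 1 (by norm_num) (by norm_num) (by norm_num) (by norm_num))
    (hag2 5 (by norm_num) (by norm_num) (by norm_num) (by norm_num))
    (hag2 6 (by norm_num) (by norm_num) (by norm_num) (by norm_num))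
    (hag2 8 (by norm_num) (by norm_num) (by norm_num) (by norm_num))
  have hkn2 : HoldsKnown d μ2 fc F := h.known.congr
    (hag2 12 (by norm_num) (by norm_num) (by norm_num) (by norm_num))
    (hag2 13 (by norm_num) (by norm_num) (by norm_num) (by norm_num))
  -- after the reset of the odometer no tuples precede its position
  have hreset : ∀ (μ3 : Mem) (c' fc' : ℕ) (R' : Finset (Fin I.n → ℚ))
      (F' : Set (Set (Fin d → ℝ))),
      Run (fun H => hpO.answer (H.relax ε hε)) (fun H => hpO.time (H.relax ε hε)) B
        (.ifLe (.const 1) (cell 16 0) (InnerApx.addPoint d 16 1) (InnerApx.appendKnown d))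
        (B + 1) μ2 [] μ3 → Bdd B μ3 → HoldsPoints I μ3 c' R' → HoldsKnown d μ3 fc' F' →
      fc' ≤ fc + 1 → Reaches I ε hε hpO.answer x₀ (ℓ ++ [H]) R' F' →
      ∃ ℓ₁ μ' c' fc' D' R' F',
        Run (fun H => hpO.answer (H.relax ε hε)) (fun H => hpO.time (H.relax ε hε))
          B (queryStep d) (B + 1) μ₁ ℓ₁ μ' ∧
        mainMeasure I s ε c' D' (ℓ ++ ℓ₁) < mainMeasure I s ε c D ℓ ∧
        MainInv ε hε hpO x₀ B μ' (ℓ ++ ℓ₁) c' fc' D' R' F' := by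
    intro μ3 c' fc' R' F' r2 hb3 hp3 hk3 hfc' hreach
    have r3 := Run.storeRow (ask := fun H => hpO.answer (H.relax ε hε))
      (askTime := fun H => hpO.time (H.relax ε hε)) hB hb3 (k := 10) (base := .const 0)
      (e := fun _ => .const 0) (b := 0) (m := d + 1) (v := fun _ => 0)
      (fun j _ => by simp [Expr.eval]) (fun j _ => by simp [Expr.eval])
      (fun j _ => height_zero_le B)
    have hlen' := (hreach.inv hI hx₀ hε hpO).length_add_one_le hI hε
    have hwr : ∀ k, k ≠ 10 → writeRow μ3 10 0 (d + 1) (fun _ => 0) k = μ3 k := fun k hk =>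
      writeRow_array_ne hk
    have hval : ∀ N, value d N (fun _ => 0) = 0 := fun N => by simp [value]
    refine ⟨[H], _, c', fc', fun _ => 0, R', F',
      .seq (ℓ₁ := [H]) (ℓ₂ := []) hB (by omega) (r1.mono (by omega))
        (.seq (ℓ₁ := []) (ℓ₂ := []) hB (by omega) r2 (r3.mono (by omega))), ?_, hreach,
      hb3.writeRow fun j _ => height_zero_le B,
      hp3.congr (hwr 0 (by norm_num)) (hwr 1 (by norm_num)) (hwr 5 (by norm_num))
        (hwr 6 (by norm_num)) (hwr 8 (by norm_num)),
      hk3.congr (hwr 12 (by norm_num)) (hwr 13 (by norm_num)), ?_, ?_, ?_, ?_⟩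
    · unfold mainMeasure
      rw [hval, Nat.sub_zero]
      rw [List.length_append, List.length_singleton] at hlen' ⊢
      obtain ⟨a, ha⟩ := Nat.exists_eq_add_of_le hlen'
      have e1 : lengthBound d ε (imageBound I s) - ℓ.length = a + 1 + 1 := by omega
      have e2 : lengthBound d ε (imageBound I s) - (ℓ.length + 1) = a + 1 := by omega
      rw [e1, e2, add_mul (a + 1), one_mul]
      omega
    · have := h.known_le
      rw [List.length_append, List.length_singleton]; omega
    · intro j hj
      have := writeRow_in (μ := μ3) (k := 10) (b := 0) (m := d + 1) (v := fun _ => 0) (i := j)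
        (by omega)
      rw [zero_add] at this
      simpa using this
    · intro j hj; omega
    · intro τ _ hτ
      rw [hval] at hτ
      omega
  cases ha : hpO.answer (H.relax ε hε) with
  | none =>
    have h16 : (cell 16 0).eval μ2 = 0 := by
      rw [eval_cell, hμ2, ha]; exact Mem.set_same _ _ _ _
    obtain ⟨μ3, r2, hb3, hag3, hk3⟩ := Run.appendKnown
      (ask := fun H => hpO.answer (H.relax ε hε)) (askTime := fun H => hpO.time (H.relax ε hε))
      hB hb2 hkn2 (by
        have := h.known_le
        rw [hBdef, memBound]; omega) (u := candAt d μ D)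
      (fun i => by rw [hμ2, writeAnswer_array_ne (by norm_num), hu]) hsum
    refine hreset μ3 c (fc + 1) R _ (.ifFalse hB (by omega) hb2 ?_ (r2.mono (by omega))) hb3
      (hpts2.congr (hag3 0 (by norm_num) (by norm_num)) (hag3 1 (by norm_num) (by norm_num))
        (hag3 5 (by norm_num) (by norm_num)) (hag3 6 (by norm_num) (by norm_num))
        (hag3 8 (by norm_num) (by norm_num))) hk3 le_rfl ?_
    · rw [h16, Expr.eval]; norm_num
    · rw [← hset]
      exact Reaches.inside H h.reaches ⟨hfacet, hF⟩ ha
  | some x =>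
    have h16 : (cell 16 0).eval μ2 = 1 := by
      rw [eval_cell, hμ2, ha]; simp [writeAnswer]
    have hsrc : ∀ j : Fin I.n, μ2 16 (j + 1) = x j := by
      intro j; rw [hμ2, ha]; simp [writeAnswer]
    have hxs := (hpO.notInside _ x hw ha).2.2
    have hnB := I.n_le_size hd
    obtain ⟨μ3, r2, hb3, hag3, g5, g6, g6', g8, g8'⟩ := Run.addPoint (I := I)
      (ask := fun H => hpO.answer (H.relax ε hε)) (askTime := fun H => hpO.time (H.relax ε hε))
      hB hb2 hpts2.nR hpts2.nZ hpts2.obj (src := 16) (off := 1) hsrc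
      ⟨by norm_num, by norm_num, by norm_num⟩ hpts2.count
      (by rw [hBdef, memBound]; omega) (by rw [hBdef, memBound, imageBound]; omega)
      (by rw [hBdef, memBound, imageBound]; omega)
    have hxR : x ∉ R := fun hxR =>
      box_ne_of_answer hI hε hpO hinv.short hfacet ha hxR rfl
    refine hreset μ3 (c + 1) fc _ F (.ifTrue hB (by omega) hb2 ?_ r2) hb3
      (hpts2.insert hxR (hag3 0 (by norm_num) (by norm_num) (by norm_num) (by norm_num))
        (hag3 1 (by norm_num) (by norm_num) (by norm_num) (by norm_num)) g5 g6 g6' g8 g8')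
      (hkn2.congr (hag3 12 (by norm_num) (by norm_num) (by norm_num) (by norm_num))
        (hag3 13 (by norm_num) (by norm_num) (by norm_num) (by norm_num))) (by omega) ?_
    · rw [h16, Expr.eval]
    · exact Reaches.notInside H x h.reaches ⟨hfacet, hF⟩ ha

/-- Every round of the main loop preserves the invariant and decreases the measure. -/
lemma MainInv.step (hd : 0 < d) (hI : ∀ x ∈ I.feasible, 0 ≤ I.f x) {x₀ : Fin I.n → ℚ}
    (hx₀ : IsShort I s x₀) {ε : ℝ} {hε : 0 < ε} {hpO : PlaneSepOracle I s}
    {μ : Mem} {ℓ : List (Halfspace d)} {c fc : ℕ} {D : ℕ → ℕ} {R : Finset (Fin I.n → ℚ)}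
    {F : Set (Set (Fin d → ℝ))}
    (h : MainInv ε hε hpO x₀ (memBound I s ε) μ ℓ c fc D R F) (hD : D d < 1) :
    ∃ ℓ₁ μ' c' fc' D' R' F',
      Run (fun H => hpO.answer (H.relax ε hε)) (fun H => hpO.time (H.relax ε hε))
        (memBound I s ε) (mainBody d) (memBound I s ε + 1) μ ℓ₁ μ' ∧
      mainMeasure I s ε c' D' (ℓ ++ ℓ₁) < mainMeasure I s ε c D ℓ ∧
      MainInv ε hε hpO x₀ (memBound I s ε) μ' (ℓ ++ ℓ₁) c' fc' D' R' F' := by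
  have hinv := h.reaches.inv hI hx₀ hε hpO
  have hc : c ≤ cardBound d ε (imageBound I s) := by
    rw [← h.points.card]; exact hinv.card_le hI hε
  have hlen := hinv.length_add_one_le hI hε
  have hfc := h.known_le
  have hB : 1 ≤ memBound I s ε := by rw [memBound]; omega
  have hcB : d + c < memBound I s ε := by rw [memBound]; omega
  obtain ⟨μ₁, r1, hb1, hag, hu, hflag⟩ := Run.testCandidate
    (ask := fun H => hpO.answer (H.relax ε hε)) (askTime := fun H => hpO.time (H.relax ε hε))
    hB h.bdd h.points.count hcB.le h.known.count (by rw [memBound]; omega)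
    (b := imageBound I s + 1) (by omega) (by rw [memBound]; omega)
    (fun j hj => h.digits j hj.le)
    (fun j hj l => h.points.height_row_le hinv.short (h.digits_lt j hj) l)
  have hif : (cell 14 0).eval μ₁ ≤ (Expr.const 0).eval μ₁ ↔ μ₁ 14 0 ≤ 0 := by
    rw [eval_cell, Expr.eval]
  by_cases hcase : μ₁ 14 0 ≤ 0
  · obtain ⟨hnn, hnew⟩ := hflag.mp hcase
    obtain ⟨ℓ₁, μ', c', fc', D', R', F', r2, hm, hI'⟩ := h.query hd hI hx₀ hb1 hag hu hnn hnew
    exact ⟨ℓ₁, μ', c', fc', D', R', F', .seq (ℓ₁ := []) hB (by omega) r1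
      (.ifTrue hB (by omega) hb1 (hif.mpr hcase) r2), hm, hI'⟩
  · have hD0 : D d = 0 := by omega
    obtain ⟨μ', D', r2, hb2, hag2, hdig, hval, hlt⟩ := Run.increment
      (ask := fun H => hpO.answer (H.relax ε hε)) (askTime := fun H => hpO.time (H.relax ε hε))
      hd hB hb1 (c := c) (D := D) (by rw [hag 5 (by norm_num) (by norm_num) (by norm_num),
        h.points.count]) hcB
      (fun j hj => by rw [hag 10 (by norm_num) (by norm_num) (by norm_num), h.digits j hj])
      h.digits_lt hD0
    have hag' : ∀ k, k ≠ 10 → k ≠ 11 → k ≠ 14 → k ≠ 15 → μ' k = μ k :=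
      fun k k10 k11 k14 k15 => by rw [hag2 k k10, hag k k11 k14 k15]
    have h8 := hag' 8 (by norm_num) (by norm_num) (by norm_num) (by norm_num)
    have h12 := hag' 12 (by norm_num) (by norm_num) (by norm_num) (by norm_num)
    have hvalD : value d (d + c) D = ∑ j ∈ Finset.range d, D j * (d + c) ^ j := by
      rw [value, Finset.sum_range_succ, hD0, zero_mul, add_zero]
    have hsettled : Settled d μ c fc D := by
      by_contra hns
      simp only [Settled, not_or, not_exists, not_and, not_lt] at hns
      exact hcase (hflag.mpr ⟨hns.2, hns.1⟩)
    refine ⟨[], μ', c, fc, D', R, F, .seq (ℓ₁ := []) (ℓ₂ := []) hB (by omega) r1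
      (.ifFalse hB (by omega) hb1 (fun h => hcase (hif.mp h)) (r2.mono (by omega))), ?_, ?_⟩
    · have h1 := sum_digits_lt h.digits_lt
      have h2 : (d + c) ^ d ≤ (d + cardBound d ε (imageBound I s)) ^ d :=
        Nat.pow_le_pow_left (by omega) d
      rw [List.append_nil, mainMeasure, mainMeasure, hval]
      omega
    · rw [List.append_nil]
      refine ⟨h.reaches, hb2, h.points.congr
        (hag' 0 (by norm_num) (by norm_num) (by norm_num) (by norm_num))
        (hag' 1 (by norm_num) (by norm_num) (by norm_num) (by norm_num))
        (hag' 5 (by norm_num) (by norm_num) (by norm_num) (by norm_num))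
        (hag' 6 (by norm_num) (by norm_num) (by norm_num) (by norm_num)) h8,
        h.known.congr h12
          (hag' 13 (by norm_num) (by norm_num) (by norm_num) (by norm_num)),
        h.known_le, hdig, hlt, ?_⟩
      intro τ hτ hlt'
      have hs' : Settled d μ c fc τ := by
        rw [hval] at hlt'
        rcases Nat.lt_succ_iff_lt_or_eq.mp hlt' with h1 | h1
        · exact h.settled τ hτ h1
        · -- the tuple that has just been tested
          have he := digits_unique hτ h.digits_lt (h1.trans hvalD)
          have e : candAt d μ τ = candAt d μ D := by
            simp only [candAt]
            congr 1
            funext j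
            rw [he j j.2]
          rw [Settled, e]
          exact hsettled
      simp only [Settled, candAt_congr h8, row_congr h8, row_congr h12]
      exact hs'

/-- When the odometer overflows, the halfspaces of all facets are known. -/
lemma MainInv.complete {x₀ : Fin I.n → ℚ} {ε : ℝ} {hε : 0 < ε} {hpO : PlaneSepOracle I s} {B : ℕ}
    {μ : Mem} {ℓ : List (Halfspace d)} {c fc : ℕ} {D : ℕ → ℕ} {R : Finset (Fin I.n → ℚ)}
    {F : Set (Set (Fin d → ℝ))} (h : MainInv ε hε hpO x₀ B μ ℓ c fc D R F) (hR : R.Nonempty)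
    (hD : ¬ D d < 1) : facetHalfspaces (innerPoly I R) \ F = ∅ := by
  rw [Set.sdiff_eq_empty]
  intro S hS
  obtain ⟨g, hg, hne, hnn, rfl⟩ := exists_candidate_of_mem_facetHalfspaces (Y := images I R)
    (by simpa [images] using hR) hS
  choose r hr hgr using fun j => (h.points.mem_gens_iff _).mp (hg j)
  set τ : ℕ → ℕ := fun j => if hj : j < d then r ⟨j, hj⟩ else 0 with hτ
  have hτr : ∀ j : Fin d, τ j = r j := fun j => by simp only [hτ, dif_pos j.2]
  have hτlt : ∀ j < d, τ j < d + c := fun j hj => by rw [hτr ⟨j, hj⟩]; exact hr _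
  have hcand : candidate g = toReal (candAt d μ τ) := by
    rw [candAt, toReal_candidate]
    congr 1
    funext j
    rw [hgr, hτr]
  have hlt : ∑ j ∈ Finset.range d, τ j * (d + c) ^ j < value d (d + c) D := by
    refine (sum_digits_lt hτlt).trans_le ?_
    rw [value, Finset.sum_range_succ]
    have : 1 * (d + c) ^ d ≤ D d * (d + c) ^ d := Nat.mul_le_mul_right _ (by omega)
    omega
  rcases h.settled τ hτlt hlt with ⟨k, hk, he⟩ | ⟨k, hk, hneg⟩
  · rw [h.known.eq]
    refine ⟨k, Nat.pos_of_ne_zero ?_, hk, by rw [hcand, he]⟩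
    rintro rfl
    apply hne
    rw [hcand, he, h.known.zero]
    funext i; simp [toReal]
  · exfalso
    have h1 := hnn _ ((h.points.mem_gens_iff _).mpr ⟨k, hk, rfl⟩)
    rw [hcand, toReal_dotProduct] at h1
    have h2 : 0 ≤ candAt d μ τ ⬝ᵥ row d μ 8 k := by exact_mod_cast h1
    exact absurd hneg (not_lt.mpr h2)

end MainLoop

/-! ### Initialization -/

section Init

variable {d : ℕ} {I : MOMILP d} {s : Polynomial ℕ}

lemma MOMILP.m_le_size (I : MOMILP d) : I.m ≤ I.size := by
  have : I.m ≤ ∑ i, ratSize (I.b i) := by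
    simpa using Finset.card_nsmul_le_sum Finset.univ (fun i => ratSize (I.b i)) 1
      fun i _ => one_le_ratSize _
  unfold MOMILP.size; omega

lemma MOMILP.ratSize_Q_le (I : MOMILP d) (i : Fin d) (j : Fin I.n) :
    ratSize (I.Q i j) ≤ I.size :=
  (Finset.single_le_sum (f := fun j => ratSize (I.Q i j)) (fun _ _ => Nat.zero_le _)
    (Finset.mem_univ j)).trans (I.sum_ratSize_row_le i)

lemma MOMILP.ratSize_A_le (I : MOMILP d) (i : Fin I.m) (j : Fin I.n) :
    ratSize (I.A i j) ≤ I.size := by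
  have h1 : ratSize (I.A i j) ≤ ∑ j, ratSize (I.A i j) :=
    Finset.single_le_sum (f := fun j => ratSize (I.A i j)) (fun _ _ => Nat.zero_le _)
      (Finset.mem_univ j)
  have h2 : ∑ j, ratSize (I.A i j) ≤ ∑ i, ∑ j, ratSize (I.A i j) :=
    Finset.single_le_sum (f := fun i => ∑ j, ratSize (I.A i j)) (fun _ _ => Nat.zero_le _)
      (Finset.mem_univ i)
  unfold MOMILP.size; omega

lemma MOMILP.ratSize_b_le (I : MOMILP d) (i : Fin I.m) : ratSize (I.b i) ≤ I.size := by
  have h1 : ratSize (I.b i) ≤ ∑ i, ratSize (I.b i) :=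
    Finset.single_le_sum (f := fun i => ratSize (I.b i)) (fun _ _ => Nat.zero_le _)
      (Finset.mem_univ i)
  unfold MOMILP.size; omega

lemma bdd_inputMem (hd : 0 < d) {x₀ : Fin I.n → ℚ} {B : ℕ} (h : I.size ≤ B)
    (hx : vecSize x₀ ≤ B) : Bdd B (inputMem I x₀) := by
  have hn := I.n_le_size hd
  have hnR : I.nR ≤ I.n := Nat.le_add_right _ _
  have hnZ : I.nZ ≤ I.n := Nat.le_add_left _ _
  have hm := I.m_le_size
  have hq : ∀ q : ℚ, ratSize q ≤ I.size → height q ≤ 2 ^ B := fun q hq =>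
    (height_le_two_pow_ratSize q).trans (Nat.pow_le_pow_right (by norm_num) (hq.trans h))
  intro k i
  unfold inputMem
  split
  · split_ifs
    · exact height_natCast_le (by omega)
    · exact height_natCast_le (by omega)
    · exact height_natCast_le (by omega)
    · exact height_zero_le B
  · split_ifs
    · exact hq _ (I.ratSize_Q_le _ _)
    · exact height_zero_le B
  · split_ifs
    · exact hq _ (I.ratSize_A_le _ _)
    · exact height_zero_le B
  · split_ifs
    · exact hq _ (I.ratSize_b_le _)
    · exact height_zero_le B
  · split_ifs
    · exact height_le_of_vecSize_le hx _
    · exact height_zero_le B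
  · exact height_zero_le B

lemma inputMem_obj (x₀ : Fin I.n → ℚ) (i : Fin d) (j : Fin I.n) :
    inputMem I x₀ 1 (i * I.n + j) = I.Q i j := by
  have h1 : ((i : ℕ) * I.n + j) / I.n = i := by
    rw [mul_comm, Nat.mul_add_div I.n_pos, Nat.div_eq_of_lt j.2, add_zero]
  have h2 : ((i : ℕ) * I.n + j) % I.n = j := by
    rw [mul_comm, Nat.mul_add_mod, Nat.mod_eq_of_lt j.2]
  simp only [inputMem, h1, h2, i.2, dif_pos, Fin.eta]

lemma inputMem_solution (x₀ : Fin I.n → ℚ) (j : Fin I.n) : inputMem I x₀ 4 (j + 0) = x₀ j := by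
  simp [inputMem]

/-- The instructions before the main loop establish its invariant. -/
lemma exists_mainInv (hd : 0 < d) {x₀ : Fin I.n → ℚ} (hx₀ : IsShort I s x₀) {ε : ℝ}
    (hε : 0 < ε) (hpO : PlaneSepOracle I s) :
    ∃ μ₁ μ₂ μ₃,
      Run (fun H => hpO.answer (H.relax ε hε)) (fun H => hpO.time (H.relax ε hε))
        (memBound I s ε) (initDirections d) (memBound I s ε + 1) (inputMem I x₀) [] μ₁ ∧
      Run (fun H => hpO.answer (H.relax ε hε)) (fun H => hpO.time (H.relax ε hε))
        (memBound I s ε) (addPoint d 4 0) (memBound I s ε + 1) μ₁ [] μ₂ ∧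
      Run (fun H => hpO.answer (H.relax ε hε)) (fun H => hpO.time (H.relax ε hε))
        (memBound I s ε) (.store 13 (.const 0) (.const 1)) (memBound I s ε + 1) μ₂ [] μ₃ ∧
      MainInv ε hε hpO x₀ (memBound I s ε) μ₃ [] 1 1 (fun _ => 0) {x₀} ∅ := by
  set B := memBound I s ε with hBdef
  have hsz : I.size + s.eval I.size + 2 ≤ B := by rw [hBdef, memBound, imageBound]; omega
  have hB : 1 ≤ B := by omega
  have hxs := hx₀.2
  have hn := I.n_le_size hd
  set v : ℕ → ℚ := fun c => if c / (d + 1) = c % (d + 1) then 1 else 0 with hv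
  have hvB : ∀ j, height (v j) ≤ 2 ^ B := fun j => by
    simp only [hv]
    split_ifs
    · exact height_one_le hB
    · exact height_zero_le B
  have hb0 : Bdd B (inputMem I x₀) := bdd_inputMem hd (by omega) (by omega)
  have r1 := Run.storeRow (ask := fun H => hpO.answer (H.relax ε hε))
    (askTime := fun H => hpO.time (H.relax ε hε)) hB hb0 (k := 8)
    (base := .const 0) (e := fun c => .const (if c / (d + 1) = c % (d + 1) then 1 else 0))
    (b := 0) (m := d * (d + 1)) (v := v) (fun j _ => by simp [Expr.eval])
    (fun j _ => by simp only [Expr.eval, hv]) (fun j _ => hvB j)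
  set μ1 := writeRow (inputMem I x₀) 8 0 (d * (d + 1)) v with hμ1
  have hb1 : Bdd B μ1 := hb0.writeRow fun j _ => hvB j
  have hag1 : ∀ k, k ≠ 8 → μ1 k = inputMem I x₀ k := fun k hk => writeRow_array_ne hk
  have hp1 : HoldsPoints I μ1 0 ∅ := by
    refine ⟨by rw [hag1 0 (by norm_num)]; simp [inputMem],
      by rw [hag1 0 (by norm_num)]; simp [inputMem],
      by rw [hag1 1 (by norm_num)]; exact inputMem_obj x₀,
      by rw [hag1 5 (by norm_num)]; simp [inputMem], rfl, by simp, fun i => ?_, by simp⟩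
    funext l
    have hlt : (i : ℕ) * (d + 1) + l < d * (d + 1) := by
      calc (i : ℕ) * (d + 1) + l < (i + 1) * (d + 1) := by
            rw [add_mul (i : ℕ), one_mul]; omega
        _ ≤ _ := Nat.mul_le_mul_right _ i.2
    have h1 : ((i : ℕ) * (d + 1) + l) / (d + 1) = i := by
      rw [mul_comm, Nat.mul_add_div (by omega), Nat.div_eq_of_lt l.2, add_zero]
    have h2 : ((i : ℕ) * (d + 1) + l) % (d + 1) = l := by
      rw [mul_comm, Nat.mul_add_mod, Nat.mod_eq_of_lt l.2]
    have h3 := writeRow_in (μ := inputMem I x₀) (k := 8) (b := 0) (v := v) hlt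
    rw [zero_add] at h3
    rw [row, hμ1, h3]
    simp only [hv, h1, h2]
    refine Fin.lastCases ?_ (fun j => ?_) l
    · rw [emb_last, Fin.val_last, if_neg (by omega)]
    · rw [emb_castSucc, Fin.val_castSucc, Pi.single_apply]
      simp only [Fin.ext_iff, eq_comm]
  obtain ⟨μ2, r2, hb2, hag2, g5, g6, g6', g8, g8'⟩ := Run.addPoint (I := I)
    (ask := fun H => hpO.answer (H.relax ε hε)) (askTime := fun H => hpO.time (H.relax ε hε))
    hB hb1 hp1.nR hp1.nZ hp1.obj (x := x₀) (src := 4) (off := 0)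
    (fun j => by rw [hag1 4 (by norm_num)]; exact inputMem_solution x₀ j)
    ⟨by norm_num, by norm_num, by norm_num⟩ hp1.count (by omega) (by omega) (by omega)
  have hp2 := hp1.insert (Finset.notMem_empty x₀)
    (hag2 0 (by norm_num) (by norm_num) (by norm_num) (by norm_num))
    (hag2 1 (by norm_num) (by norm_num) (by norm_num) (by norm_num)) g5 g6 g6' g8 g8'
  have r3 := Run.store (ask := fun H => hpO.answer (H.relax ε hε))
    (askTime := fun H => hpO.time (H.relax ε hε)) hB hb2 13 (.const 0) (.const 1)
    (j := 0) (q := 1) (by simp [Expr.eval]) (by simp [Expr.eval])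
  have hag3 : ∀ k, k ≠ 13 → μ2.set 13 0 1 k = μ2 k := fun k hk => Mem.set_array_ne _ _ _ hk
  have hclean : ∀ k, k = 10 ∨ k = 12 → ∀ i, μ2.set 13 0 1 k i = 0 := by
    rintro k (rfl | rfl) i <;>
      rw [hag3 _ (by norm_num), hag2 _ (by norm_num) (by norm_num) (by norm_num) (by norm_num),
        hag1 _ (by norm_num)] <;> rfl
  refine ⟨μ1, μ2, _, r1.mono (by omega), r2, r3.mono (by omega), .start,
    hb2.set (height_one_le hB),
    hp2.congr (hag3 0 (by norm_num)) (hag3 1 (by norm_num)) (hag3 5 (by norm_num))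
      (hag3 6 (by norm_num)) (hag3 8 (by norm_num)),
    ⟨by rw [Mem.set_same]; simp, le_rfl, ?_, fun r h1 h2 => by omega, ?_⟩, by simp, ?_, ?_, ?_⟩
  · funext l; exact hclean 12 (Or.inr rfl) _
  · ext S
    simp only [Set.mem_empty_iff_false, Set.mem_ofPred_eq, false_iff, not_exists]
    rintro r ⟨h1, h2, -⟩
    omega
  · intro j _
    rw [hclean 10 (Or.inl rfl)]; simp
  · intro j _; omega
  · intro τ _ hτ
    simp [value] at hτ

end Init

/-! ### Polynomial bounds -/

section Formulas

variable {A : Type*} [CommSemiring A]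

/-- The formula for `cardBound`, where `M` stands for the bound on the images and `e` for `ε⁻¹`. -/
def cardFormula (d : ℕ) (M e : A) : A := (2 * M * (1 + e) + 2) ^ d

/-- The formula for `lengthBound`. -/
def lengthFormula (d : ℕ) (M e : A) : A :=
  cardFormula d M e + ((d : A) + cardFormula d M e) ^ d

/-- The formula for `memBound`. -/
def memFormula (d : ℕ) (M e : A) : A :=
  ((d + 1 : ℕ) : A) * (((d + 1).factorial : A) * (((d + 1 : ℕ) : A) * (M + 1))) + (d : A)
    + cardFormula d M e + lengthFormula d M e + M + 2

/-- The formula for the largest value of `mainMeasure`. -/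
def measureFormula (d : ℕ) (M e : A) : A :=
  lengthFormula d M e * (((d : A) + cardFormula d M e) ^ d + 1)
    + ((d : A) + cardFormula d M e) ^ d

/-- The formula for the running time, where `T` stands for the time of an oracle call. -/
def timeFormula (d : ℕ) (M e T : A) : A :=
  ((innerApxProg d).costConst d : A) * memFormula d M e
    * ((measureFormula d M e + 1) * (memFormula d M e + 1)) + lengthFormula d M e * T

variable {A' : Type*} [CommSemiring A'] {F : Type*} [FunLike F A A'] [RingHomClass F A A']

lemma map_lengthFormula (φ : F) (d : ℕ) (M e : A) :
    φ (lengthFormula d M e) = lengthFormula d (φ M) (φ e) := by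
  simp [lengthFormula, cardFormula, map_ofNat]

lemma map_timeFormula (φ : F) (d : ℕ) (M e T : A) :
    φ (timeFormula d M e T) = timeFormula d (φ M) (φ e) (φ T) := by
  simp [timeFormula, measureFormula, memFormula, lengthFormula, cardFormula, map_ofNat]

/-- The polynomial `t + s(t)`, where `t` is the variable with index `i`. -/
noncomputable def imagePoly {σ : Type*} (i : σ) (s : Polynomial ℕ) : MvPolynomial σ ℕ :=
  .X i + Polynomial.aeval (MvPolynomial.X i) s

lemma aeval_imagePoly {σ : Type*} {d : ℕ} (I : MOMILP d) (s : Polynomial ℕ) (i : σ) (v : σ → ℝ)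
    (hv : v i = I.size) : MvPolynomial.aeval v (imagePoly i s) = (imageBound I s : ℝ) := by
  rw [imagePoly, map_add, MvPolynomial.aeval_X, ← Polynomial.aeval_algHom_apply,
    MvPolynomial.aeval_X, hv, imageBound, Nat.cast_add]
  congr 1
  have := Polynomial.aeval_algebraMap_apply ℝ I.size s
  simpa using this

lemma cardBound_le (d : ℕ) {ε : ℝ} (hε : 0 < ε) (M : ℕ) :
    (cardBound d ε M : ℝ) ≤ cardFormula d (M : ℝ) ε⁻¹ := by
  have h : (gridSize ε M : ℝ) ≤ 2 * M * (1 + ε⁻¹) := Nat.floor_le (by positivity)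
  rw [cardBound, cardFormula]
  push_cast
  gcongr

lemma lengthBound_le (d : ℕ) {ε : ℝ} (hε : 0 < ε) (M : ℕ) :
    (lengthBound d ε M : ℝ) ≤ lengthFormula d (M : ℝ) ε⁻¹ := by
  have h := cardBound_le d hε M
  rw [lengthBound, lengthFormula]
  push_cast
  gcongr

lemma memBound_le {d : ℕ} (I : MOMILP d) (s : Polynomial ℕ) {ε : ℝ} (hε : 0 < ε) :
    (memBound I s ε : ℝ) ≤ memFormula d (imageBound I s : ℝ) ε⁻¹ := by
  have h1 := cardBound_le d hε (imageBound I s)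
  have h2 := lengthBound_le d hε (imageBound I s)
  rw [memBound, memFormula, candBound]
  push_cast
  linarith

lemma mainMeasure_le {d : ℕ} (I : MOMILP d) (s : Polynomial ℕ) {ε : ℝ} (hε : 0 < ε) (c : ℕ)
    (D : ℕ → ℕ) (ℓ : List (Halfspace d)) :
    (mainMeasure I s ε c D ℓ : ℝ) ≤ measureFormula d (imageBound I s : ℝ) ε⁻¹ := by
  have h1 := cardBound_le d hε (imageBound I s)
  have h2 := lengthBound_le d hε (imageBound I s)
  have h3 : mainMeasure I s ε c D ℓ ≤ lengthBound d ε (imageBound I s)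
      * ((d + cardBound d ε (imageBound I s)) ^ d + 1)
      + (d + cardBound d ε (imageBound I s)) ^ d := by
    unfold mainMeasure
    gcongr <;> exact Nat.sub_le _ _
  refine (Nat.cast_le.mpr h3).trans ?_
  rw [measureFormula]
  push_cast
  have h4 := (Nat.cast_nonneg (α := ℝ) _).trans h2
  gcongr

end Formulas

end InnerApx

open InnerApx
theorem theorem3p3 (d : ℕ) (hd : 0 < d) :
    -- one program for all instances with `d` objectives, all `ε` and all oracles
    ∃ P : Prog, ∀ s : Polynomial ℕ,
      ∃ (p : MvPolynomial (Fin 3) ℕ) (q : MvPolynomial (Fin 2) ℕ),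
      ∀ (I : MOMILP d) (_ : ∀ x ∈ I.feasible, 0 ≤ I.f x)
        (x₀ : Fin I.n → ℚ) (_ : toReal x₀ ∈ I.feasible) (_ : vecSize x₀ ≤ s.eval I.size)
        (ε : ℝ) (hε : 0 < ε) (hpO : PlaneSepOracle I s),
        -- however the halfspaces are picked, the number of iterations is polynomially bounded
        (∀ ℓ R F, Reaches I ε hε hpO.answer x₀ ℓ R F →
          (ℓ.length : ℝ) ≤ MvPolynomial.aeval ![(I.size : ℝ), ε⁻¹] q) ∧
        -- the program carries out a complete run of the algorithm in polynomial time
        ∃ (t : ℕ) (ℓ : List (Halfspace d)) (μ : Mem) (R : Finset (Fin I.n → ℚ)),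
          Exec (fun H => hpO.answer (H.relax ε hε)) (fun H => hpO.time (H.relax ε hε))
            P (inputMem I x₀) t ℓ μ ∧
          IsRun I ε hε hpO.answer x₀ ℓ R ∧ Outputs μ R ∧
          ∀ T : ℕ, (∀ H ∈ ℓ, hpO.time (H.relax ε hε) ≤ T) →
            (t : ℝ) ≤ MvPolynomial.aeval ![(I.size : ℝ), ε⁻¹, (T : ℝ)] p := by
  refine ⟨innerApxProg d, fun s => ⟨timeFormula d (imagePoly 0 s) (.X 1) (.X 2),
    lengthFormula d (imagePoly 0 s) (.X 1), ?_⟩⟩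
  intro I hI x₀ hx₀ hx₀s ε hε hpO
  have hshort : IsShort I s x₀ := ⟨hx₀, hx₀s⟩
  have hlen : ∀ ℓ R F, Reaches I ε hε hpO.answer x₀ ℓ R F →
      ℓ.length ≤ lengthBound d ε (imageBound I s) := fun ℓ R F h =>
    (Nat.le_succ _).trans ((h.inv hI hshort hε hpO).length_add_one_le hI hε)
  refine ⟨fun ℓ R F h => ?_, ?_⟩
  · rw [map_lengthFormula, aeval_imagePoly I s 0 _ rfl, MvPolynomial.aeval_X]
    exact (Nat.cast_le.mpr (hlen ℓ R F h)).trans (lengthBound_le d hε _)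
  obtain ⟨μ₁, μ₂, μ₃, r1, r2, r3, hinv⟩ := exists_mainInv hd hshort hε hpO
  set B := memBound I s ε with hBdef
  have hB : 1 ≤ B := by rw [hBdef, memBound]; omega
  have hloop : ∀ μ c fc D ℓ R F, MainInv ε hε hpO x₀ B μ ℓ c fc D R F →
      ((cell 10 d).eval μ < (Expr.const 1).eval μ ↔ D d < 1) := by
    intro μ c fc D ℓ R F h
    rw [eval_cell, Expr.eval, h.digits d le_rfl]
    exact_mod_cast Iff.rfl
  obtain ⟨ℓ, μ, W', r4, ⟨c, fc, D, R, F, hfin, -⟩, hcond⟩ := Run.while_measure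
    (ask := fun H => hpO.answer (H.relax ε hε)) (askTime := fun H => hpO.time (H.relax ε hε))
    (e₁ := cell 10 d) (e₂ := .const 1) (p := mainBody d) (N := B + 1) hB (by omega)
    (fun μ ℓ W => ∃ c fc D R F, MainInv ε hε hpO x₀ B μ ℓ c fc D R F ∧
      W = mainMeasure I s ε c D ℓ)
    (fun μ ℓ W ⟨c, fc, D, R, F, h, _⟩ => h.bdd)
    (fun μ ℓ W ⟨c, fc, D, R, F, h, hW⟩ hlt => by
      obtain ⟨ℓ₁, μ', c', fc', D', R', F', hr, hm, h'⟩ :=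
        h.step hd hI hshort ((hloop _ _ _ _ _ _ _ h).mp hlt)
      exact ⟨ℓ₁, μ', _, hr, hW ▸ hm, c', fc', D', R', F', h', rfl⟩)
    _ μ₃ [] ⟨1, 1, _, _, _, hinv, rfl⟩
  rw [List.nil_append] at hfin
  set W := mainMeasure I s ε 1 (fun _ => 0) ([] : List (Halfspace d)) with hW
  have hWB : B + 1 ≤ (W + 1) * (B + 1) := Nat.le_mul_of_pos_left _ (by omega)
  have hW1 : 1 ≤ (W + 1) * (B + 1) := by omega
  obtain ⟨t, hexec, ht⟩ := Run.seq (ℓ₁ := []) hB hW1 (r1.mono hWB)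
    (.seq (ℓ₁ := []) hB hW1 (r2.mono hWB) (.seq (ℓ₁ := []) hB hW1 (r3.mono hWB) r4))
  simp only [List.nil_append] at hexec ht
  have hRne := (hfin.reaches.inv hI hshort hε hpO).nonempty
  refine ⟨t, ℓ, μ, R, hexec, ⟨F, hfin.reaches, hfin.complete hRne
    fun h => hcond ((hloop _ _ _ _ _ _ _ hfin).mpr h)⟩, ⟨?_, ?_⟩, fun T hT => ?_⟩
  · rw [hfin.points.count, hfin.points.card]
  · rw [hfin.points.card]
    conv_lhs => rw [hfin.points.points]
    ext x
    simp only [Finset.mem_image, Finset.mem_range, Finset.mem_univ, true_and]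
    exact ⟨fun ⟨i, hi, hx⟩ => ⟨⟨i, hi⟩, hx⟩, fun ⟨i, hx⟩ => ⟨i, i.2, hx⟩⟩
  · rw [map_timeFormula, aeval_imagePoly I s 0 _ rfl, MvPolynomial.aeval_X, MvPolynomial.aeval_X]
    have hsum : (ℓ.map fun H => hpO.time (H.relax ε hε)).sum
        ≤ lengthBound d ε (imageBound I s) * T := by
      refine (List.sum_le_card_nsmul _ T fun y hy => ?_).trans ?_
      · obtain ⟨H, hH, rfl⟩ := List.mem_map.mp hy
        exact hT H hH
      · rw [List.length_map, smul_eq_mul]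
        exact Nat.mul_le_mul_right _ (hlen _ _ _ hfin.reaches)
    refine (Nat.cast_le.mpr (ht.trans (Nat.add_le_add_left hsum _))).trans ?_
    have h1 := memBound_le I s hε
    have h2 := mainMeasure_le I s hε 1 (fun _ => 0) []
    have h3 := lengthBound_le d hε (imageBound I s)
    have h4 : (0 : ℝ) ≤ memFormula d (imageBound I s : ℝ) ε⁻¹ := (Nat.cast_nonneg _).trans h1
    have h5 : (0 : ℝ) ≤ measureFormula d (imageBound I s : ℝ) ε⁻¹ := (Nat.cast_nonneg _).trans h2
    change _ ≤ timeFormula d (imageBound I s : ℝ) ε⁻¹ (T : ℝ)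
    rw [timeFormula]
    push_cast
    gcongr
    exact le_rfl
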